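/- **Setting.** Let $M\ge 1$ be an integer, let $K_n(\zeta)=\int_0^\infty\cosh(n\vartheta)e^{-\zeta\cosh\vartheta}\,d\vartheta$, and for $\zeta>0$, $\ell=0,1$ let $P_n^{(\ell)}(x)=P_n^{(\ell)}(x;\zeta)$, $n\ge 0$, be the orthonormal polynomials (degree $n$, leading coefficient $c_n^{(\ell)}>0$) for the inner product $(f,g)_{\omega^{(\ell)}}=\int_1^\infty fg\,\omega^{(\ell)}dx$ with weight $\omega^{(\ell)}(x;\zeta)=K_1(\zeta)^{-1}(x^2-1)^{\ell-1/2}e^{-\zeta x}$. Let $x^{(\ell)}_{i,n}$ be the zeros of $P_n^{(\ell)}$ and put $$a_n^{(\ell)}=(xP_n^{(\ell)},P_{n+1}^{(\ell)})_{\omega^{(\ell)}},\quad b_n^{(\ell)}=(xP_n^{(\ell)},P_n^{(\ell)})_{\omega^{(\ell)}},\quad p_n=\frac{c_n^{(0)}}{c_n^{(1)}},\quad q_n=\frac{c_n^{(1)}}{c_{n+1}^{(0)}}\Big(\sum_{i=1}^{n+2}x^{(0)}_{i,n+2}-\sum_{i=1}^{n}x^{(1)}_{i,n}\Big),\quad r_n=\frac{c_{n-1}^{(1)}}{c_{n+1}^{(0)}}.$$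 Let $J_n^{(\ell)}$ be the symmetric tridiagonal matrix of order $n+1$ with diagonal $b_0^{(\ell)},\dots,b_n^{(\ell)}$ and off-diagonal $a_0^{(\ell)},\dots,a_{n-1}^{(\ell)}$, let $J_n$ be the $(n+1)\times(n+2)$ matrix whose row $i$ ($0\le i\le n$) has the entries $p_i,q_i,r_{i+1}$ in the columns $i,i+1,i+2$ (as far as these exist; columns counted from $0$) and zeros elsewhere, and $$A_M^0=\begin{pmatrix}J_M^{(0)}&0\\0&J_{M-1}^{(1)}\end{pmatrix},\qquad A_M^1=\begin{pmatrix}0&J_{M-1}^T\\J_{M-1}&0\end{pmatrix}.$$ Let $Q_{2M}(x)=P_{M+1}^{(0)}(x)P_M^{(1)}(-x)+P_{M+1}^{(0)}(-x)P_M^{(1)}(x)$. Its zeros are $z_{i,M}$, $i=\pm1,\dots,\pm M$, with $z_{-i,M}=-z_{i,M}$ and $1<z_{1,M}<\dots<z_{M,M}$. Put $\hat\lambda_{0,M}=0$, $\hat\lambda_{i,M}=\sqrt{z_{i,M}^2-1}/z_{i,M}$ for $i\neq0$, and $y_{i,M}=(u_{i,M}^T,v_{i,M}^T)^T$, where for $i\ne0$,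 with $z=z_{i,M}$, $$u_{i,M}=\big(P_k^{(0)}(z)P_M^{(1)}(-z)+P_k^{(0)}(-z)P_M^{(1)}(z)\big)_{k=0}^{M},\quad v_{i,M}=\sqrt{z^2-1}\,\big(P_k^{(1)}(z)P_M^{(1)}(-z)-P_k^{(1)}(-z)P_M^{(1)}(z)\big)_{k=0}^{M-1},$$ and $u_{0,M}=\big(P_k^{(0)}(1)P_{M+1}^{(0)}(-1)-P_k^{(0)}(-1)P_{M+1}^{(0)}(1)\big)_{k=0}^{M}$, $v_{0,M}=0$. **The moment system.** Let $|u|<1$, $\theta>0$, $\zeta=1/\theta$, $U^0=(1-u^2)^{-1/2}$, $U^1=uU^0$, $p^0=\sqrt{1+p^2}$, $E=U^0p^0-U^1p$, $p_{<1>}=U^1E-p$, $g=\frac{1}{2K_1(\zeta)}e^{-E/\theta}$, and $\langle f,h\rangle_g=\int_{\mathbb R}g^{-1}fh\,\frac{dp}{p^0}$. Let $\tilde P_n^{(0)}=gP_n^{(0)}(E)$, $\tilde P_n^{(1)}=g\,(U^0)^{-1}p_{<1>}P_n^{(1)}(E)$ and $$\mathcal P_M[u,\theta]=(\tilde P_0^{(0)},\tilde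 P_1^{(0)},\tilde P_0^{(1)},\tilde P_2^{(0)},\tilde P_1^{(1)},\dots,\tilde P_M^{(0)},\tilde P_{M-1}^{(1)})^T,$$ and let $P_M^p$ be the permutation matrix that takes $(\tilde P_0^{(0)},\dots,\tilde P_M^{(0)},\tilde P_0^{(1)},\dots,\tilde P_{M-1}^{(1)})^T$ to $\mathcal P_M[u,\theta]$. For a state $W=(\rho,u,\theta,\Pi,\tilde n^1,f_3^0,f_2^1,\dots,f_M^0,f_{M-1}^1)^T\in\mathbb R^{2M+1}$ (only $(\rho,u,\theta)$ if $M=1$, and then $\Pi=\tilde n^1=0$ below) let $f_M(W)=(f_0^0,f_1^0,f_0^1,f_2^0,f_1^1,\dots,f_M^0,f_{M-1}^1)^T$, where $$f_0^0=\frac{\rho}{c_0^{(0)}}-c_0^{(0)}\Pi,\quad f_n^0=-P_n^{(0)}(0)\,\Pi\ (n=1,2),\quad f_n^1=-P_n^{(1)}(0)\,\tilde n^1\ (n=0,1)$$ and the remaining entries are those of $W$; let $F_W(p)=\mathcal P_M[u,\theta](p)^Tf_M(W)$ be the corresponding distribution. Let $D_M=D_M(W)$ be the matrix with entries $(D_M)_{jk}=\big\langle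 \partial F_W/\partial W_k,\ (\mathcal P_M[u,\theta])_j\big\rangle_g$, and $$M_M^t=P_M^p\,(U^0A_M^0-U^1A_M^1)\,(P_M^p)^T,\quad M_M^x=P_M^p\,(U^1A_M^0-U^0A_M^1)\,(P_M^p)^T,\quad B_M^0=M_M^tD_M,\quad B_M^1=M_M^xD_M .$$ The moment system of order $M$ of the one-dimensional special relativistic Boltzmann equation is $B_M^0\,\partial_tW+B_M^1\,\partial_xW=S(W)$; its eigenvalues and eigenvectors are the solutions $(\lambda,r)$, $r\neq0$, of $B_M^1r=\lambda B_M^0r$. **Theorem.** Let $M\ge1$ and let $W$ satisfy $\rho>0$, $|u|<1$, $\theta>0$ and $\Pi>-\rho\theta$ (the last condition is void for $M=1$). Then the zeros of $Q_{2M}$ are as described above, $A_M^0$ is invertible, and the pair $(A_M^0,A_M^1)$ has the $2M+1$ pairwise different generalized eigenvalues $\hat\lambda_{i,M}$ with eigenvectors $y_{i,M}\ne0$, that is, $A_M^1y_{i,M}=\hat\lambda_{i,M}A_M^0y_{i,M}$. The matrices $D_M$ and $B_M^0$ are invertible, and the eigenvalues of the moment system are the $2M+1$ pairwise different numbers $$\lambda_{i,M}=\frac{u-\hat\lambda_{i,M}}{1-u\hat\lambda_{i,M}},\qquad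 i=-M,\dots,M$$ (so that $\det(\lambda I-(B_M^0)^{-1}B_M^1)=\prod_{i=-M}^{M}(\lambda-\lambda_{i,M})$). They satisfy $|\lambda_{i,M}|<1$, and corresponding eigenvectors are $r_{i,M}=D_M^{-1}P_M^p\,y_{i,M}\ne0$, $i=-M,\dots,M$. -/

import Mathlib

open MeasureTheory

noncomputable section

namespace RelMoment

/-! ### Weights, inner products and orthonormal polynomials -/

/-- Modified Bessel function of the second kind `K_n(ζ)`. -/
def besselK (n : ℕ) (ζ : ℝ) : ℝ :=
  ∫ t in Set.Ioi (0 : ℝ), Real.cosh (n * t) * Real.exp (-ζ * Real.cosh t)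

/-- The weight `ω^{(ℓ)}(x; ζ) = (x² - 1)^{ℓ - 1/2} exp(-ζ x) / K₁(ζ)`. -/
def weight (ℓ : Fin 2) (ζ x : ℝ) : ℝ :=
  (x ^ 2 - 1) ^ (((ℓ : ℕ) : ℝ) - 1 / 2) / besselK 1 ζ * Real.exp (-ζ * x)

/-- The inner product `(f, g)_{ω^{(ℓ)}}` of two polynomials on `[1, ∞)`. -/
def wip (ℓ : Fin 2) (ζ : ℝ) (f g : Polynomial ℝ) : ℝ :=
  ∫ x in Set.Ioi (1 : ℝ), f.eval x * g.eval x * weight ℓ ζ x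

/-- The orthonormal polynomials `P_n^{(ℓ)}(·; ζ)` with positive leading coefficient,
obtained from `1, X, X², …` by the Gram-Schmidt process. -/
def orthPoly (ℓ : Fin 2) (ζ : ℝ) (n : ℕ) : Polynomial ℝ :=
  let q : Polynomial ℝ := Polynomial.X ^ n -
    ∑ k : Fin n, Polynomial.C (wip ℓ ζ (Polynomial.X ^ n) (orthPoly ℓ ζ k)) * orthPoly ℓ ζ k
  Polynomial.C (Real.sqrt (wip ℓ ζ q q))⁻¹ * q
termination_by n
decreasing_by all_goals exact k.2

/-- Leading coefficient `c_n^{(ℓ)}`. -/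
def lc (ℓ : Fin 2) (ζ : ℝ) (n : ℕ) : ℝ := (orthPoly ℓ ζ n).leadingCoeff

/-- Sum of the zeros `∑_i x_{i,n}^{(ℓ)}`. -/
def zeroSum (ℓ : Fin 2) (ζ : ℝ) (n : ℕ) : ℝ := (orthPoly ℓ ζ n).roots.sum

/-! ### Recurrence coefficients and matrices -/

def coefA (ℓ : Fin 2) (ζ : ℝ) (n : ℕ) : ℝ :=
  wip ℓ ζ (Polynomial.X * orthPoly ℓ ζ n) (orthPoly ℓ ζ (n + 1))

def coefB (ℓ : Fin 2) (ζ : ℝ) (n : ℕ) : ℝ :=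
  wip ℓ ζ (Polynomial.X * orthPoly ℓ ζ n) (orthPoly ℓ ζ n)

def coefP (ζ : ℝ) (n : ℕ) : ℝ := lc 0 ζ n / lc 1 ζ n

def coefQ (ζ : ℝ) (n : ℕ) : ℝ :=
  lc 1 ζ n / lc 0 ζ (n + 1) * (zeroSum 0 ζ (n + 2) - zeroSum 1 ζ n)

/-- `r_n` for `n ≥ 1`. -/
def coefR (ζ : ℝ) (n : ℕ) : ℝ := lc 1 ζ (n - 1) / lc 0 ζ (n + 1)

/-- The symmetric tridiagonal matrix of order `N` with diagonal `b_0, …, b_{N-1}` and off-diagonal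
`a_0, …, a_{N-2}`; this is `J_{N-1}^{(ℓ)}`. -/
def jacobiMat (ℓ : Fin 2) (ζ : ℝ) (N : ℕ) : Matrix (Fin N) (Fin N) ℝ :=
  fun i j =>
    if (i : ℕ) = j then coefB ℓ ζ i
    else if (j : ℕ) = i + 1 then coefA ℓ ζ i
    else if (i : ℕ) = j + 1 then coefA ℓ ζ j
    else 0

/-- The `N × (N+1)` matrix `J_{N-1}`, whose row `i` is `(0, …, 0, p_i, q_i, r_{i+1}, 0, …)` with
`p_i` on the diagonal. -/
def crossMat (ζ : ℝ) (N : ℕ) : Matrix (Fin N) (Fin (N + 1)) ℝ :=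
  fun i j =>
    if (j : ℕ) = i then coefP ζ i
    else if (j : ℕ) = i + 1 then coefQ ζ i
    else if (j : ℕ) = i + 2 then coefR ζ (i + 1)
    else 0

/-- Block index set: `inl n` stands for `P_n^{(0)}`, `0 ≤ n ≤ M`, and `inr n` for `P_n^{(1)}`,
`0 ≤ n ≤ M - 1`. -/
abbrev Blk (M : ℕ) : Type := Fin (M + 1) ⊕ Fin M

def matA0 (M : ℕ) (ζ : ℝ) : Matrix (Blk M) (Blk M) ℝ :=
  Matrix.fromBlocks (jacobiMat 0 ζ (M + 1)) 0 0 (jacobiMat 1 ζ M)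

def matA1 (M : ℕ) (ζ : ℝ) : Matrix (Blk M) (Blk M) ℝ :=
  Matrix.fromBlocks 0 (crossMat ζ M).transpose (crossMat ζ M) 0

/-! ### Generalized eigenvalues and eigenvectors of the pair -/

/-- `Q_{2M}(x; ζ) = P_{M+1}^{(0)}(x) P_M^{(1)}(-x) + P_{M+1}^{(0)}(-x) P_M^{(1)}(x)`. -/
def polyQ (M : ℕ) (ζ x : ℝ) : ℝ :=
  (orthPoly 0 ζ (M + 1)).eval x * (orthPoly 1 ζ M).eval (-x)
    + (orthPoly 0 ζ (M + 1)).eval (-x) * (orthPoly 1 ζ M).eval x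

/-- `z_i`, `i = ±1, …, ±M`, is the list of all zeros of `Q_{2M}(·; ζ)`: it is odd in `i`, and
`1 < z_1 < ⋯ < z_M`. (Only the values at `1 ≤ |i| ≤ M` matter.) -/
structure IsZeroList (M : ℕ) (ζ : ℝ) (z : ℤ → ℝ) : Prop where
  odd : ∀ i, z (-i) = -z i
  one_lt : ∀ i ∈ Set.Icc (1 : ℤ) M, 1 < z i
  strictMonoOn : StrictMonoOn z (Set.Icc (1 : ℤ) M)
  zeros : ∀ x : ℝ, polyQ M ζ x = 0 ↔ ∃ i ∈ Set.Icc (-(M : ℤ)) M, i ≠ 0 ∧ x = z i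

/-- `λ̂_{i,M}`: zero for `i = 0`, and `√(z_i² - 1) / z_i` otherwise. -/
def lamHat (z : ℤ → ℝ) (i : ℤ) : ℝ :=
  if i = 0 then 0 else Real.sqrt (z i ^ 2 - 1) / z i

/-- The generalized eigenvectors `y_{i,M} = (u_{i,M}, v_{i,M})`. -/
def genVec (M : ℕ) (ζ : ℝ) (z : ℤ → ℝ) (i : ℤ) : Blk M → ℝ :=
  if i = 0 then
    Sum.elim
      (fun k => (orthPoly 0 ζ k).eval 1 * (orthPoly 0 ζ (M + 1)).eval (-1)
        - (orthPoly 0 ζ k).eval (-1) * (orthPoly 0 ζ (M + 1)).eval 1)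
      (fun _ => 0)
  else
    Sum.elim
      (fun k => (orthPoly 0 ζ k).eval (z i) * (orthPoly 1 ζ M).eval (-z i)
        + (orthPoly 0 ζ k).eval (-z i) * (orthPoly 1 ζ M).eval (z i))
      (fun k => Real.sqrt (z i ^ 2 - 1) *
        ((orthPoly 1 ζ k).eval (z i) * (orthPoly 1 ζ M).eval (-z i)
          - (orthPoly 1 ζ k).eval (-z i) * (orthPoly 1 ζ M).eval (z i)))

/-! ### Kinematics and the weighted polynomial basis (units with `c = m = 1`) -/

def U0 (u : ℝ) : ℝ := 1 / Real.sqrt (1 - u ^ 2)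

def U1 (u : ℝ) : ℝ := u / Real.sqrt (1 - u ^ 2)

/-- `p⁰` on the mass shell. -/
def p0 (p : ℝ) : ℝ := Real.sqrt (1 + p ^ 2)

/-- `E = U_α p^α`. -/
def energy (u p : ℝ) : ℝ := U0 u * p0 p - U1 u * p

/-- `p_{<1>} = -p^{<1>}`, where `p^{<1>} = p - E U¹`. -/
def pLow (u p : ℝ) : ℝ := -(p - energy u p * U1 u)

/-- `g^{(0)}_{[u,θ]}`. -/
def gEq (u θ p : ℝ) : ℝ := 1 / (2 * besselK 1 θ⁻¹) * Real.exp (-(energy u p / θ))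

/-- The polynomial in position `j` of the ordering
`P_0^{(0)}, P_1^{(0)}, P_0^{(1)}, P_2^{(0)}, P_1^{(1)}, …` (positions start at `0`). -/
def posPoly (ζ : ℝ) (j : ℕ) : Polynomial ℝ :=
  if j = 0 ∨ Odd j then orthPoly 0 ζ ((j + 1) / 2) else orthPoly 1 ζ (j / 2 - 1)

/-- The basis function in position `j`: `g P_n^{(0)}(E)` or `g (U⁰)⁻¹ P_n^{(1)}(E) p_{<1>}`. -/
def basisFn (u θ : ℝ) (j : ℕ) (p : ℝ) : ℝ :=
  if j = 0 ∨ Odd j then gEq u θ p * (posPoly θ⁻¹ j).eval (energy u p)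
  else gEq u θ p * (U0 u)⁻¹ * (posPoly θ⁻¹ j).eval (energy u p) * pLow u p

/-- The inner product `<f, h>_{g^{(0)}_{[u,θ]}}`. -/
def gip (u θ : ℝ) (f h : ℝ → ℝ) : ℝ :=
  ∫ p : ℝ, 1 / gEq u θ p * f p * h p / p0 p

/-- The permutation matrix which takes the block ordering to the interlaced ordering of the
basis functions: `P_0^{(0)}` has position `0`, `P_n^{(0)}` has position `2n - 1` for `n ≥ 1`, and
`P_n^{(1)}` has position `2n + 2`. -/
def permMat (M : ℕ) : Matrix (Fin (2 * M + 1)) (Blk M) ℝ :=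
  fun j b =>
    if (j : ℕ) = Sum.elim (fun n : Fin (M + 1) => 2 * (n : ℕ) - 1)
      (fun n : Fin M => 2 * (n : ℕ) + 2) b then 1 else 0

/-! ### The moment system -/

/-- State vector `W_M = (ρ, u, θ, Π, ñ¹, f_3^0, f_2^1, …, f_M^0, f_{M-1}^1)`. -/
abbrev State (M : ℕ) : Type := Fin (2 * M + 1) → ℝ

/-- Component of a state vector; components beyond the length are `0` (so `Π = 0` if `M = 1`). -/
def State.comp {M : ℕ} (W : State M) (k : ℕ) : ℝ :=
  if h : k < 2 * M + 1 then W ⟨k, h⟩ else 0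

def State.rho {M : ℕ} (W : State M) : ℝ := W.comp 0

def State.vel {M : ℕ} (W : State M) : ℝ := W.comp 1

def State.theta {M : ℕ} (W : State M) : ℝ := W.comp 2

def State.bulk {M : ℕ} (W : State M) : ℝ := W.comp 3

/-- The matrix `D_M^W(θ)` with `f_M = D_M^W W_M`. The columns of `Π` and `ñ¹` hold the negatives of
the values at `0` of `P_0^{(0)}, P_1^{(0)}, P_2^{(0)}` and `P_0^{(1)}, P_1^{(1)}`, for instance
`-P_1^{(0)}(0) = c_1^{(0)} x_{1,1}^{(0)}`, because `∫ f dp/p⁰ = ρ (G - 2/ζ) - Π`,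
`∫ E f dp/p⁰ = ρ`, `∫ E² f dp/p⁰ = ρ (G - 1/ζ)`, `∫ (U⁰)⁻¹ p_{<1>} f dp/p⁰ = -ñ¹` and
`∫ E (U⁰)⁻¹ p_{<1>} f dp/p⁰ = 0`. -/
def matDW (M : ℕ) (θ : ℝ) : Matrix (Fin (2 * M + 1)) (Fin (2 * M + 1)) ℝ :=
  fun j k =>
    if (k : ℕ) = 0 then (if (j : ℕ) = 0 then (lc 0 θ⁻¹ 0)⁻¹ else 0)
    else if (k : ℕ) = 1 ∨ (k : ℕ) = 2 then 0
    else if (k : ℕ) = 3 then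
      (if (j : ℕ) = 0 ∨ (j : ℕ) = 1 ∨ (j : ℕ) = 3 then -(posPoly θ⁻¹ j).eval 0 else 0)
    else if (k : ℕ) = 4 then
      (if (j : ℕ) = 2 ∨ (j : ℕ) = 4 then -(posPoly θ⁻¹ j).eval 0 else 0)
    else (if j = k then 1 else 0)

/-- The projected distribution `Π_M[u,θ] f = [𝒫_M[u,θ], D_M^W W_M]` as a function of the state `W`
and of the momentum `p`. -/
def projDist {M : ℕ} (W : State M) (p : ℝ) : ℝ :=
  ∑ j : Fin (2 * M + 1), basisFn W.vel W.theta j p * (matDW M W.theta).mulVec W j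

/-- The matrix `D_M`: its column `k` is the coefficient vector of
`Π_M[u,θ] (∂ (Π_M[u,θ] f) / ∂ W_k)` in the basis `𝒫_M[u,θ]`, so that
`Π_M[u,θ] (∂ (Π_M[u,θ] f) / ∂ s) = [𝒫_M[u,θ], D_M ∂W_M/∂s]_M` for `s = t, x`. -/
def matD {M : ℕ} (W : State M) : Matrix (Fin (2 * M + 1)) (Fin (2 * M + 1)) ℝ :=
  fun j k => gip W.vel W.theta
    (fun p => deriv (fun s : ℝ => projDist (M := M) (Function.update W k s) p) (W k))
    (basisFn W.vel W.theta j)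

def matMt (M : ℕ) (u θ : ℝ) : Matrix (Fin (2 * M + 1)) (Fin (2 * M + 1)) ℝ :=
  -U1 u • (permMat M * matA1 M θ⁻¹ * (permMat M).transpose)
    + U0 u • (permMat M * matA0 M θ⁻¹ * (permMat M).transpose)

def matMx (M : ℕ) (u θ : ℝ) : Matrix (Fin (2 * M + 1)) (Fin (2 * M + 1)) ℝ :=
  -U0 u • (permMat M * matA1 M θ⁻¹ * (permMat M).transpose)
    + U1 u • (permMat M * matA0 M θ⁻¹ * (permMat M).transpose)

/-- `B_M^0` in the moment system `B_M^0 ∂W/∂t + B_M^1 ∂W/∂x = S(W)`. -/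
def matB0 {M : ℕ} (W : State M) : Matrix (Fin (2 * M + 1)) (Fin (2 * M + 1)) ℝ :=
  matMt M W.vel W.theta * matD W

/-- `B_M^1` in the moment system. -/
def matB1 {M : ℕ} (W : State M) : Matrix (Fin (2 * M + 1)) (Fin (2 * M + 1)) ℝ :=
  matMx M W.vel W.theta * matD W

/-- `λ_{i,M} = (u - λ̂_{i,M}) / (1 - u λ̂_{i,M})`. -/
def lam (u : ℝ) (z : ℤ → ℝ) (i : ℤ) : ℝ := (u - lamHat z i) / (1 - u * lamHat z i)

/-- `r_{i,M} = D_M⁻¹ P_M^p y_{i,M}`. -/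
def eigVec {M : ℕ} (W : State M) (z : ℤ → ℝ) (i : ℤ) : Fin (2 * M + 1) → ℝ :=
  ((matD W)⁻¹ * permMat M).mulVec (genVec M W.theta⁻¹ z i)

/-- The numbers `μ_i`, `-M ≤ i ≤ M`, with vectors `y_i`, are the eigenvalues and eigenvectors of the
generalized eigenvalue problem `A¹ y = μ A⁰ y` of order `2M + 1`: the matrix `A⁰` is invertible,
the `μ_i` are pairwise different and are all the roots of the characteristic polynomial of
`(A⁰)⁻¹ A¹`, and `y_i` is an eigenvector for `μ_i`. -/
structure IsEigenSystem {ι : Type} [Fintype ι] [DecidableEq ι] (M : ℕ) (A0 A1 : Matrix ι ι ℝ)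
    (μ : ℤ → ℝ) (y : ℤ → ι → ℝ) : Prop where
  isUnit_det : IsUnit A0.det
  injOn : Set.InjOn μ (Set.Icc (-(M : ℤ)) M)
  charpoly_eq : (A0⁻¹ * A1).charpoly =
    ∏ i ∈ Finset.Icc (-(M : ℤ)) M, (Polynomial.X - Polynomial.C (μ i))
  ne_zero : ∀ i ∈ Set.Icc (-(M : ℤ)) M, y i ≠ 0
  eigen : ∀ i ∈ Set.Icc (-(M : ℤ)) M, A1.mulVec (y i) = μ i • A0.mulVec (y i)

end RelMoment

end

/-! The substitution E = cosh t, (U⁰)⁻¹p_{<1>} = -sinh t, dp/p⁰ = dt turns every integral into one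
against exp(-ζ cosh t) on the line. For functions g·(A(E) + (U⁰)⁻¹p_{<1>}·B(E)) with polynomials A,
B the mixed terms are odd in t, and sinh² = E² - 1 carries one weight into the other, so the inner
product of two of them is (A,F) for `ℓ = 0` plus (B,G) for `ℓ = 1` (`wip_eq`, `gip_mix`). In this
basis A⁰ and A¹ are truncations of multiplication by E and by the momentum: p, q, r are the numbers
(P_j⁰, P_i¹) for `ℓ = 1` (`crossMat_apply`).

The eigenvectors come from evaluating the recurrences at ±z. Truncation leaves remainders with
P_{M+1}⁰ and P_M¹; in the combination `genVec` those with P_M¹ alone cancel, and the others add up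
to a multiple of Q_{2M}(z) (`eigen_genVec`). At z = ±1 the factor z² - 1 vanishes, which gives the
eigenvalue 0. The zeros of Q_{2M} are found by interlacing: at the zeros of P_{M+1}⁰ only
P_{M+1}⁰(-x)P_M¹(x) is left, whose sign alternates (`polyQ_mul_neg`); evenness and the degree bound
2M show that there are no others. So there are 2M+1 distinct eigenvalues, and they exhaust the
spectrum (`isEigenSystem_of_eigen`).

For D_M, the u- and θ-derivatives of the distribution keep the form above, so D_M w consists of
moments of a single pair of polynomials. For a kernel vector w these moments are tested with 1, x,
x² and 1, x. No formula for ∂P_n/∂θ is needed: the low moments of the distribution are explicit in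
ρ, Π, ñ¹ (`wip_polyA`, `wip_polyB`), hence so are their derivatives, and u-derivatives are moved to
the test polynomial by parts. The first five components vanish one by one, the velocity component by
Π > -ρθ and the temperature component by the strict Cauchy-Schwarz inequality (`isUnit_det_matD`);
the others are then coefficients of the expansion.

Finally M^t and M^x are a Lorentz boost of (A⁰, A¹): eigenvectors stay and λ̂ goes to (u - λ̂)/(1 -
uλ̂). As |λ̂| < 1, M^t is invertible and the new eigenvalues lie in (-1, 1). -/

noncomputable section

namespace RelMoment

open Polynomial

section

open Real

/-! ### Exponential moments of polynomials in `cosh` -/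

/-- The functional `f ↦ ∫ f(cosh t) exp(-ζ cosh t) dt` on polynomials. -/
def expMom (ζ : ℝ) (f : ℝ[X]) : ℝ := ∫ t : ℝ, f.eval (cosh t) * exp (-ζ * cosh t)

/-- Provides a Gaussian majorant for `exp (-ζ * cosh t)`. -/
lemma sq_div_four_le_cosh (t : ℝ) : t ^ 2 / 4 ≤ cosh t := by
  rw [← cosh_abs, cosh_eq]
  have h1 := quadratic_le_exp_of_nonneg (abs_nonneg t)
  have h2 := exp_pos (-|t|)
  have h3 := abs_nonneg t
  rw [sq_abs] at h1
  linarith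

lemma integrable_exp_neg_mul_cosh {ζ : ℝ} (hζ : 0 < ζ) :
    Integrable (fun t : ℝ => exp (-ζ * cosh t)) := by
  refine (integrable_exp_neg_mul_sq (b := ζ / 4) (by positivity)).mono' (by fun_prop) ?_
  refine Filter.Eventually.of_forall fun t => ?_
  rw [norm_of_nonneg (exp_pos _).le]
  apply exp_le_exp.2
  nlinarith [sq_div_four_le_cosh t]

/-- Half of the exponential absorbs the power: one term of the exponential series bounds `cosh t ^
k` by a constant times `exp (ζ / 2 * cosh t)`. -/
lemma integrable_cosh_pow {ζ : ℝ} (hζ : 0 < ζ) (k : ℕ) :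
    Integrable (fun t : ℝ => cosh t ^ k * exp (-ζ * cosh t)) := by
  refine ((integrable_exp_neg_mul_cosh (half_pos hζ)).const_mul
    (k.factorial / (ζ / 2) ^ k)).mono' (by fun_prop) ?_
  refine Filter.Eventually.of_forall fun t => ?_
  have hc := cosh_pos t
  rw [norm_of_nonneg (by positivity)]
  have h := pow_div_factorial_le_exp (ζ / 2 * cosh t) (by positivity) k
  have h2 : cosh t ^ k ≤ k.factorial / (ζ / 2) ^ k * exp (ζ / 2 * cosh t) := by
    rw [mul_pow] at h
    rw [div_mul_eq_mul_div, le_div_iff₀ (by positivity)]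
    rw [div_le_iff₀ (by positivity)] at h
    linarith
  calc cosh t ^ k * exp (-ζ * cosh t)
      ≤ (k.factorial / (ζ / 2) ^ k * exp (ζ / 2 * cosh t)) * exp (-ζ * cosh t) := by gcongr
    _ = _ := by rw [mul_assoc, ← exp_add]; ring_nf

lemma integrable_eval_cosh {ζ : ℝ} (hζ : 0 < ζ) (f : ℝ[X]) :
    Integrable (fun t : ℝ => f.eval (cosh t) * exp (-ζ * cosh t)) := by
  simp only [eval_eq_sum_range, Finset.sum_mul, mul_assoc]
  exact integrable_finsetSum _ fun i _ => (integrable_cosh_pow hζ i).const_mul _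

lemma integrable_sinh_mul_eval_cosh {ζ : ℝ} (hζ : 0 < ζ) (f : ℝ[X]) :
    Integrable (fun t : ℝ => sinh t * f.eval (cosh t) * exp (-ζ * cosh t)) := by
  refine (integrable_eval_cosh hζ (X * f)).mono (by fun_prop) ?_
  refine Filter.Eventually.of_forall fun t => ?_
  simp only [norm_mul, eval_mul, eval_X, norm_eq_abs]
  have h : |sinh t| ≤ |cosh t| := by
    refine abs_le_abs (sinh_lt_cosh t).le ?_
    rw [← sinh_neg, ← cosh_neg]
    exact (sinh_lt_cosh _).le
  gcongr ?_ * _ * _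

lemma expMom_add {ζ : ℝ} (hζ : 0 < ζ) (f g : ℝ[X]) :
    expMom ζ (f + g) = expMom ζ f + expMom ζ g := by
  simp only [expMom, eval_add, add_mul]
  exact integral_add (integrable_eval_cosh hζ f) (integrable_eval_cosh hζ g)

lemma expMom_C_mul (ζ c : ℝ) (f : ℝ[X]) : expMom ζ (C c * f) = c * expMom ζ f := by
  simp only [expMom, eval_mul, eval_C, mul_assoc, integral_const_mul]

/-- `expMom ζ` as a linear functional. -/
def expMomL {ζ : ℝ} (hζ : 0 < ζ) : ℝ[X] →ₗ[ℝ] ℝ where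
  toFun := expMom ζ
  map_add' := expMom_add hζ
  map_smul' c f := by rw [smul_eq_C_mul, expMom_C_mul]; rfl

lemma exists_eval_cosh_ne_zero {f : ℝ[X]} (hf : f ≠ 0) : ∃ t : ℝ, f.eval (cosh t) ≠ 0 := by
  by_contra! h
  refine hf (eq_zero_of_infinite_isRoot f
    (Set.Infinite.mono (s := Set.Ici 1) ?_ (Set.Ici_infinite 1)))
  intro x hx
  have := h (arcosh x)
  rwa [cosh_arcosh hx] at this

/-- A nonzero polynomial cannot vanish on all of [1, ∞), the range of `cosh`, so the continuous
nonnegative integrand is nonzero somewhere. -/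
lemma expMom_pos {ζ : ℝ} (hζ : 0 < ζ) {f : ℝ[X]} (hf : f ≠ 0)
    (h : ∀ x : ℝ, 1 ≤ x → 0 ≤ f.eval x) : 0 < expMom ζ f := by
  obtain ⟨t, ht⟩ := exists_eval_cosh_ne_zero hf
  refine integral_pos_of_integrable_nonneg_nonzero (x := t) (by fun_prop)
    (integrable_eval_cosh hζ f) (fun s => ?_) (mul_ne_zero ht (exp_pos _).ne')
  exact mul_nonneg (h _ (one_le_cosh s)) (exp_pos _).le

/-- Integration by parts: the integral of the derivative of `sinh t f(cosh t) exp(-ζ cosh t)`. -/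
lemma expMom_by_parts {ζ : ℝ} (hζ : 0 < ζ) (f : ℝ[X]) :
    expMom ζ (X * f + (X ^ 2 - 1) * (derivative f - C ζ * f)) = 0 := by
  refine integral_eq_zero_of_hasDerivAt_of_integrable
    (f := fun t => sinh t * f.eval (cosh t) * exp (-ζ * cosh t)) (fun t => ?_)
    (integrable_eval_cosh hζ _) (integrable_sinh_mul_eval_cosh hζ f)
  have h1 := ((hasDerivAt_sinh t).mul ((f.hasDerivAt (cosh t)).comp t (hasDerivAt_cosh t))).mul
    (((hasDerivAt_cosh t).const_mul (-ζ)).exp)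
  refine h1.congr_deriv ?_
  simp only [Function.comp_apply, Pi.mul_apply, eval_add, eval_mul, eval_sub, eval_pow,
    eval_X, eval_one, eval_C]
  rw [cosh_sq]
  ring

/-- Differentiation under the integral sign; for `s > ζ / 2` the integrand of the derivative is
dominated by its absolute value at `ζ / 2`. -/
lemma hasDerivAt_expMom {ζ : ℝ} (hζ : 0 < ζ) (f : ℝ[X]) :
    HasDerivAt (fun s => expMom s f) (-expMom ζ (X * f)) ζ := by
  have key := (hasDerivAt_integral_of_dominated_loc_of_deriv_le (μ := volume)
    (F := fun s t => f.eval (cosh t) * exp (-s * cosh t))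
    (F' := fun s t => -((X * f).eval (cosh t) * exp (-s * cosh t)))
    (bound := fun t => ‖(X * f).eval (cosh t) * exp (-(ζ / 2) * cosh t)‖)
    (s := Set.Ioi (ζ / 2)) (x₀ := ζ) (Ioi_mem_nhds (half_lt_self hζ))
    (Filter.Eventually.of_forall fun s => by fun_prop) (integrable_eval_cosh hζ f) (by fun_prop)
    (Filter.Eventually.of_forall fun t s hs => ?_)
    (integrable_eval_cosh (half_pos hζ) (X * f)).norm
    (Filter.Eventually.of_forall fun t s hs => ?_)).2
  · rw [integral_neg] at key
    exact key
  · rw [norm_neg, norm_mul, norm_mul]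
    gcongr 2
    rw [norm_of_nonneg (exp_pos _).le, norm_of_nonneg (exp_pos _).le]
    apply exp_le_exp.2
    have := cosh_pos t
    have : ζ / 2 < s := hs
    nlinarith
  · have h := (((hasDerivAt_id s).neg.mul_const (cosh t)).exp).const_mul (f.eval (cosh t))
    refine h.congr_deriv ?_
    simp only [id, Pi.neg_apply, eval_mul, eval_X]
    ring

lemma expMom_eq_two_mul (ζ : ℝ) (f : ℝ[X]) :
    expMom ζ f = 2 * ∫ t in Set.Ioi (0 : ℝ), f.eval (cosh t) * exp (-ζ * cosh t) := by
  rw [← integral_comp_abs (f := fun t => f.eval (cosh t) * exp (-ζ * cosh t))]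
  simp only [cosh_abs, expMom]

lemma two_mul_besselK_one (ζ : ℝ) : 2 * besselK 1 ζ = expMom ζ X := by
  rw [expMom_eq_two_mul, besselK]
  simp

lemma cosh_image_Ioi : cosh '' Set.Ioi 0 = Set.Ioi 1 := by
  ext x
  constructor
  · rintro ⟨t, ht, rfl⟩
    exact one_lt_cosh.2 (ne_of_gt ht)
  · intro hx
    exact ⟨arcosh x, arcosh_pos hx, cosh_arcosh (le_of_lt hx)⟩

lemma sinh_mul_weight (ℓ : Fin 2) (ζ : ℝ) {t : ℝ} (ht : 0 < t) :
    sinh t * weight ℓ ζ (cosh t) =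
      (cosh t ^ 2 - 1) ^ (ℓ : ℕ) / besselK 1 ζ * exp (-ζ * cosh t) := by
  have hs : 0 < sinh t := sinh_pos_iff.2 ht
  have h1 : cosh t ^ 2 - 1 = sinh t ^ 2 := by rw [cosh_sq]; ring
  rw [weight, h1, rpow_sub (by positivity), ← sqrt_eq_rpow, sqrt_sq hs.le, rpow_natCast]
  field_simp

/-- Substitute x = cosh t: the Jacobian sinh t cancels the power -1/2 of the weight. Passing from
the half line to the line gives a factor 2, which the normalization 2K₁ = `expMom ζ X` absorbs. -/
lemma wip_eq (ℓ : Fin 2) (ζ : ℝ) (f g : ℝ[X]) :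
    wip ℓ ζ f g = expMom ζ ((X ^ 2 - 1) ^ (ℓ : ℕ) * (f * g)) / expMom ζ X := by
  rw [wip, ← cosh_image_Ioi, integral_image_eq_integral_abs_deriv_smul measurableSet_Ioi
    (fun t _ => (hasDerivAt_cosh t).hasDerivWithinAt)
    (cosh_strictMonoOn.injOn.mono Set.Ioi_subset_Ici_self), ← two_mul_besselK_one,
    expMom_eq_two_mul, mul_div_mul_left _ _ two_ne_zero, ← integral_div]
  refine setIntegral_congr_fun measurableSet_Ioi fun t ht => ?_
  have h := sinh_mul_weight ℓ ζ ht
  simp only [smul_eq_mul]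
  rw [abs_of_pos (sinh_pos_iff.2 ht)]
  simp only [eval_mul, eval_pow, eval_sub, eval_X, eval_one]
  linear_combination (eval (cosh t) f * eval (cosh t) g) * h

end

/-! ### Orthonormal polynomials of a positive functional -/

/-- `Λ` is positive on nonzero polynomials which are nonnegative on `[1, ∞)`. -/
def IsPosFunctional (Λ : ℝ[X] →ₗ[ℝ] ℝ) : Prop :=
  ∀ f : ℝ[X], f ≠ 0 → (∀ x : ℝ, 1 ≤ x → 0 ≤ f.eval x) → 0 < Λ f

/-- `P` is the sequence of orthonormal polynomials with positive leading coefficients for `Λ`. -/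
structure IsONS (Λ : ℝ[X] →ₗ[ℝ] ℝ) (P : ℕ → ℝ[X]) : Prop where
  natDegree_eq : ∀ n, (P n).natDegree = n
  lc_pos : ∀ n, 0 < (P n).leadingCoeff
  ortho : ∀ m n, Λ (P m * P n) = if m = n then 1 else 0

lemma map_C_mul (Λ : ℝ[X] →ₗ[ℝ] ℝ) (c : ℝ) (f : ℝ[X]) : Λ (C c * f) = c * Λ f := by
  rw [← smul_eq_C_mul, map_smul, smul_eq_mul]

lemma map_X_mul_mul_comm (Λ : ℝ[X] →ₗ[ℝ] ℝ) (f g : ℝ[X]) : Λ (X * f * g) = Λ (X * g * f) := by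
  congr 1; ring

namespace IsONS

variable {Λ : ℝ[X] →ₗ[ℝ] ℝ} {P : ℕ → ℝ[X]}

lemma ne_zero (h : IsONS Λ P) (n : ℕ) : P n ≠ 0 := leadingCoeff_ne_zero.1 (h.lc_pos n).ne'

lemma degree_eq (h : IsONS Λ P) (n : ℕ) : (P n).degree = n := by
  rw [degree_eq_natDegree (h.ne_zero n), h.natDegree_eq]

lemma coeff_self (h : IsONS Λ P) (n : ℕ) : (P n).coeff n = (P n).leadingCoeff := by
  rw [leadingCoeff, h.natDegree_eq]

lemma exists_expansion (h : IsONS Λ P) (N : ℕ) :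
    ∀ f : ℝ[X], f.degree < N → ∃ a : ℕ → ℝ, f = ∑ k ∈ Finset.range N, C (a k) * P k := by
  induction N with
  | zero =>
    intro f hf
    exact ⟨0, by simpa using hf⟩
  | succ N ih =>
    -- Subtracting the multiple of `P N` with the same coefficient of degree N lowers the degree
    -- bound.
    intro f hf
    set g := f - C (f.coeff N / (P N).leadingCoeff) * P N with hg
    have hdeg : g.degree < N := by
      rw [degree_lt_iff_coeff_zero]
      intro m hm
      rcases hm.eq_or_lt with rfl | hm
      · rw [hg, coeff_sub, coeff_C_mul, h.coeff_self, div_mul_cancel₀ _ (h.lc_pos _).ne', sub_self]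
      · rw [hg, coeff_sub, coeff_C_mul, (degree_lt_iff_coeff_zero f _).1 hf m hm,
          coeff_eq_zero_of_natDegree_lt (p := P N) (by rwa [h.natDegree_eq])]
        simp
    obtain ⟨a, ha⟩ := ih g hdeg
    refine ⟨fun k => if k = N then f.coeff N / (P N).leadingCoeff else a k, ?_⟩
    simp only [Finset.sum_range_succ, if_true]
    have : ∑ k ∈ Finset.range N, C (if k = N then f.coeff N / (P N).leadingCoeff else a k) * P k
        = ∑ k ∈ Finset.range N, C (a k) * P k :=
      Finset.sum_congr rfl fun k hk => by rw [if_neg (Finset.mem_range.1 hk).ne]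
    rw [this, ← ha, hg]
    ring

lemma map_sum_mul (h : IsONS Λ P) (N : ℕ) (a : ℕ → ℝ) (m : ℕ) :
    Λ ((∑ k ∈ Finset.range N, C (a k) * P k) * P m) = if m < N then a m else 0 := by
  simp only [Finset.sum_mul, map_sum, mul_assoc, map_C_mul, h.ortho]
  simp

/-- Expansion in orthonormal polynomials. -/
lemma expansion (h : IsONS Λ P) {N : ℕ} {f : ℝ[X]} (hf : f.degree < N) :
    f = ∑ k ∈ Finset.range N, C (Λ (f * P k)) * P k := by
  obtain ⟨a, ha⟩ := h.exists_expansion N f hf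
  conv_lhs => rw [ha]
  refine Finset.sum_congr rfl fun k hk => ?_
  rw [ha, h.map_sum_mul, if_pos (Finset.mem_range.1 hk)]

lemma map_mul_eq_zero (h : IsONS Λ P) {n : ℕ} {f : ℝ[X]} (hf : f.degree < n) : Λ (f * P n) = 0 := by
  obtain ⟨a, ha⟩ := h.exists_expansion n f hf
  rw [ha, h.map_sum_mul, if_neg (lt_irrefl n)]

/-- Below the top index the terms of the orthonormal expansion have degree less than n, so the
coefficient of degree n sees only the term of `P n`. -/
lemma map_mul_eq_coeff_div (h : IsONS Λ P) {n : ℕ} {f : ℝ[X]} (hf : f.degree < (n + 1 : ℕ)) :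
    Λ (f * P n) = f.coeff n / (P n).leadingCoeff := by
  have h1 := congrArg (fun g => g.coeff n) (h.expansion hf)
  simp only [finsetSum_coeff, coeff_C_mul] at h1
  rw [Finset.sum_range_succ, Finset.sum_eq_zero, zero_add, h.coeff_self] at h1
  · rw [h1, mul_div_cancel_right₀ _ (h.lc_pos n).ne']
  · intro k hk
    rw [coeff_eq_zero_of_natDegree_lt (p := P k)
      (by rw [h.natDegree_eq]; exact Finset.mem_range.1 hk), mul_zero]

/-- The orthonormal expansion reproduces functionals tested against low degree polynomials. -/
lemma reproducing (h : IsONS Λ P) {N : ℕ} {f : ℝ[X]} (hf : f.degree < N) (x : ℝ) :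
    Λ ((∑ k ∈ Finset.range N, C ((P k).eval x) * P k) * f) = f.eval x := by
  conv_rhs => rw [h.expansion hf]
  simp only [Finset.sum_mul, map_sum, mul_assoc, map_C_mul, eval_finsetSum, eval_mul, eval_C]
  exact Finset.sum_congr rfl fun k _ => by rw [mul_comm (P k) f, mul_comm]

lemma degree_X_mul (h : IsONS Λ P) (n : ℕ) : (X * P n).degree = ((n + 1 : ℕ) : WithBot ℕ) := by
  rw [degree_mul, degree_X, h.degree_eq, add_comm]; rfl

lemma map_X_mul_mul_eq_zero (h : IsONS Λ P) {m n : ℕ} (hmn : m + 1 < n) : Λ (X * P m * P n) = 0 :=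
  h.map_mul_eq_zero (by rw [h.degree_X_mul]; exact_mod_cast hmn)

lemma map_X_mul_mul_succ (h : IsONS Λ P) (n : ℕ) :
    Λ (X * P n * P (n + 1)) = (P n).leadingCoeff / (P (n + 1)).leadingCoeff := by
  rw [h.map_mul_eq_coeff_div (by rw [h.degree_X_mul]; exact_mod_cast Nat.lt_succ_self _),
    coeff_X_mul, h.coeff_self]

lemma map_X_mul_mul_succ_pos (h : IsONS Λ P) (n : ℕ) : 0 < Λ (X * P n * P (n + 1)) := by
  rw [h.map_X_mul_mul_succ]
  exact div_pos (h.lc_pos _) (h.lc_pos _)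

lemma recurrence_zero (h : IsONS Λ P) :
    X * P 0 = C (Λ (X * P 0 * P 1)) * P 1 + C (Λ (X * P 0 * P 0)) * P 0 := by
  conv_lhs => rw [h.expansion (N := 2) (f := X * P 0) (by rw [h.degree_X_mul]; norm_num)]
  rw [Finset.sum_range_succ, Finset.sum_range_one, add_comm]

/-- Three term recurrence. -/
lemma recurrence (h : IsONS Λ P) (n : ℕ) :
    X * P (n + 1) = C (Λ (X * P (n + 1) * P (n + 2))) * P (n + 2)
    + C (Λ (X * P (n + 1) * P (n + 1))) * P (n + 1) + C (Λ (X * P n * P (n + 1))) * P n := by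
  conv_lhs => rw [h.expansion (N := n + 3) (f := X * P (n + 1))
    (by rw [h.degree_X_mul]; exact_mod_cast Nat.lt_succ_self _)]
  rw [Finset.sum_range_succ, Finset.sum_range_succ, Finset.sum_range_succ, Finset.sum_eq_zero,
    map_X_mul_mul_comm Λ (P (n + 1)) (P n)]
  · ring
  · intro k hk
    rw [map_X_mul_mul_comm, h.map_X_mul_mul_eq_zero (by simpa using hk)]
    simp

/-- The confluent Christoffel-Darboux formula. -/
lemma christoffel_darboux (h : IsONS Λ P) (n : ℕ) :
    C (Λ (X * P n * P (n + 1))) * (derivative (P (n + 1)) * P n - derivative (P n) * P (n + 1))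
      = ∑ k ∈ Finset.range (n + 1), P k ^ 2 := by
  induction n with
  | zero =>
    have h0 := congrArg derivative h.recurrence_zero
    have h1 := h.recurrence_zero
    simp only [derivative_mul, derivative_X, derivative_add, derivative_C, zero_mul, zero_add,
      one_mul] at h0
    rw [Finset.sum_range_one]
    simp only [zero_add] at *
    linear_combination derivative (P 0) * h1 - P 0 * h0
  | succ n ih =>
    have h0 := congrArg derivative (h.recurrence n)
    have h1 := h.recurrence n
    simp only [derivative_mul, derivative_X, derivative_add, derivative_C, zero_mul, zero_add,
      one_mul] at h0
    rw [Finset.sum_range_succ, ← ih]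
    -- The recurrence times P'_{n+1}, minus its derivative times P_{n+1}, eliminates the b-term and
    -- leaves P_{n+1}² plus the previous Wronskian.
    linear_combination derivative (P (n + 1)) * h1 - P (n + 1) * h0

/-- If P_n = s q, then q has smaller degree and is orthogonal to P_n, whereas q P_n = s q² has
positive integral. Suitable choices of s show that the zeros of P_n are larger than 1, simple and
real. -/
lemma not_dvd_of_nonneg (h : IsONS Λ P) (hΛ : IsPosFunctional Λ) {n : ℕ} {s : ℝ[X]}
    (hs : 0 < s.natDegree)
    (hpos : ∀ x : ℝ, 1 ≤ x → 0 ≤ s.eval x) : ¬ s ∣ P n := by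
  rintro ⟨q, hq⟩
  have hs0 : s ≠ 0 := by rintro rfl; simp at hs
  have hq0 : q ≠ 0 := by rintro rfl; exact h.ne_zero n (by simpa using hq)
  have hdeg : q.degree < n := by
    rw [degree_eq_natDegree hq0]
    have := congrArg natDegree hq
    rw [h.natDegree_eq, natDegree_mul hs0 hq0] at this
    exact_mod_cast (by omega : q.natDegree < n)
  have h1 := h.map_mul_eq_zero hdeg
  have h2 := hΛ (q * P n) (mul_ne_zero hq0 (h.ne_zero n)) fun x hx => by
    rw [hq, eval_mul, eval_mul]
    nlinarith [mul_nonneg (hpos x hx) (mul_self_nonneg (q.eval x))]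
  exact h2.ne' h1

lemma one_lt_of_isRoot (h : IsONS Λ P) (hΛ : IsPosFunctional Λ) {n : ℕ} {w : ℝ}
    (hw : (P n).IsRoot w) : 1 < w := by
  by_contra! hle
  refine h.not_dvd_of_nonneg hΛ (s := X - C w) (by simp) (fun x hx => ?_) (dvd_iff_isRoot.2 hw)
  simp only [eval_sub, eval_X, eval_C]
  linarith

lemma nodup_roots (h : IsONS Λ P) (hΛ : IsPosFunctional Λ) (n : ℕ) : (P n).roots.Nodup := by
  rw [Multiset.nodup_iff_count_le_one]
  intro w
  rw [count_roots]
  by_contra! hlt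
  refine h.not_dvd_of_nonneg hΛ (n := n) (s := (X - C w) ^ 2) (by simp [natDegree_pow])
    (fun x hx => ?_)
    ((pow_dvd_pow _ hlt).trans (pow_rootMultiplicity_dvd _ _))
  simp only [eval_pow]
  positivity

/-- A nonreal zero would yield a real quadratic factor (x - Re z)² + (Im z)², which is nonnegative.
-/
lemma splits (h : IsONS Λ P) (hΛ : IsPosFunctional Λ) (n : ℕ) : (P n).Splits := by
  refine Splits.of_splits_map (algebraMap ℝ ℂ) (IsAlgClosed.splits _) fun z hz => ?_
  have hz0 : aeval z (P n) = 0 := by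
    rw [aeval_def, ← eval_map]
    exact isRoot_of_mem_roots hz
  by_cases him : z.im = 0
  · exact ⟨z.re, by apply Complex.ext <;> simp [him]⟩
  · exfalso
    refine h.not_dvd_of_nonneg hΛ (n := n) ?_ (fun x _ => ?_)
      (quadratic_dvd_of_aeval_eq_zero_im_ne_zero (P n) hz0 him)
    · have : (X ^ 2 - C (2 * z.re) * X + C (‖z‖ ^ 2) : ℝ[X]).natDegree = 2 := by compute_degree!
      omega
    · simp only [eval_add, eval_sub, eval_pow, eval_mul, eval_X, eval_C]
      rw [Complex.sq_norm, Complex.normSq_apply]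
      nlinarith [sq_nonneg (x - z.re), sq_nonneg z.im]

lemma card_roots (h : IsONS Λ P) (hΛ : IsPosFunctional Λ) (n : ℕ) : (P n).roots.card = n := by
  rw [← (h.splits hΛ n).natDegree_eq_card_roots, h.natDegree_eq]

/-- The coefficient below the leading one. -/
lemma coeff_eq_neg_roots_sum (h : IsONS Λ P) (hΛ : IsPosFunctional Λ) (n : ℕ) :
    (P (n + 1)).coeff n = -(P (n + 1)).leadingCoeff * (P (n + 1)).roots.sum := by
  have h1 := (h.splits hΛ (n + 1)).nextCoeff_eq_neg_sum_roots_mul_leadingCoeff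
  rw [nextCoeff_of_natDegree_pos (by rw [h.natDegree_eq]; omega), h.natDegree_eq] at h1
  simpa using h1

lemma eval_zero_ne (h : IsONS Λ P) (hΛ : IsPosFunctional Λ) (n : ℕ) :
    (P n).eval 0 ≠ 0 := fun h0 => by
  have := h.one_lt_of_isRoot hΛ (w := 0) h0
  linarith

/-- All zeros a exceed 1, hence |z - a| < |-z - a| for every linear factor. Strictness is kept by
splitting off one factor, which exists as n > 0. -/
lemma abs_eval_lt_abs_eval_neg (h : IsONS Λ P) (hΛ : IsPosFunctional Λ) {n : ℕ}
    (hn : 0 < n) {z : ℝ} (hz : 1 ≤ z) :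
    |(P n).eval z| < |(P n).eval (-z)| := by
  have hroot : ∀ a ∈ (P n).roots, 1 < a := fun a ha =>
    h.one_lt_of_isRoot hΛ (isRoot_of_mem_roots ha)
  have hfac : ∀ a : ℝ, 1 < a → |z - a| < |-z - a| := fun a ha => by
    rw [← sq_lt_sq]
    nlinarith
  have hprod : ∀ s : Multiset ℝ, (∀ a ∈ s, 1 < a) →
      |(s.map fun a => z - a).prod| ≤ |(s.map fun a => -z - a).prod| ∧
        (s.map fun a => -z - a).prod ≠ 0 := by
    intro s
    induction s using Multiset.induction with
    | empty => simp
    | cons a s ih =>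
      intro hs
      have h1 := hfac a (hs a (Multiset.mem_cons_self a s))
      obtain ⟨h2, h3⟩ := ih fun b hb => hs b (Multiset.mem_cons_of_mem hb)
      simp only [Multiset.map_cons, Multiset.prod_cons, abs_mul]
      exact ⟨mul_le_mul h1.le h2 (abs_nonneg _) (abs_nonneg _),
        mul_ne_zero (abs_pos.1 ((abs_nonneg _).trans_lt h1)) h3⟩
  have hne : (P n).roots ≠ 0 := fun h0 => by
    have := h.card_roots hΛ n
    rw [h0, Multiset.card_zero] at this
    omega
  obtain ⟨a, ha⟩ := Multiset.exists_mem_of_ne_zero hne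
  obtain ⟨s, hs⟩ := Multiset.exists_cons_of_mem ha
  have hs' : ∀ b ∈ s, 1 < b := fun b hb => hroot b (by rw [hs]; exact Multiset.mem_cons_of_mem hb)
  obtain ⟨h2, h3⟩ := hprod s hs'
  rw [(h.splits hΛ n).eval_eq_prod_roots, (h.splits hΛ n).eval_eq_prod_roots (-z), hs]
  simp only [Multiset.map_cons, Multiset.prod_cons, abs_mul]
  refine mul_lt_mul_of_pos_left ?_ (abs_pos.2 (h.lc_pos n).ne')
  exact (mul_le_mul_of_nonneg_left h2 (abs_nonneg _)).trans_lt
    (mul_lt_mul_of_pos_right (hfac a (hroot a ha)) (abs_pos.2 h3))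

end IsONS

/-! ### The polynomials `orthPoly` -/

/-- The functional `f ↦ (f, 1)_{ω^{(ℓ)}}`. -/
def wFun (ℓ : Fin 2) {ζ : ℝ} (hζ : 0 < ζ) : ℝ[X] →ₗ[ℝ] ℝ :=
  (expMom ζ X)⁻¹ • (expMomL hζ).comp (LinearMap.mulLeft ℝ ((X ^ 2 - 1) ^ (ℓ : ℕ)))

lemma wFun_apply (ℓ : Fin 2) {ζ : ℝ} (hζ : 0 < ζ) (f : ℝ[X]) :
    wFun ℓ hζ f = expMom ζ ((X ^ 2 - 1) ^ (ℓ : ℕ) * f) / expMom ζ X := by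
  simp [wFun, expMomL, div_eq_inv_mul]

lemma wFun_zero_apply {ζ : ℝ} (hζ : 0 < ζ) (f : ℝ[X]) :
    wFun 0 hζ f = expMom ζ f / expMom ζ X := by
  simp [wFun_apply]

lemma wip_eq_wFun (ℓ : Fin 2) {ζ : ℝ} (hζ : 0 < ζ) (f g : ℝ[X]) :
    wip ℓ ζ f g = wFun ℓ hζ (f * g) := by
  rw [wip_eq, wFun_apply]

/-- The link between the two families: a factor x² - 1 changes one weight into the other. It bounds
the bandwidth of the cross block. -/
lemma wFun_one {ζ : ℝ} (hζ : 0 < ζ) (f : ℝ[X]) :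
    wFun 1 hζ f = wFun 0 hζ ((X ^ 2 - 1) * f) := by
  simp [wFun_apply]

lemma expMom_X_pos {ζ : ℝ} (hζ : 0 < ζ) : 0 < expMom ζ X :=
  expMom_pos hζ X_ne_zero fun x hx => by rw [eval_X]; linarith

lemma X_sq_sub_one_ne_zero : (X ^ 2 - 1 : ℝ[X]) ≠ 0 := by
  have := monic_X_pow_sub_C (1 : ℝ) two_ne_zero
  simpa using this.ne_zero

lemma isPosFunctional_wFun (ℓ : Fin 2) {ζ : ℝ} (hζ : 0 < ζ) : IsPosFunctional (wFun ℓ hζ) := by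
  intro f hf hpos
  rw [wFun_apply]
  refine div_pos (expMom_pos hζ (mul_ne_zero (pow_ne_zero _ X_sq_sub_one_ne_zero) hf)
    fun x hx => ?_) (expMom_X_pos hζ)
  simp only [eval_mul, eval_pow, eval_sub, eval_X, eval_one]
  exact mul_nonneg (pow_nonneg (by nlinarith) _) (hpos x hx)

/-- Positivity of the functional keeps every norm nonzero. Strong induction carries degree, sign of
the leading coefficient, normalization and orthogonality to the earlier polynomials together. -/
lemma isONS_of_gramSchmidt {Λ : ℝ[X] →ₗ[ℝ] ℝ} (hΛ : IsPosFunctional Λ) {P q : ℕ → ℝ[X]}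
    (hq : ∀ n, q n = X ^ n - ∑ k ∈ Finset.range n, C (Λ (X ^ n * P k)) * P k)
    (hP : ∀ n, P n = C (Real.sqrt (Λ (q n * q n)))⁻¹ * q n) : IsONS Λ P := by
  have key : ∀ n, (P n).natDegree = n ∧ 0 < (P n).leadingCoeff ∧ Λ (P n * P n) = 1 ∧
      ∀ k < n, Λ (P n * P k) = 0 := by
    intro n
    induction n using Nat.strong_induction_on with
    | _ n ih =>
      have hdeg : (∑ k ∈ Finset.range n, C (Λ (X ^ n * P k)) * P k).degree < n := by
        rw [degree_lt_iff_coeff_zero]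
        intro m hm
        rw [finsetSum_coeff]
        refine Finset.sum_eq_zero fun k hk => ?_
        rw [Finset.mem_range] at hk
        rw [coeff_C_mul, coeff_eq_zero_of_natDegree_lt (p := P k) (by rw [(ih k hk).1]; omega),
          mul_zero]
      have hqm : (q n).Monic := by rw [hq]; exact monic_X_pow_sub hdeg
      have hqn : (q n).natDegree = n := by
        apply natDegree_eq_of_degree_eq_some
        rw [hq, degree_sub_eq_left_of_degree_lt (by rwa [degree_X_pow]), degree_X_pow]
      have hpos : 0 < Λ (q n * q n) := hΛ _ (mul_ne_zero hqm.ne_zero hqm.ne_zero) fun x _ => by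
        rw [eval_mul]; exact mul_self_nonneg _
      have hs := Real.sqrt_pos.2 hpos
      have hinv := inv_pos.2 hs
      refine ⟨?_, ?_, ?_, ?_⟩
      · rw [hP, natDegree_C_mul hinv.ne', hqn]
      · rw [hP, leadingCoeff_mul, leadingCoeff_C, hqm.leadingCoeff, mul_one]
        exact hinv
      · have : P n * P n = C (Real.sqrt (Λ (q n * q n)))⁻¹ *
            (C (Real.sqrt (Λ (q n * q n)))⁻¹ * (q n * q n)) := by
          conv_lhs => rw [hP]
          ring
        rw [this, map_C_mul, map_C_mul]
        field_simp
        rw [Real.sq_sqrt hpos.le]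
      · intro k hk
        suffices hz : Λ (q n * P k) = 0 by rw [hP n, mul_assoc, map_C_mul, hz, mul_zero]
        rw [hq, sub_mul, map_sub, Finset.sum_mul, map_sum, Finset.sum_eq_single k]
        · rw [mul_assoc, map_C_mul, (ih k hk).2.2.1]; simp
        · intro j hj hjk
          rw [Finset.mem_range] at hj
          rw [mul_assoc, map_C_mul]
          rcases lt_or_gt_of_ne hjk with hlt | hlt
          · rw [mul_comm (P j), (ih k hk).2.2.2 j hlt, mul_zero]
          · rw [(ih j hj).2.2.2 k hlt, mul_zero]
        · intro hk'; exact absurd (Finset.mem_range.2 hk) hk'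
  refine ⟨fun n => (key n).1, fun n => (key n).2.1, fun m n => ?_⟩
  rcases lt_trichotomy m n with hlt | rfl | hlt
  · rw [if_neg hlt.ne, mul_comm, (key n).2.2.2 m hlt]
  · rw [if_pos rfl, (key m).2.2.1]
  · rw [if_neg hlt.ne', (key m).2.2.2 n hlt]

/-- The unnormalized polynomials of the Gram-Schmidt process. -/
def preOrth (ℓ : Fin 2) (ζ : ℝ) (n : ℕ) : ℝ[X] :=
  X ^ n - ∑ k ∈ Finset.range n, C (wip ℓ ζ (X ^ n) (orthPoly ℓ ζ k)) * orthPoly ℓ ζ k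

lemma orthPoly_eq (ℓ : Fin 2) (ζ : ℝ) (n : ℕ) : orthPoly ℓ ζ n =
    C (Real.sqrt (wip ℓ ζ (preOrth ℓ ζ n) (preOrth ℓ ζ n)))⁻¹ * preOrth ℓ ζ n := by
  rw [orthPoly, preOrth, Finset.sum_range]

lemma isONS_orthPoly (ℓ : Fin 2) {ζ : ℝ} (hζ : 0 < ζ) : IsONS (wFun ℓ hζ) (orthPoly ℓ ζ) :=
  isONS_of_gramSchmidt (isPosFunctional_wFun ℓ hζ) (q := preOrth ℓ ζ)
    (fun n => by simp only [preOrth, wip_eq_wFun ℓ hζ])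
    (fun n => by rw [← wip_eq_wFun ℓ hζ]; exact orthPoly_eq ℓ ζ n)

/-! ### Matrix entries -/

lemma jacobiMat_apply (ℓ : Fin 2) {ζ : ℝ} (hζ : 0 < ζ) (N : ℕ) (i j : Fin N) :
    jacobiMat ℓ ζ N i j = wFun ℓ hζ (X * orthPoly ℓ ζ i * orthPoly ℓ ζ j) := by
  have h := isONS_orthPoly ℓ hζ
  simp only [jacobiMat, coefA, coefB, wip_eq_wFun ℓ hζ]
  split_ifs with h1 h2 h3
  · rw [h1]
  · rw [h2]
  · rw [h3, map_X_mul_mul_comm]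
  · rcases lt_or_gt_of_ne h1 with hlt | hlt
    · rw [h.map_X_mul_mul_eq_zero (by omega)]
    · rw [map_X_mul_mul_comm, h.map_X_mul_mul_eq_zero (by omega)]

lemma degree_X_sq_sub_one_mul {ζ : ℝ} (hζ : 0 < ζ) (n : ℕ) :
    ((X ^ 2 - 1) * orthPoly 1 ζ n).degree = ((n + 2 : ℕ) : WithBot ℕ) := by
  have h2 : (X ^ 2 - 1 : ℝ[X]).degree = 2 := by
    simpa using degree_X_pow_sub_C (n := 2) two_pos (1 : ℝ)
  rw [degree_mul, h2, (isONS_orthPoly 1 hζ).degree_eq, add_comm]; rfl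

lemma coefP_eq {ζ : ℝ} (hζ : 0 < ζ) (n : ℕ) :
    coefP ζ n = wFun 1 hζ (orthPoly 0 ζ n * orthPoly 1 ζ n) := by
  have h0 := isONS_orthPoly 0 hζ
  rw [(isONS_orthPoly 1 hζ).map_mul_eq_coeff_div (by
    rw [h0.degree_eq]; exact_mod_cast Nat.lt_succ_self _), h0.coeff_self, coefP, lc, lc]

lemma coefR_succ_eq {ζ : ℝ} (hζ : 0 < ζ) (n : ℕ) :
    coefR ζ (n + 1) = wFun 1 hζ (orthPoly 0 ζ (n + 2) * orthPoly 1 ζ n) := by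
  have h1 := isONS_orthPoly 1 hζ
  rw [wFun_one, mul_left_comm, mul_comm (orthPoly 0 _ _),
    (isONS_orthPoly 0 hζ).map_mul_eq_coeff_div (by
      rw [degree_X_sq_sub_one_mul hζ]; exact_mod_cast Nat.lt_succ_self _), coefR, lc, lc, sub_mul,
    one_mul, coeff_sub, coeff_X_pow_mul, h1.coeff_self,
    coeff_eq_zero_of_natDegree_lt (p := orthPoly 1 ζ n) (by rw [h1.natDegree_eq]; omega), sub_zero]
  rfl

lemma wFun_one_eq_zero_of_lt {ζ : ℝ} (hζ : 0 < ζ) {k n : ℕ} (hkn : k < n) :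
    wFun 1 hζ (orthPoly 0 ζ k * orthPoly 1 ζ n) = 0 :=
  (isONS_orthPoly 1 hζ).map_mul_eq_zero (by
    rw [(isONS_orthPoly 0 hζ).degree_eq]; exact_mod_cast hkn)

lemma wFun_one_eq_zero_of_gt {ζ : ℝ} (hζ : 0 < ζ) {k n : ℕ} (hkn : n + 2 < k) :
    wFun 1 hζ (orthPoly 0 ζ k * orthPoly 1 ζ n) = 0 := by
  rw [wFun_one, mul_left_comm, mul_comm (orthPoly 0 _ _)]
  exact (isONS_orthPoly 0 hζ).map_mul_eq_zero (by
    rw [degree_X_sq_sub_one_mul hζ]; exact_mod_cast hkn)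

/-- Expansion of `(X² - 1) P_n^{(1)}` in the polynomials `P_k^{(0)}`. -/
lemma X_sq_sub_one_mul_expansion {ζ : ℝ} (hζ : 0 < ζ) {n N : ℕ} (hN : n + 2 < N) :
    (X ^ 2 - 1) * orthPoly 1 ζ n =
      ∑ k ∈ Finset.range N, C (wFun 1 hζ (orthPoly 0 ζ k * orthPoly 1 ζ n)) * orthPoly 0 ζ k := by
  conv_lhs => rw [(isONS_orthPoly 0 hζ).expansion (N := N) (f := (X ^ 2 - 1) * orthPoly 1 ζ n)
    (by rw [degree_X_sq_sub_one_mul hζ]; exact_mod_cast hN)]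
  refine Finset.sum_congr rfl fun k _ => ?_
  rw [wFun_one, mul_assoc, mul_comm (orthPoly 0 ζ k)]

/-- Terms with k < n vanish by orthogonality for `ℓ = 1`, terms with k > n + 2 are absent by degree.
-/
lemma X_sq_sub_one_mul_three_term {ζ : ℝ} (hζ : 0 < ζ) (n : ℕ) :
    (X ^ 2 - 1) * orthPoly 1 ζ n = C (coefP ζ n) * orthPoly 0 ζ n
      + C (wFun 1 hζ (orthPoly 0 ζ (n + 1) * orthPoly 1 ζ n)) * orthPoly 0 ζ (n + 1)
      + C (coefR ζ (n + 1)) * orthPoly 0 ζ (n + 2) := by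
  rw [X_sq_sub_one_mul_expansion hζ (Nat.lt_succ_self (n + 2)), Finset.sum_range_succ,
    Finset.sum_range_succ, Finset.sum_range_succ, Finset.sum_eq_zero, coefP_eq hζ,
    coefR_succ_eq hζ, zero_add]
  intro k hk
  rw [wFun_one_eq_zero_of_lt hζ (Finset.mem_range.1 hk)]
  simp

/-- Vieta's formula for the second coefficient. The factor `X` shifts the index so that n = 0, where
the sum of zeros is empty, is covered too. -/
lemma coeff_pred_eq {ζ : ℝ} (hζ : 0 < ζ) (ℓ : Fin 2) (n : ℕ) :
    (X * orthPoly ℓ ζ n).coeff n = -lc ℓ ζ n * zeroSum ℓ ζ n := by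
  have h := isONS_orthPoly ℓ hζ
  have hp := isPosFunctional_wFun ℓ hζ
  cases n with
  | zero =>
    have : (orthPoly ℓ ζ 0).roots = 0 := Multiset.card_eq_zero.1 (h.card_roots hp 0)
    simp [zeroSum, this]
  | succ n => rw [coeff_X_mul, h.coeff_eq_neg_roots_sum hp, lc, zeroSum]

/-- Compare the coefficients of x^(n+1) in the three-term formula for (x² - 1)P_n¹. Both second
coefficients are sums of zeros, and r_{n+1}c_{n+2}⁰ = c_n¹ combines them into a difference. -/
lemma coefQ_eq {ζ : ℝ} (hζ : 0 < ζ) (n : ℕ) :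
    coefQ ζ n = wFun 1 hζ (orthPoly 0 ζ (n + 1) * orthPoly 1 ζ n) := by
  have h0 := isONS_orthPoly 0 hζ
  have h1 := isONS_orthPoly 1 hζ
  have h := congrArg (fun f => (X * f).coeff (n + 2)) (X_sq_sub_one_mul_three_term hζ n)
  have e2 := coeff_pred_eq hζ 0 (n + 2)
  have e1 := coeff_pred_eq hζ 1 n
  have c1 : (orthPoly 0 ζ (n + 1)).coeff (n + 1) = lc 0 ζ (n + 1) := h0.coeff_self _
  have c0 : (orthPoly 0 ζ n).coeff (n + 1) = 0 :=
    coeff_eq_zero_of_natDegree_lt (by rw [h0.natDegree_eq]; omega)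
  have c2 : (orthPoly 1 ζ n).coeff (n + 1) = 0 :=
    coeff_eq_zero_of_natDegree_lt (by rw [h1.natDegree_eq]; omega)
  have l1 : lc 0 ζ (n + 1) ≠ 0 := (h0.lc_pos _).ne'
  have l2 : lc 0 ζ (n + 2) ≠ 0 := (h0.lc_pos _).ne'
  have lhs : (X * ((X ^ 2 - 1) * orthPoly 1 ζ n)).coeff (n + 2) = -lc 1 ζ n * zeroSum 1 ζ n := by
    have : X * ((X ^ 2 - 1) * orthPoly 1 ζ n) = X ^ 2 * (X * orthPoly 1 ζ n)
      - X * orthPoly 1 ζ n := by ring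
    rw [this, coeff_sub, coeff_X_pow_mul, e1, coeff_X_mul, c2, sub_zero]
  have hr : coefR ζ (n + 1) * lc 0 ζ (n + 2) = lc 1 ζ n := by
    rw [coefR, Nat.add_sub_cancel, div_mul_cancel₀ _ l2]
  simp only [lhs] at h
  rw [coeff_X_mul, coeff_add, coeff_add, coeff_C_mul, coeff_C_mul, coeff_C_mul, c0, c1,
    ← coeff_X_mul (orthPoly 0 ζ (n + 2)), e2] at h
  rw [coefQ, div_mul_eq_mul_div, div_eq_iff l1]
  linear_combination h - zeroSum 0 ζ (n + 2) * hr

lemma crossMat_apply {ζ : ℝ} (hζ : 0 < ζ) (N : ℕ) (i : Fin N) (j : Fin (N + 1)) :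
    crossMat ζ N i j = wFun 1 hζ (orthPoly 0 ζ j * orthPoly 1 ζ i) := by
  simp only [crossMat]
  split_ifs with h1 h2 h3
  · rw [h1, coefP_eq hζ]
  · rw [h2, coefQ_eq hζ]
  · rw [h3, coefR_succ_eq hζ]
  · rcases lt_or_gt_of_ne h1 with hlt | hlt
    · rw [wFun_one_eq_zero_of_lt hζ hlt]
    · rw [wFun_one_eq_zero_of_gt hζ (by omega)]

/-! ### The zeros of `polyQ` -/

lemma exists_zero_of_mul_neg {f : ℝ → ℝ} (hf : Continuous f) {a b : ℝ} (hab : a < b)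
    (h : f a * f b < 0) : ∃ c ∈ Set.Ioo a b, f c = 0 := by
  rcases mul_neg_iff.1 h with ⟨ha, hb⟩ | ⟨ha, hb⟩
  · exact intermediate_value_Ioo' hab.le hf.continuousOn ⟨hb, ha⟩
  · exact intermediate_value_Ioo hab.le hf.continuousOn ⟨ha, hb⟩

/-- The derivative changes sign between consecutive simple roots. -/
lemma derivative_mul_neg_of_consecutive {p : ℝ[X]} {a b : ℝ} (hab : a < b) (ha : p.IsRoot a)
    (hb : p.IsRoot b) (ha' : p.derivative.eval a ≠ 0) (hb' : p.derivative.eval b ≠ 0)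
    (hno : ∀ c ∈ Set.Ioo a b, ¬ p.IsRoot c) :
    p.derivative.eval a * p.derivative.eval b < 0 := by
  obtain ⟨k, rfl⟩ := dvd_iff_isRoot.2 ha
  have hk : k.IsRoot b := by
    have : (b - a) * k.eval b = 0 := by simpa using hb
    exact (mul_eq_zero.1 this).resolve_left (sub_pos.2 hab).ne'
  obtain ⟨q, rfl⟩ := dvd_iff_isRoot.2 hk
  simp only [derivative_mul, derivative_sub, derivative_X, derivative_C, eval_add, eval_mul,
    eval_sub, eval_X, eval_C, sub_self, zero_mul, add_zero, sub_zero, one_mul, zero_add]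
    at ha' hb' ⊢
  have hq : 0 < q.eval a * q.eval b := by
    by_contra! hle
    have hne : q.eval a * q.eval b ≠ 0 :=
      mul_ne_zero (right_ne_zero_of_mul ha') (right_ne_zero_of_mul hb')
    obtain ⟨c, hc, hc0⟩ := exists_zero_of_mul_neg q.continuous hab (lt_of_le_of_ne hle hne)
    exact hno c hc (by simp [hc0])
  have : (a - b) * eval a q * ((b - a) * eval b q) = -((b - a) ^ 2 * (q.eval a * q.eval b)) := by
    ring
  rw [this, neg_lt_zero]
  exact mul_pos (pow_pos (sub_pos.2 hab) 2) hq

/-- At a zero of the next polynomial, `P_M` has the sign of the derivative. -/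
lemma derivative_mul_pos {Λ : ℝ[X] →ₗ[ℝ] ℝ} {P : ℕ → ℝ[X]} (h : IsONS Λ P) {n : ℕ} {x : ℝ}
    (hx : (P (n + 1)).IsRoot x) : 0 < (derivative (P (n + 1))).eval x * (P n).eval x := by
  have hcd := congrArg (eval x) (h.christoffel_darboux n)
  rw [eval_mul, eval_sub, eval_mul, eval_mul, eval_C, hx.eq_zero, mul_zero, sub_zero,
    eval_finsetSum] at hcd
  have h0 : (P 0).eval x ≠ 0 := by
    have := h.ne_zero 0
    rw [eq_C_of_natDegree_eq_zero (h.natDegree_eq 0)] at this ⊢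
    simpa using this
  have hs : 0 < ∑ k ∈ Finset.range (n + 1), (P k ^ 2).eval x := by
    refine Finset.sum_pos' (fun k _ => ?_) ⟨0, by simp, ?_⟩
    · rw [eval_pow]; positivity
    · rw [eval_pow]; positivity
  rw [← hcd] at hs
  exact pos_of_mul_pos_right hs (h.map_X_mul_mul_succ_pos n).le

/-- At the zeros of `P_{M+1}^{(0)}`, the polynomials `(X² - 1) P_M^{(1)}` and `P_M^{(0)}` are
proportional. -/
lemma exists_ratio {ζ : ℝ} (hζ : 0 < ζ) (M : ℕ) :
    ∃ κ : ℝ, ∀ x : ℝ, (orthPoly 0 ζ (M + 1)).IsRoot x →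
    (x ^ 2 - 1) * (orthPoly 1 ζ M).eval x = κ * (orthPoly 0 ζ M).eval x := by
  have h0 := isONS_orthPoly 0 hζ
  -- At a zero of P_{M+1}⁰ the recurrence reads a_{M+1}P_{M+2}⁰ = -a_M P_M⁰. Inserted in the
  -- three-term formula this gives κ = p_M - r_{M+1}a_M/a_{M+1}.
  refine ⟨coefP ζ M - coefR ζ (M + 1) * (wFun 0 hζ (X * orthPoly 0 ζ M * orthPoly 0 ζ (M + 1)) /
    wFun 0 hζ (X * orthPoly 0 ζ (M + 1) * orthPoly 0 ζ (M + 2))), fun x hx => ?_⟩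
  have e1 := congrArg (eval x) (X_sq_sub_one_mul_three_term hζ M)
  have e2 := congrArg (eval x) (h0.recurrence M)
  have ha := (h0.map_X_mul_mul_succ_pos (M + 1)).ne'
  simp only [eval_add, eval_mul, eval_sub, eval_pow, eval_X, eval_one, eval_C, hx.eq_zero,
    mul_zero, add_zero] at e1 e2
  have e3 : (orthPoly 0 ζ (M + 2)).eval x =
      -(wFun 0 hζ (X * orthPoly 0 ζ M * orthPoly 0 ζ (M + 1)) /
        wFun 0 hζ (X * orthPoly 0 ζ (M + 1) * orthPoly 0 ζ (M + 2)) *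
          (orthPoly 0 ζ M).eval x) := by
    rw [div_mul_eq_mul_div, ← neg_div, eq_div_iff ha]
    linear_combination -e2
  rw [e1, e3]
  ring

lemma mul_pos_of_not_root {p : ℝ[X]} (hp : ∀ x, p.IsRoot x → 1 < x) {a b : ℝ} (ha : a ≤ 1)
    (hb : b ≤ 1) : 0 < p.eval a * p.eval b := by
  wlog hab : a ≤ b generalizing a b
  · rw [mul_comm]; exact this hb ha (le_of_not_ge hab)
  have hna : p.eval a ≠ 0 := fun h => ha.not_gt (hp a h)
  have hnb : p.eval b ≠ 0 := fun h => hb.not_gt (hp b h)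
  rcases hab.eq_or_lt with rfl | hlt
  · exact mul_self_pos.2 hna
  · by_contra! hle
    obtain ⟨c, hc, hc0⟩ := exists_zero_of_mul_neg p.continuous hlt
      (lt_of_le_of_ne hle (mul_ne_zero hna hnb))
    exact (hc.2.trans_le hb).not_gt (hp c hc0)

/-- At a zero x of P_{M+1}⁰ only P_{M+1}⁰(-x)P_M¹(x) survives. The first factor has constant sign,
since -x lies left of all zeros. The second alternates: it is κP_M⁰(x)/(x² - 1), and P_M⁰ has the
sign of the derivative of P_{M+1}⁰ there. -/
lemma polyQ_mul_neg {ζ : ℝ} (hζ : 0 < ζ) (M : ℕ) (x : Fin (M + 1) → ℝ) (hmono : StrictMono x)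
    (hx : ∀ y, (orthPoly 0 ζ (M + 1)).IsRoot y ↔ ∃ i, y = x i) {i j : Fin (M + 1)}
    (hij : (j : ℕ) = i + 1) : polyQ M ζ (x i) * polyQ M ζ (x j) < 0 := by
  have h0 := isONS_orthPoly 0 hζ
  have h1 := isONS_orthPoly 1 hζ
  have p0 := isPosFunctional_wFun 0 hζ
  have hr : ∀ i, (orthPoly 0 ζ (M + 1)).IsRoot (x i) := fun i => (hx _).2 ⟨i, rfl⟩
  have hgt : ∀ i, 1 < x i := fun i => h0.one_lt_of_isRoot p0 (hr i)
  obtain ⟨κ, hκ⟩ := exists_ratio hζ M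
  -- Otherwise P_M¹, of degree M, would vanish at the M + 1 zeros of P_{M+1}⁰.
  have hκ0 : κ ≠ 0 := by
    rintro rfl
    refine h1.ne_zero M (eq_zero_of_natDegree_lt_card_of_eval_eq_zero _ hmono.injective
      (fun i => ?_) (by rw [h1.natDegree_eq, Fintype.card_fin]; omega))
    have h2 := hκ _ (hr i)
    rw [zero_mul] at h2
    exact (mul_eq_zero.1 h2).resolve_left (by nlinarith [hgt i])
  have hij' : i < j := by rw [Fin.lt_def]; omega
  have hdi := derivative_mul_pos h0 (hr i)
  have hdj := derivative_mul_pos h0 (hr j)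
  have hder := derivative_mul_neg_of_consecutive (hmono hij') (hr i) (hr j)
    (left_ne_zero_of_mul hdi.ne') (left_ne_zero_of_mul hdj.ne') (fun c hc hroot => by
      obtain ⟨k, rfl⟩ := (hx c).1 hroot
      have h3 := hmono.lt_iff_lt.1 hc.1
      have h4 := hmono.lt_iff_lt.1 hc.2
      rw [Fin.lt_def] at h3 h4
      omega)
  have hneg := mul_pos_of_not_root (p := orthPoly 0 ζ (M + 1))
    (fun y hy => h0.one_lt_of_isRoot p0 hy)
    (a := -x i) (b := -x j) (by linarith [hgt i]) (by linarith [hgt j])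
  have hP : (orthPoly 0 ζ M).eval (x i) * (orthPoly 0 ζ M).eval (x j) < 0 := by
    have := mul_pos hdi hdj
    by_contra! hge
    nlinarith
  have hP1 : (orthPoly 1 ζ M).eval (x i) * (orthPoly 1 ζ M).eval (x j) < 0 := by
    have hi := hκ _ (hr i)
    have hj := hκ _ (hr j)
    have hA : 0 < (x i ^ 2 - 1) * (x j ^ 2 - 1) :=
      mul_pos (by nlinarith [hgt i]) (by nlinarith [hgt j])
    have hB : ((x i ^ 2 - 1) * (x j ^ 2 - 1)) *
        ((orthPoly 1 ζ M).eval (x i) * (orthPoly 1 ζ M).eval (x j)) =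
        κ ^ 2 * ((orthPoly 0 ζ M).eval (x i) * (orthPoly 0 ζ M).eval (x j)) := by
      linear_combination (x j ^ 2 - 1) * (orthPoly 1 ζ M).eval (x j) * hi +
        κ * (orthPoly 0 ζ M).eval (x i) * hj
    have hC := mul_neg_of_pos_of_neg (pow_pos (abs_pos.2 hκ0) 2) hP
    rw [sq_abs, ← hB] at hC
    by_contra! hge
    exact absurd (mul_nonneg hA.le hge) hC.not_ge
  have e : polyQ M ζ (x i) * polyQ M ζ (x j) =
      ((orthPoly 0 ζ (M + 1)).eval (-x i) * (orthPoly 0 ζ (M + 1)).eval (-x j)) *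
        ((orthPoly 1 ζ M).eval (x i) * (orthPoly 1 ζ M).eval (x j)) := by
    rw [polyQ, polyQ, (hr i).eq_zero, (hr j).eq_zero]
    ring
  rw [e]
  exact mul_neg_of_pos_of_neg hneg hP1

/-- `polyQ` as a polynomial. -/
def polyQPoly (M : ℕ) (ζ : ℝ) : ℝ[X] :=
  orthPoly 0 ζ (M + 1) * (orthPoly 1 ζ M).comp (-X)
    + (orthPoly 0 ζ (M + 1)).comp (-X) * orthPoly 1 ζ M

lemma eval_polyQPoly (M : ℕ) (ζ x : ℝ) : (polyQPoly M ζ).eval x = polyQ M ζ x := by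
  simp [polyQPoly, polyQ, eval_comp]

lemma polyQ_neg (M : ℕ) (ζ x : ℝ) : polyQ M ζ (-x) = polyQ M ζ x := by
  rw [polyQ, polyQ, neg_neg]; ring

/-- The degree is at most 2M + 1 by inspection, and an even polynomial cannot have odd degree. -/
lemma natDegree_polyQPoly_le {ζ : ℝ} (hζ : 0 < ζ) (M : ℕ) : (polyQPoly M ζ).natDegree ≤ 2 * M := by
  have h0 := (isONS_orthPoly 0 hζ).natDegree_eq (M + 1)
  have h1 := (isONS_orthPoly 1 hζ).natDegree_eq M
  have hle : (polyQPoly M ζ).natDegree ≤ 2 * M + 1 := by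
    refine natDegree_add_le_of_degree_le ?_ ?_ <;>
    · refine natDegree_mul_le.trans ?_
      rw [natDegree_comp, natDegree_neg, natDegree_X, h0, h1]
      omega
  have hsymm : (polyQPoly M ζ).comp (-X) = polyQPoly M ζ := by
    refine Polynomial.funext fun x => ?_
    rw [eval_comp, eval_neg, eval_X, eval_polyQPoly, eval_polyQPoly, polyQ_neg]
  by_contra! hlt
  have hdeg : (polyQPoly M ζ).natDegree = 2 * M + 1 := by omega
  have h2 := comp_neg_X_leadingCoeff_eq (polyQPoly M ζ)
  rw [hsymm, hdeg, Odd.neg_one_pow ⟨M, rfl⟩] at h2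
  have h3 : polyQPoly M ζ = 0 := leadingCoeff_eq_zero.1 (by linarith)
  simp [h3] at hdeg

lemma exists_sorted_roots {ζ : ℝ} (hζ : 0 < ζ) (M : ℕ) : ∃ x : Fin (M + 1) → ℝ, StrictMono x ∧
    ∀ y, (orthPoly 0 ζ (M + 1)).IsRoot y ↔ ∃ i, y = x i := by
  have h0 := isONS_orthPoly 0 hζ
  have p0 := isPosFunctional_wFun 0 hζ
  have hcard : (orthPoly 0 ζ (M + 1)).roots.toFinset.card = M + 1 := by
    rw [Multiset.toFinset_card_of_nodup (h0.nodup_roots p0 _), h0.card_roots p0]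
  refine ⟨_, ((orthPoly 0 ζ (M + 1)).roots.toFinset.orderEmbOfFin hcard).strictMono, fun y => ?_⟩
  rw [← mem_roots (h0.ne_zero _), ← Multiset.mem_toFinset, ← Finset.mem_coe,
    ← Finset.range_orderEmbOfFin _ hcard]
  exact ⟨fun ⟨i, hi⟩ => ⟨i, hi.symm⟩, fun ⟨i, hi⟩ => ⟨i, hi.symm⟩⟩

/-- Each of the M gaps between consecutive zeros of P_{M+1}⁰ contains a zero by the sign change;
evenness adds the negatives, and the degree bound excludes any further one. -/
theorem exists_isZeroList {ζ : ℝ} (hζ : 0 < ζ) {M : ℕ} (hM : 1 ≤ M) :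
    ∃ z : ℤ → ℝ, IsZeroList M ζ z := by
  obtain ⟨x, hmono, hx⟩ := exists_sorted_roots hζ M
  have hgt : ∀ i, 1 < x i := fun i =>
    (isONS_orthPoly 0 hζ).one_lt_of_isRoot (isPosFunctional_wFun 0 hζ) ((hx _).2 ⟨i, rfl⟩)
  have hcont : Continuous (polyQ M ζ) := by
    rw [← funext (eval_polyQPoly M ζ)]
    exact (polyQPoly M ζ).continuous
  have hex : ∀ i : Fin M, ∃ c, x i.castSucc < c ∧ c < x i.succ ∧ polyQ M ζ c = 0 := fun i => by
    obtain ⟨c, hc, hc0⟩ := exists_zero_of_mul_neg hcont (hmono (Fin.castSucc_lt_succ (i := i)))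
      (polyQ_mul_neg hζ M x hmono hx (by simp))
    exact ⟨c, hc.1, hc.2, hc0⟩
  choose w hw1 hw2 hw0 using hex
  have hwgt : ∀ i, 1 < w i := fun i => (hgt _).trans (hw1 i)
  have hwmono : StrictMono w := fun i j hij =>
    (hw2 i).trans_le ((hmono.monotone (Fin.le_def.2 (by simpa using hij))).trans (hw1 j).le)
  -- The sign makes `z` odd for all integers. The shift by one translates the index range 1, …, M to
  -- `Fin M`; the value 0 is a filler outside the range.
  set z : ℤ → ℝ := fun i => (i.sign : ℝ) *
    (if h : i.natAbs - 1 < M then w ⟨i.natAbs - 1, h⟩ else 0) with hz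
  have hodd : ∀ i, z (-i) = -z i := fun i => by
    simp only [hz, Int.sign_neg, Int.natAbs_neg, Int.cast_neg, neg_mul]
  have hpos : ∀ i : ℤ, ∀ (h1 : 1 ≤ i) (h2 : i ≤ M), z i = w ⟨i.natAbs - 1, by omega⟩ := by
    intro i h1 h2
    simp only [hz]
    rw [Int.sign_eq_one_of_pos (by omega), dif_pos (by omega)]
    simp
  have hval : ∀ k : Fin M, z ((k : ℕ) + 1 : ℤ) = w k := fun k => by
    rw [hpos _ (by omega) (by omega)]
    congr 1
  have hne : polyQPoly M ζ ≠ 0 := by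
    intro h0
    have := polyQ_mul_neg hζ M x hmono hx (i := 0) (j := ⟨1, by omega⟩) (by simp)
    rw [← eval_polyQPoly, h0] at this
    simp at this
  refine ⟨z, hodd, ?_, ?_, ?_⟩
  · rintro i ⟨h1, h2⟩
    rw [hpos i h1 h2]
    exact hwgt _
  · rintro i ⟨h1, h2⟩ j ⟨h3, h4⟩ hij
    rw [hpos i h1 h2, hpos j h3 h4]
    apply hwmono
    rw [Fin.lt_def]
    simp only
    omega
  · intro y
    constructor
    · intro hy
      by_contra! hno
      have hyw : ∀ k, y ≠ w k := fun k => by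
        rw [← hval k]
        exact hno _ ⟨by omega, by omega⟩ (by omega)
      have hyw' : ∀ k, y ≠ -w k := fun k => by
        rw [← hval k, ← hodd]
        exact hno _ ⟨by omega, by omega⟩ (by omega)
      -- Another zero y, together with the numbers ±w_k, makes 2M + 1 distinct zeros.
      refine hne (eq_zero_of_natDegree_lt_card_of_eval_eq_zero _
        (f := fun o : Option (Fin M ⊕ Fin M) => o.elim y (Sum.elim w fun k => -w k)) ?_ ?_ ?_)
      · rintro (_ | i | i) (_ | j | j) hij <;> simp only [Option.elim, Sum.elim_inl,
          Sum.elim_inr] at hij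
        · rfl
        · exact absurd hij (hyw _)
        · exact absurd hij (hyw' _)
        · exact absurd hij.symm (hyw _)
        · rw [hwmono.injective hij]
        · linarith [hwgt i, hwgt j]
        · exact absurd hij.symm (hyw' _)
        · linarith [hwgt i, hwgt j]
        · rw [hwmono.injective (neg_injective hij)]
      · rintro (_ | i | i) <;> simp only [Option.elim, Sum.elim_inl, Sum.elim_inr, eval_polyQPoly]
        · exact hy
        · exact hw0 i
        · rw [polyQ_neg]; exact hw0 i
      · have := natDegree_polyQPoly_le hζ M
        simp only [Fintype.card_option, Fintype.card_sum, Fintype.card_fin]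
        omega
    · rintro ⟨i, ⟨h1, h2⟩, hi, rfl⟩
      rcases lt_or_gt_of_ne hi with h3 | h3
      · rw [← neg_neg i, hodd, polyQ_neg, hpos (-i) (by omega) (by omega)]
        exact hw0 _
      · rw [hpos i (by omega) h2]
        exact hw0 _

/-! ### The generalized eigenvalue problem of the pair -/

/-- Every eigenpair gives a linear factor of the characteristic polynomial. The factors are coprime
and their number equals its degree. -/
lemma isEigenSystem_of_eigen {ι : Type} [Fintype ι] [DecidableEq ι] {M : ℕ}
    {A0 A1 : Matrix ι ι ℝ} {μ : ℤ → ℝ} {y : ℤ → ι → ℝ} (hcard : Fintype.card ι = 2 * M + 1)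
    (hdet : IsUnit A0.det) (hinj : Set.InjOn μ (Set.Icc (-(M : ℤ)) M))
    (hne : ∀ i ∈ Set.Icc (-(M : ℤ)) M, y i ≠ 0)
    (heig : ∀ i ∈ Set.Icc (-(M : ℤ)) M, A1.mulVec (y i) = μ i • A0.mulVec (y i)) :
    IsEigenSystem M A0 A1 μ y := by
  refine ⟨hdet, hinj, ?_, hne, heig⟩
  have hroot : ∀ i ∈ Finset.Icc (-(M : ℤ)) M, X - C (μ i) ∣ (A0⁻¹ * A1).charpoly := by
    intro i hi
    have hi' : i ∈ Set.Icc (-(M : ℤ)) M := by simpa using hi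
    rw [dvd_iff_isRoot, IsRoot.def, Matrix.eval_charpoly]
    refine Matrix.exists_mulVec_eq_zero_iff.1 ⟨y i, hne i hi', ?_⟩
    rw [Matrix.sub_mulVec, ← Matrix.mulVec_mulVec, heig i hi', Matrix.mulVec_smul,
      Matrix.mulVec_mulVec, Matrix.nonsing_inv_mul _ hdet, Matrix.one_mulVec]
    ext j
    simp [Matrix.scalar_apply]
  have hdvd : ∏ i ∈ Finset.Icc (-(M : ℤ)) M, (X - C (μ i)) ∣ (A0⁻¹ * A1).charpoly := by
    refine Finset.prod_dvd_of_coprime (fun i hi j hj hij => ?_) hroot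
    refine isCoprime_X_sub_C_of_isUnit_sub ?_
    rw [isUnit_iff_ne_zero, sub_ne_zero]
    exact fun h => hij (hinj (by simpa using hi) (by simpa using hj) h)
  refine eq_of_monic_of_dvd_of_natDegree_le (monic_prod_of_monic _ _ fun i _ => monic_X_sub_C _)
    (Matrix.charpoly_monic _) hdvd ?_
  rw [Matrix.charpoly_natDegree_eq_dim, hcard, natDegree_prod_of_monic _ _
    fun i _ => monic_X_sub_C _]
  simp
  omega

/-- A kernel vector is the coefficient vector of a polynomial f with (x f, f) = 0, which is
impossible for f ≠ 0 because x ≥ 1 on the support. -/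
lemma isUnit_det_jacobiMat (ℓ : Fin 2) {ζ : ℝ} (hζ : 0 < ζ) (N : ℕ) :
    IsUnit (jacobiMat ℓ ζ N).det := by
  rw [isUnit_iff_ne_zero]
  intro h0
  obtain ⟨v, hv, hv0⟩ := Matrix.exists_mulVec_eq_zero_iff.2 h0
  have h := isONS_orthPoly ℓ hζ
  set f : ℝ[X] := ∑ i : Fin N, C (v i) * orthPoly ℓ ζ i with hf
  have hfi : ∀ i : Fin N, wFun ℓ hζ (f * orthPoly ℓ ζ i) = v i := fun i => by
    simp only [hf, Finset.sum_mul, map_sum, mul_assoc, map_C_mul, h.ortho, Fin.val_inj]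
    simp
  have hq : wFun ℓ hζ (X * f * f) = 0 := by
    have e : X * f * f = ∑ i : Fin N, C (v i) * ∑ j : Fin N,
        C (v j) * (X * orthPoly ℓ ζ i * orthPoly ℓ ζ j) := by
      simp only [Finset.mul_sum]
      rw [mul_assoc, hf, Finset.sum_mul_sum, Finset.mul_sum]
      refine Finset.sum_congr rfl fun i _ => ?_
      rw [Finset.mul_sum]
      exact Finset.sum_congr rfl fun j _ => by ring
    rw [e, map_sum]
    refine Finset.sum_eq_zero fun i _ => ?_
    rw [map_C_mul, map_sum]
    have := congrFun hv0 i
    simp only [Matrix.mulVec, dotProduct, jacobiMat_apply ℓ hζ, Pi.zero_apply] at this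
    simp only [map_C_mul, mul_comm (v _), this, zero_mul]
  have hf0 : f = 0 := by
    by_contra hne
    refine (isPosFunctional_wFun ℓ hζ _ (mul_ne_zero (mul_ne_zero X_ne_zero hne) hne)
      fun x hx => ?_).ne' hq
    rw [eval_mul, eval_mul, eval_X, mul_assoc]
    exact mul_nonneg (by linarith) (mul_self_nonneg _)
  refine hv (funext fun i => ?_)
  rw [← hfi i, hf0, zero_mul, map_zero, Pi.zero_apply]

lemma isUnit_det_matA0 {ζ : ℝ} (hζ : 0 < ζ) (M : ℕ) : IsUnit (matA0 M ζ).det := by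
  rw [matA0, Matrix.det_fromBlocks_zero₁₂]
  exact (isUnit_det_jacobiMat 0 hζ _).mul (isUnit_det_jacobiMat 1 hζ _)

/-- The expansion of x P_i evaluated at z, with the one term cut off by the truncation moved to the
right. The next two lemmas do the same for (x² - 1)P_i¹ and for P_k⁰; these remainders must cancel
in an eigenvector. -/
lemma jacobiMat_sum (ℓ : Fin 2) {ζ : ℝ} (hζ : 0 < ζ) (N : ℕ) (i : Fin N) (z : ℝ) :
    ∑ k : Fin N, jacobiMat ℓ ζ N i k * (orthPoly ℓ ζ k).eval z =
      z * (orthPoly ℓ ζ i).eval z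
        - wFun ℓ hζ (X * orthPoly ℓ ζ i * orthPoly ℓ ζ N) * (orthPoly ℓ ζ N).eval z := by
  have h := isONS_orthPoly ℓ hζ
  have e := congrArg (eval z) (h.expansion (N := N + 1) (f := X * orthPoly ℓ ζ i)
    (by rw [h.degree_X_mul]; exact_mod_cast (by omega)))
  rw [eval_mul, eval_X, eval_finsetSum, Finset.sum_range_succ, Finset.sum_range] at e
  simp only [eval_mul, eval_C] at e
  simp only [jacobiMat_apply ℓ hζ]
  linear_combination -e

lemma crossMat_sum {ζ : ℝ} (hζ : 0 < ζ) (N : ℕ) (i : Fin N) (z : ℝ) :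
    ∑ k : Fin (N + 1), crossMat ζ N i k * (orthPoly 0 ζ k).eval z =
      (z ^ 2 - 1) * (orthPoly 1 ζ i).eval z
        - wFun 1 hζ (orthPoly 0 ζ (N + 1) * orthPoly 1 ζ i) * (orthPoly 0 ζ (N + 1)).eval z := by
  have e := congrArg (eval z) (X_sq_sub_one_mul_expansion hζ (n := i) (N := N + 2) (by omega))
  rw [eval_finsetSum, Finset.sum_range_succ, Finset.sum_range] at e
  simp only [eval_mul, eval_C, eval_sub, eval_pow, eval_X, eval_one] at e
  simp only [crossMat_apply hζ]
  linear_combination -e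

lemma crossMat_transpose_sum {ζ : ℝ} (hζ : 0 < ζ) (N : ℕ) (k : Fin (N + 1)) (z : ℝ) :
    ∑ i : Fin N, crossMat ζ N i k * (orthPoly 1 ζ i).eval z = (orthPoly 0 ζ k).eval z
        - wFun 1 hζ (orthPoly 0 ζ k * orthPoly 1 ζ N) * (orthPoly 1 ζ N).eval z := by
  have e := congrArg (eval z) ((isONS_orthPoly 1 hζ).expansion (N := N + 1) (f := orthPoly 0 ζ k)
    (by rw [(isONS_orthPoly 0 hζ).degree_eq]; exact_mod_cast k.2))
  rw [eval_finsetSum, Finset.sum_range_succ, Finset.sum_range] at e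
  simp only [eval_mul, eval_C] at e
  simp only [crossMat_apply hζ]
  linear_combination -e

lemma sum_mul_comb {N : ℕ} (a f g : Fin N → ℝ) (c d : ℝ) :
    ∑ k, a k * (f k * c + g k * d) = (∑ k, a k * f k) * c + (∑ k, a k * g k) * d := by
  rw [Finset.sum_mul, Finset.sum_mul, ← Finset.sum_add_distrib]
  exact Finset.sum_congr rfl fun k _ => by ring

/-- At z = ±1 the factor z² - 1 is zero, so only multiples of P_{M+1}⁰(±1) remain, and the
coefficients of the combination cancel them. -/
lemma eigen_genVec_zero {ζ : ℝ} (hζ : 0 < ζ) (M : ℕ) (z : ℤ → ℝ) :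
    (matA1 M ζ).mulVec (genVec M ζ z 0) =
      lamHat z 0 • (matA0 M ζ).mulVec (genVec M ζ z 0) := by
  simp only [lamHat, if_true, zero_smul, genVec, matA1, Matrix.fromBlocks_mulVec]
  ext (k | k)
  · simp [Matrix.mulVec, dotProduct]
  · simp only [Sum.elim_inr, Pi.add_apply, Matrix.mulVec, dotProduct, Function.comp_apply,
      Sum.elim_inl, Matrix.zero_apply, zero_mul, Finset.sum_const_zero, add_zero, Pi.zero_apply]
    have e := sum_mul_comb (crossMat ζ M k) (fun j => (orthPoly 0 ζ j).eval 1)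
      (fun j => (orthPoly 0 ζ j).eval (-1)) ((orthPoly 0 ζ (M + 1)).eval (-1))
      (-(orthPoly 0 ζ (M + 1)).eval 1)
    rw [crossMat_sum hζ, crossMat_sum hζ] at e
    simp only [mul_neg, ← sub_eq_add_neg] at e
    rw [e]
    ring

/-- The remainders with P_M¹ come as P_M¹(z)P_M¹(-z) - P_M¹(-z)P_M¹(z) and cancel. Those with
P_{M+1}⁰ assemble to Q_{2M}(z). -/
lemma eigen_genVec {ζ : ℝ} (hζ : 0 < ζ) (M : ℕ) (z : ℤ → ℝ) {i : ℤ} (hi : i ≠ 0)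
    (hz : z i ≠ 0) (hz1 : 1 ≤ z i ^ 2) (hQ : polyQ M ζ (z i) = 0) :
    (matA1 M ζ).mulVec (genVec M ζ z i) =
      lamHat z i • (matA0 M ζ).mulVec (genVec M ζ z i) := by
  simp only [lamHat, if_neg hi, genVec, matA1, matA0, Matrix.fromBlocks_mulVec]
  generalize z i = x at *
  rw [polyQ] at hQ
  have hs : Real.sqrt (x ^ 2 - 1) ^ 2 = x ^ 2 - 1 := Real.sq_sqrt (by linarith)
  generalize Real.sqrt (x ^ 2 - 1) = s at *
  set α := (orthPoly 1 ζ M).eval (-x)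
  set β := (orthPoly 1 ζ M).eval x
  ext (k | k)
  · simp only [Sum.elim_inl, Pi.add_apply, Matrix.mulVec, dotProduct, Function.comp_apply,
      Sum.elim_inr, Matrix.zero_apply, zero_mul, Finset.sum_const_zero, add_zero, zero_add,
      Pi.smul_apply, smul_eq_mul, Matrix.transpose_apply]
    have e1 := sum_mul_comb (fun j => crossMat ζ M j k) (fun j => (orthPoly 1 ζ j).eval x)
      (fun j => (orthPoly 1 ζ j).eval (-x)) (s * α) (-(s * β))
    have e2 := sum_mul_comb (jacobiMat 0 ζ (M + 1) k) (fun j => (orthPoly 0 ζ j).eval x)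
      (fun j => (orthPoly 0 ζ j).eval (-x)) α β
    rw [crossMat_transpose_sum hζ, crossMat_transpose_sum hζ] at e1
    rw [jacobiMat_sum 0 hζ, jacobiMat_sum 0 hζ] at e2
    rw [e2]
    have e3 : ∀ j : Fin M, crossMat ζ M j k * (s * ((orthPoly 1 ζ j).eval x * α
        - (orthPoly 1 ζ j).eval (-x) * β)) = crossMat ζ M j k * ((orthPoly 1 ζ j).eval x * (s * α)
        + (orthPoly 1 ζ j).eval (-x) * (-(s * β))) := fun j => by ring
    rw [Finset.sum_congr rfl fun j _ => e3 j, e1]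
    field_simp
    linear_combination s * (wFun 0 hζ (X * orthPoly 0 ζ k * orthPoly 0 ζ (M + 1))) * hQ
  · simp only [Sum.elim_inl, Pi.add_apply, Matrix.mulVec, dotProduct, Function.comp_apply,
      Sum.elim_inr, Matrix.zero_apply, zero_mul, Finset.sum_const_zero, add_zero, zero_add,
      Pi.smul_apply, smul_eq_mul]
    have e1 := sum_mul_comb (jacobiMat 1 ζ M k) (fun j => (orthPoly 1 ζ j).eval x)
      (fun j => (orthPoly 1 ζ j).eval (-x)) (s * α) (-(s * β))
    have e2 := sum_mul_comb (crossMat ζ M k) (fun j => (orthPoly 0 ζ j).eval x)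
      (fun j => (orthPoly 0 ζ j).eval (-x)) α β
    rw [jacobiMat_sum 1 hζ, jacobiMat_sum 1 hζ] at e1
    rw [crossMat_sum hζ, crossMat_sum hζ] at e2
    rw [e2]
    have e3 : ∀ j : Fin M, jacobiMat 1 ζ M k j * (s * ((orthPoly 1 ζ j).eval x * α
        - (orthPoly 1 ζ j).eval (-x) * β)) =
          jacobiMat 1 ζ M k j * ((orthPoly 1 ζ j).eval x * (s * α)
        + (orthPoly 1 ζ j).eval (-x) * (-(s * β))) := fun j => by ring
    rw [Finset.sum_congr rfl fun j _ => e3 j, e1]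
    set w := wFun 1 hζ (orthPoly 0 ζ (M + 1) * orthPoly 1 ζ k)
    set a := wFun 1 hζ (X * orthPoly 1 ζ k * orthPoly 1 ζ M)
    have e4 : s / x * ((x * (orthPoly 1 ζ k).eval x - a * β) * (s * α)
        + (-x * (orthPoly 1 ζ k).eval (-x) - a * α) * -(s * β)) =
        s ^ 2 * ((orthPoly 1 ζ k).eval x * α + (orthPoly 1 ζ k).eval (-x) * β) := by
      field_simp
      ring
    rw [e4, hs]
    linear_combination -w * hQ

/-- The first entry is a nonzero constant times P(-1) - P(1) with P = P_{M+1}⁰ if i = 0, and times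
P(-z) + P(z) with P = P_M¹ otherwise. Neither vanishes because |P(z)| < |P(-z)| (up to the sign of
z). -/
lemma genVec_ne_zero {ζ : ℝ} (hζ : 0 < ζ) {M : ℕ} (hM : 1 ≤ M) (z : ℤ → ℝ) {i : ℤ}
    (hz : i ≠ 0 → 1 ≤ |z i|) : genVec M ζ z i ≠ 0 := by
  have h0 := isONS_orthPoly 0 hζ
  have h1 := isONS_orthPoly 1 hζ
  have hc : ∀ x, (orthPoly 0 ζ 0).eval x = (orthPoly 0 ζ 0).eval 0 := fun x => by
    rw [eq_C_of_natDegree_eq_zero (h0.natDegree_eq 0)]; simp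
  have hc0 := h0.eval_zero_ne (isPosFunctional_wFun 0 hζ) 0
  intro hv
  have hv0 := congrFun hv (Sum.inl 0)
  by_cases hi : i = 0
  · simp only [genVec, if_pos hi, Sum.elim_inl, Fin.val_zero, Pi.zero_apply, hc 1, hc (-1)] at hv0
    rw [← mul_sub] at hv0
    have hlt := h0.abs_eval_lt_abs_eval_neg (isPosFunctional_wFun 0 hζ) (Nat.succ_pos M) le_rfl
    rw [sub_eq_zero.1 ((mul_eq_zero.1 hv0).resolve_left hc0)] at hlt
    exact lt_irrefl _ hlt
  · simp only [genVec, if_neg hi, Sum.elim_inl, Fin.val_zero, Pi.zero_apply, hc (z i),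
      hc (-z i)] at hv0
    rw [← mul_add] at hv0
    have hsum := (mul_eq_zero.1 hv0).resolve_left hc0
    have hlt := h1.abs_eval_lt_abs_eval_neg (isPosFunctional_wFun 1 hζ) hM (hz hi)
    rcases abs_choice (z i) with h | h <;> rw [h] at hlt
    · rw [eq_neg_of_add_eq_zero_left hsum, abs_neg] at hlt
      exact lt_irrefl _ hlt
    · rw [neg_neg, eq_neg_of_add_eq_zero_left hsum, abs_neg] at hlt
      exact lt_irrefl _ hlt

/-! ### Size, sign and order of the eigenvalues of the pair -/

namespace IsZeroList

variable {M : ℕ} {ζ : ℝ} {z : ℤ → ℝ}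

lemma one_lt_abs (h : IsZeroList M ζ z) {i : ℤ} (hi : i ∈ Set.Icc (-(M : ℤ)) M) (h0 : i ≠ 0) :
    1 < |z i| := by
  rcases lt_or_gt_of_ne h0 with hlt | hlt
  · rw [← abs_neg, ← h.odd]
    exact (h.one_lt _ ⟨by omega, by linarith [hi.1]⟩).trans_le (le_abs_self _)
  · exact (h.one_lt _ ⟨by omega, hi.2⟩).trans_le (le_abs_self _)

lemma pos_iff (h : IsZeroList M ζ z) {i : ℤ} (hi : i ∈ Set.Icc (-(M : ℤ)) M) (h0 : i ≠ 0) :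
    0 < z i ↔ 0 < i := by
  constructor
  · intro hz
    by_contra! hle
    have := h.one_lt (-i) ⟨by omega, by linarith [hi.1]⟩
    rw [h.odd] at this
    linarith
  · intro hi'
    linarith [h.one_lt i ⟨by omega, hi.2⟩]

lemma lamHat_sq (h : IsZeroList M ζ z) {i : ℤ} (hi : i ∈ Set.Icc (-(M : ℤ)) M) (h0 : i ≠ 0) :
    lamHat z i ^ 2 = 1 - 1 / z i ^ 2 := by
  have h1 := h.one_lt_abs hi h0
  have h2 : 1 < z i ^ 2 := by rw [← sq_abs]; nlinarith
  rw [lamHat, if_neg h0, div_pow, Real.sq_sqrt (by linarith), sub_div,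
    div_self (by linarith)]

lemma abs_lamHat_lt_one (h : IsZeroList M ζ z) {i : ℤ} (hi : i ∈ Set.Icc (-(M : ℤ)) M) :
    |lamHat z i| < 1 := by
  by_cases h0 : i = 0
  · simp [lamHat, h0]
  · rw [← sq_lt_one_iff_abs_lt_one, h.lamHat_sq hi h0]
    have h1 := h.one_lt_abs hi h0
    have h2 : 1 < z i ^ 2 := by rw [← sq_abs]; nlinarith
    have : 0 < 1 / z i ^ 2 := by positivity
    linarith

lemma lamHat_pos_iff (h : IsZeroList M ζ z) {i : ℤ} (hi : i ∈ Set.Icc (-(M : ℤ)) M) :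
    0 < lamHat z i ↔ 0 < i := by
  by_cases h0 : i = 0
  · simp [lamHat, h0]
  · have h1 := h.one_lt_abs hi h0
    have h2 : 1 < z i ^ 2 := by rw [← sq_abs]; nlinarith
    rw [← h.pos_iff hi h0, lamHat, if_neg h0]
    exact div_pos_iff_of_pos_left (Real.sqrt_pos.2 (by linarith))

lemma lamHat_neg (h : IsZeroList M ζ z) (i : ℤ) : lamHat z (-i) = -lamHat z i := by
  simp only [lamHat, neg_eq_zero, h.odd, neg_sq]
  split_ifs <;> simp [div_neg]

lemma strictMonoOn_lamHat (h : IsZeroList M ζ z) :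
    StrictMonoOn (lamHat z) (Set.Icc (1 : ℤ) M) := by
  rintro i ⟨hi1, hi2⟩ j ⟨hj1, hj2⟩ hij
  have hi : i ∈ Set.Icc (-(M : ℤ)) M := ⟨by omega, hi2⟩
  have hj : j ∈ Set.Icc (-(M : ℤ)) M := ⟨by omega, hj2⟩
  have h1 := h.one_lt i ⟨hi1, hi2⟩
  have h2 := h.strictMonoOn ⟨hi1, hi2⟩ ⟨hj1, hj2⟩ hij
  have hp := (h.lamHat_pos_iff hj).2 (by omega)
  refine lt_of_pow_lt_pow_left₀ 2 hp.le ?_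
  rw [h.lamHat_sq hi (by omega), h.lamHat_sq hj (by omega)]
  have : 1 / z j ^ 2 < 1 / z i ^ 2 := by
    apply one_div_lt_one_div_of_lt <;> nlinarith
  linarith

/-- The values have the sign of the index and are odd in it, so monotonicity on the positive indices
suffices. -/
lemma injOn_lamHat (h : IsZeroList M ζ z) : Set.InjOn (lamHat z) (Set.Icc (-(M : ℤ)) M) := by
  intro i hi j hj hij
  have hpos := (h.lamHat_pos_iff hi).symm.trans (hij ▸ h.lamHat_pos_iff hj)
  have hni : -i ∈ Set.Icc (-(M : ℤ)) M := ⟨by linarith [hi.2], by linarith [hi.1]⟩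
  have hnj : -j ∈ Set.Icc (-(M : ℤ)) M := ⟨by linarith [hj.2], by linarith [hj.1]⟩
  have hij' : lamHat z (-i) = lamHat z (-j) := by rw [h.lamHat_neg, h.lamHat_neg, hij]
  have hneg := (h.lamHat_pos_iff hni).symm.trans (hij' ▸ h.lamHat_pos_iff hnj)
  have hi1 := hi.1
  have hi2 := hi.2
  have hj1 := hj.1
  have hj2 := hj.2
  rcases lt_trichotomy i 0 with h0 | h0 | h0
  · have := h.strictMonoOn_lamHat.injOn (x₁ := -i) (x₂ := -j) ⟨by omega, by omega⟩
      ⟨by omega, by omega⟩ hij'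
    omega
  · omega
  · exact h.strictMonoOn_lamHat.injOn ⟨by omega, by omega⟩ ⟨by omega, by omega⟩ hij

theorem isEigenSystem_pair (h : IsZeroList M ζ z) (hζ : 0 < ζ) (hM : 1 ≤ M) :
    IsEigenSystem M (matA0 M ζ) (matA1 M ζ) (lamHat z) (genVec M ζ z) := by
  refine isEigenSystem_of_eigen (by simp; omega) (isUnit_det_matA0 hζ M) h.injOn_lamHat
    (fun i hi => genVec_ne_zero hζ hM z fun h0 => (h.one_lt_abs hi h0).le) fun i hi => ?_
  by_cases h0 : i = 0
  · rw [h0]; exact eigen_genVec_zero hζ M z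
  · have h1 := h.one_lt_abs hi h0
    refine eigen_genVec hζ M z h0 (abs_pos.1 (by linarith)) (by rw [← sq_abs]; nlinarith)
      ((h.zeros _).2 ⟨i, hi, h0, rfl⟩)

end IsZeroList

/-! ### Momentum integrals -/

/-- The normalized momentum `(U⁰)⁻¹ p_{<1>}`. -/
def nmom (u p : ℝ) : ℝ := (U0 u)⁻¹ * pLow u p

/-- The function `g (A(E) + (U⁰)⁻¹ p_{<1>} B(E))` of the momentum. -/
def mix (u θ : ℝ) (A B : ℝ[X]) (p : ℝ) : ℝ :=
  gEq u θ p * (A.eval (energy u p) + nmom u p * B.eval (energy u p))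

section Kinematics

variable {u : ℝ}

lemma one_sub_sq_pos (hu : |u| < 1) : 0 < 1 - u ^ 2 := by
  have := (sq_lt_one_iff_abs_lt_one u).2 hu
  linarith

lemma U0_pos (hu : |u| < 1) : 0 < U0 u := by
  have := Real.sqrt_pos.2 (one_sub_sq_pos hu)
  unfold U0
  positivity

lemma U0_sq (hu : |u| < 1) : U0 u ^ 2 * (1 - u ^ 2) = 1 := by
  have h := one_sub_sq_pos hu
  rw [U0, div_pow, Real.sq_sqrt h.le]
  field_simp

lemma U1_eq (u : ℝ) : U1 u = u * U0 u := by rw [U1, U0]; ring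

lemma U0_sq_eq (hu : |u| < 1) : U0 u ^ 2 = 1 + U1 u ^ 2 := by
  rw [U1_eq]
  linear_combination U0_sq hu

lemma nmom_eq (hu : |u| < 1) (p : ℝ) : nmom u p = U1 u * p0 p - U0 u * p := by
  have h := (U0_pos hu).ne'
  rw [nmom, pLow, energy, inv_mul_eq_iff_eq_mul₀ h]
  linear_combination p * U0_sq_eq hu

lemma exists_rapidity (hu : |u| < 1) :
    ∃ φ : ℝ, U0 u = Real.cosh φ ∧ U1 u = Real.sinh φ := by
  refine ⟨Real.arsinh (U1 u), ?_, (Real.sinh_arsinh _).symm⟩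
  rw [Real.cosh_arsinh, ← U0_sq_eq hu, Real.sqrt_sq (U0_pos hu).le]

lemma p0_sinh (t : ℝ) : p0 (Real.sinh t) = Real.cosh t := by
  rw [p0, add_comm, ← Real.cosh_sq, Real.sqrt_sq (Real.cosh_pos t).le]

lemma hasDerivAt_U0 (hu : |u| < 1) : HasDerivAt U0 (u * U0 u ^ 3) u := by
  have h := one_sub_sq_pos hu
  have hs := Real.sqrt_pos.2 h
  have h1 : HasDerivAt (fun x : ℝ => 1 - x ^ 2) (-(2 * u)) u := by
    simpa using (hasDerivAt_pow 2 u).const_sub 1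
  have h2 := (h1.sqrt h.ne').inv hs.ne'
  have h3 : U0 = (fun x : ℝ => Real.sqrt (1 - x ^ 2))⁻¹ := by
    funext x; simp [U0]
  rw [h3]
  refine h2.congr_deriv ?_
  simp only [Pi.inv_apply]
  field_simp

lemma hasDerivAt_U1 (hu : |u| < 1) : HasDerivAt U1 (U0 u ^ 3) u := by
  have h := (hasDerivAt_id u).mul (hasDerivAt_U0 hu)
  have h3 : U1 = id * U0 := funext fun x => U1_eq x
  rw [h3]
  refine h.congr_deriv ?_
  simp only [id]
  linear_combination -U0 u * U0_sq hu

/-- A change of u is an infinitesimal boost: the rapidity grows at the rate (U⁰)², and boosts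
exchange the energy and the normalized momentum. -/
lemma hasDerivAt_energy (hu : |u| < 1) (p : ℝ) :
    HasDerivAt (fun s => energy s p) (U0 u ^ 2 * nmom u p) u := by
  have h := ((hasDerivAt_U0 hu).mul_const (p0 p)).sub ((hasDerivAt_U1 hu).mul_const p)
  refine h.congr_deriv ?_
  rw [nmom_eq hu, U1_eq]
  ring

lemma hasDerivAt_nmom (hu : |u| < 1) (p : ℝ) :
    HasDerivAt (fun s => nmom s p) (U0 u ^ 2 * energy u p) u := by
  have h := ((hasDerivAt_U1 hu).mul_const (p0 p)).sub ((hasDerivAt_U0 hu).mul_const p)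
  have hev : (fun s => nmom s p) =ᶠ[nhds u] fun s => U1 s * p0 p - U0 s * p := by
    have : ∀ᶠ s in nhds u, |s| < 1 := continuous_abs.continuousAt.eventually_lt_const hu
    filter_upwards [this] with s hs using nmom_eq hs p
  refine (h.congr_of_eventuallyEq hev).congr_deriv ?_
  rw [energy, U1_eq]
  ring

lemma energy_sq (hu : |u| < 1) (p : ℝ) : energy u p ^ 2 = 1 + nmom u p ^ 2 := by
  have hp : p0 p ^ 2 = 1 + p ^ 2 := Real.sq_sqrt (by positivity)
  rw [nmom_eq hu, energy]
  linear_combination hp + (p0 p ^ 2 - p ^ 2) * U0_sq_eq hu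

/-- Change of variables to the rapidity relative to the fluid. -/
lemma integral_momentum (hu : |u| < 1) (H : ℝ → ℝ → ℝ) :
    ∫ p : ℝ, H (energy u p) (nmom u p) / p0 p = ∫ t : ℝ, H (Real.cosh t) (-Real.sinh t) := by
  obtain ⟨φ, h0, h1⟩ := exists_rapidity hu
  have himg : Real.sinh '' Set.univ = Set.univ := by
    rw [Set.image_univ, Real.sinh_surjective.range_eq]
  rw [← setIntegral_univ, ← himg, integral_image_eq_integral_abs_deriv_smul MeasurableSet.univ
    (fun t _ => (Real.hasDerivAt_sinh t).hasDerivWithinAt) Real.sinh_injective.injOn,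
    setIntegral_univ,
    -- Put p = sinh t, whose Jacobian cancels p⁰. A translation by the rapidity φ of the fluid then
    -- leads to its rest frame.
    ← integral_sub_right_eq_self (fun t => H (Real.cosh t) (-Real.sinh t)) φ]
  refine integral_congr_ae (Filter.Eventually.of_forall fun t => ?_)
  have hE : energy u (Real.sinh t) = Real.cosh (t - φ) := by
    rw [energy, p0_sinh, h0, h1, Real.cosh_sub]; ring
  have hN : nmom u (Real.sinh t) = -Real.sinh (t - φ) := by
    rw [nmom_eq hu, p0_sinh, h0, h1, Real.sinh_sub]; ring
  have hc := Real.cosh_pos t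
  simp only [hE, hN, p0_sinh, abs_of_pos hc, smul_eq_mul]
  field_simp

end Kinematics

lemma gEq_eq (u θ p : ℝ) :
    gEq u θ p = (expMom θ⁻¹ X)⁻¹ * Real.exp (-θ⁻¹ * energy u p) := by
  rw [gEq, two_mul_besselK_one, one_div]
  congr 2
  rw [div_eq_inv_mul, neg_mul]

lemma gEq_pos {θ : ℝ} (hθ : 0 < θ) (u p : ℝ) : 0 < gEq u θ p := by
  rw [gEq_eq]
  exact mul_pos (inv_pos.2 (expMom_X_pos (inv_pos.2 hθ))) (Real.exp_pos _)

lemma integral_sinh_mul_eval_cosh (ζ : ℝ) (f : ℝ[X]) :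
    ∫ t : ℝ, Real.sinh t * f.eval (Real.cosh t) * Real.exp (-ζ * Real.cosh t) = 0 := by
  have h := integral_neg_eq_self
    (fun t : ℝ => Real.sinh t * f.eval (Real.cosh t) * Real.exp (-ζ * Real.cosh t)) volume
  simp only [Real.sinh_neg, Real.cosh_neg, neg_mul, integral_neg] at h ⊢
  linarith

/-- In the rapidity variable the mixed terms are odd and integrate to zero; the product of the two
momentum factors is sinh² = cosh² - 1, which supplies the weight for `ℓ = 1`. -/
lemma gip_mix {u θ : ℝ} (hu : |u| < 1) (hθ : 0 < θ) (A B F G : ℝ[X]) :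
    gip u θ (mix u θ A B) (mix u θ F G) =
      wip 0 θ⁻¹ A F + wip 1 θ⁻¹ B G := by
  have hζ := inv_pos.2 hθ
  set ζ := θ⁻¹ with hζd
  set H : ℝ → ℝ → ℝ := fun e q => (expMom ζ X)⁻¹ * Real.exp (-ζ * e) *
    (A.eval e + q * B.eval e) * (F.eval e + q * G.eval e) with hH
  have e1 : gip u θ (mix u θ A B) (mix u θ F G) =
      ∫ p : ℝ, H (energy u p) (nmom u p) / p0 p := by
    refine integral_congr_ae (Filter.Eventually.of_forall fun p => ?_)
    have hg := (gEq_pos hθ u p).ne'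
    simp only [mix, hH]
    rw [hζd, ← gEq_eq]
    field_simp
  have e2 : ∀ t : ℝ, (expMom ζ X)⁻¹ * Real.exp (-ζ * Real.cosh t) *
      (A.eval (Real.cosh t) + -Real.sinh t * B.eval (Real.cosh t)) *
        (F.eval (Real.cosh t) + -Real.sinh t * G.eval (Real.cosh t)) =
      (expMom ζ X)⁻¹ * (((A * F + (X ^ 2 - 1) * (B * G)).eval (Real.cosh t) *
        Real.exp (-ζ * Real.cosh t)) -
        Real.sinh t * (A * G + B * F).eval (Real.cosh t) * Real.exp (-ζ * Real.cosh t)) := by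
    intro t
    simp only [eval_add, eval_mul, eval_sub, eval_pow, eval_X, eval_one]
    linear_combination -((expMom ζ X)⁻¹ * Real.exp (-ζ * Real.cosh t) * B.eval (Real.cosh t) *
      G.eval (Real.cosh t)) * Real.cosh_sq t
  refine (e1.trans (integral_momentum hu H)).trans ?_
  simp only [hH, e2]
  rw [integral_const_mul, integral_sub (integrable_eval_cosh hζ _)
    (integrable_sinh_mul_eval_cosh hζ _), integral_sinh_mul_eval_cosh, sub_zero]
  rw [wip_eq_wFun 0 hζ, wip_eq_wFun 1 hζ, wFun_one, ← map_add, wFun_zero_apply hζ, div_eq_inv_mul]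
  rfl

/-- The scalar coefficient of the velocity derivative of `mix`. -/
def velA (u ζ : ℝ) (B : ℝ[X]) : ℝ[X] :=
  C (U0 u ^ 2) * (X * B + (X ^ 2 - 1) * (derivative B - C ζ * B))

/-- The vector coefficient of the velocity derivative of `mix`. -/
def velB (u ζ : ℝ) (A : ℝ[X]) : ℝ[X] := C (U0 u ^ 2) * (derivative A - C ζ * A)

/-- The form is preserved because the square of the normalized momentum, produced by
differentiation, equals E² - 1. -/
lemma hasDerivAt_mix_vel {u : ℝ} (hu : |u| < 1) (θ : ℝ) (A B : ℝ[X]) (p : ℝ) :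
    HasDerivAt (fun s => mix s θ A B p) (mix u θ (velA u θ⁻¹ B) (velB u θ⁻¹ A) p) u := by
  have hE := hasDerivAt_energy hu p
  have hN := hasDerivAt_nmom hu p
  have hA := (A.hasDerivAt (energy u p)).comp u hE
  have hB := (B.hasDerivAt (energy u p)).comp u hE
  have hg := ((hE.const_mul (-θ⁻¹)).exp).const_mul (expMom θ⁻¹ X)⁻¹
  have h := hg.mul (hA.add (hN.mul hB))
  have e : (fun s => mix s θ A B p) = fun s => (expMom θ⁻¹ X)⁻¹ *
      Real.exp (-θ⁻¹ * energy s p) * (A.eval (energy s p) + nmom s p * B.eval (energy s p)) := by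
    funext s; rw [mix, gEq_eq]
  rw [e]
  refine h.congr_deriv ?_
  rw [mix, gEq_eq]
  simp only [velA, velB, eval_add, eval_mul, eval_sub, eval_pow, eval_X, eval_one, eval_C,
    Function.comp_apply, Pi.add_apply, Pi.mul_apply, energy_sq hu]
  ring

/-- Integration by parts moves the derivative to the test polynomial, so a test with low degree
needs only low moments of `B`. -/
lemma wFun_velA_mul {u ζ : ℝ} (hζ : 0 < ζ) (B h : ℝ[X]) :
    wFun 0 hζ (velA u ζ B * h) = -U0 u ^ 2 * wFun 1 hζ (B * derivative h) := by
  have e := expMom_by_parts hζ (B * h)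
  have e0 : wFun 0 hζ (X * (B * h) + (X ^ 2 - 1) * (derivative (B * h) - C ζ * (B * h))) = 0 := by
    rw [wFun_zero_apply, e, zero_div]
  have e1 : velA u ζ B * h = C (U0 u ^ 2) *
      ((X * (B * h) + (X ^ 2 - 1) * (derivative (B * h) - C ζ * (B * h)))
        - (X ^ 2 - 1) * (B * derivative h)) := by
    rw [velA, derivative_mul]; ring
  rw [e1, map_C_mul, map_sub, e0, wFun_one]
  ring

lemma wFun_velB_mul {u ζ : ℝ} (hζ : 0 < ζ) (A h : ℝ[X]) :
    wFun 1 hζ (velB u ζ A * h) =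
      -U0 u ^ 2 * wFun 0 hζ (A * (X * h + (X ^ 2 - 1) * derivative h)) := by
  have e := expMom_by_parts hζ (A * h)
  have e0 : wFun 0 hζ (X * (A * h) + (X ^ 2 - 1) * (derivative (A * h) - C ζ * (A * h))) = 0 := by
    rw [wFun_zero_apply, e, zero_div]
  have e1 : (X ^ 2 - 1) * (velB u ζ A * h) = C (U0 u ^ 2) *
      ((X * (A * h) + (X ^ 2 - 1) * (derivative (A * h) - C ζ * (A * h)))
        - A * (X * h + (X ^ 2 - 1) * derivative h)) := by
    rw [velB, derivative_mul]; ring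
  rw [wFun_one, e1, map_C_mul, map_sub, e0]
  ring

/-! ### Differentiable families of polynomials -/

/-- A family of polynomials of bounded degree with coefficients differentiable at `s`. -/
structure PolyDiffAt (A : ℝ → ℝ[X]) (s : ℝ) : Prop where
  bounded : ∃ N, ∀ t, (A t).natDegree ≤ N
  coeff : ∀ i, DifferentiableAt ℝ (fun t => (A t).coeff i) s

namespace PolyDiffAt

variable {A B : ℝ → ℝ[X]} {s : ℝ}

lemma const (p : ℝ[X]) (s : ℝ) : PolyDiffAt (fun _ => p) s :=
  ⟨⟨p.natDegree, fun _ => le_rfl⟩, fun _ => differentiableAt_const _⟩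

lemma of_scalar {f : ℝ → ℝ} (hf : DifferentiableAt ℝ f s) : PolyDiffAt (fun t => C (f t)) s := by
  refine ⟨⟨0, fun t => by simp⟩, fun i => ?_⟩
  simp only [coeff_C]
  split_ifs
  · exact hf
  · exact differentiableAt_const _

lemma add (hA : PolyDiffAt A s) (hB : PolyDiffAt B s) : PolyDiffAt (fun t => A t + B t) s := by
  obtain ⟨⟨N, hN⟩, hA⟩ := hA
  obtain ⟨⟨K, hK⟩, hB⟩ := hB
  refine ⟨⟨max N K, fun t => natDegree_add_le_of_degree_le ((hN t).trans (le_max_left _ _))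
    ((hK t).trans (le_max_right _ _))⟩, fun i => ?_⟩
  simp only [coeff_add]
  exact (hA i).fun_add (hB i)

lemma mul (hA : PolyDiffAt A s) (hB : PolyDiffAt B s) : PolyDiffAt (fun t => A t * B t) s := by
  obtain ⟨⟨N, hN⟩, hA⟩ := hA
  obtain ⟨⟨K, hK⟩, hB⟩ := hB
  refine ⟨⟨N + K, fun t => natDegree_mul_le_of_le (hN t) (hK t)⟩, fun i => ?_⟩
  simp only [coeff_mul]
  exact DifferentiableAt.fun_sum fun x _ => (hA _).fun_mul (hB _)

lemma neg (hA : PolyDiffAt A s) : PolyDiffAt (fun t => -A t) s := by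
  simpa using (const (-1) s).mul hA

lemma sub (hA : PolyDiffAt A s) (hB : PolyDiffAt B s) : PolyDiffAt (fun t => A t - B t) s := by
  simpa only [sub_eq_add_neg] using hA.add hB.neg

lemma sum {ι : Type*} (S : Finset ι) {F : ι → ℝ → ℝ[X]} (hF : ∀ i ∈ S, PolyDiffAt (F i) s) :
    PolyDiffAt (fun t => ∑ i ∈ S, F i t) s := by
  classical
  induction S using Finset.induction with
  | empty => simpa using const 0 s
  | insert a S ha ih =>
    simp only [Finset.sum_insert ha]
    exact (hF a (Finset.mem_insert_self a S)).add
      (ih fun i hi => hF i (Finset.mem_insert_of_mem hi))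

lemma comp_inv (hA : PolyDiffAt A s⁻¹) (hs : s ≠ 0) : PolyDiffAt (fun t => A t⁻¹) s := by
  obtain ⟨⟨N, hN⟩, hA⟩ := hA
  exact ⟨⟨N, fun t => hN _⟩, fun i =>
    (hA i).fun_comp' s (f := fun t => t⁻¹) (differentiableAt_inv hs)⟩

end PolyDiffAt

lemma expMom_mul_eq_sum {ζ : ℝ} (hζ : 0 < ζ) {f : ℝ[X]} {N : ℕ} (hN : f.natDegree ≤ N)
    (h : ℝ[X]) :
    expMom ζ (f * h) = ∑ i ∈ Finset.range (N + 1), f.coeff i * expMom ζ (X ^ i * h) := by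
  have e : f * h = ∑ i ∈ Finset.range (N + 1), C (f.coeff i) * (X ^ i * h) := by
    conv_lhs => rw [f.as_sum_range_C_mul_X_pow' (Nat.lt_succ_of_le hN), Finset.sum_mul]
    exact Finset.sum_congr rfl fun i _ => by ring
  rw [e]
  change expMomL hζ _ = _
  rw [map_sum]
  exact Finset.sum_congr rfl fun i _ => map_C_mul (expMomL hζ) _ _

lemma PolyDiffAt.expMom {A : ℝ → ℝ[X]} {s : ℝ} (hA : PolyDiffAt A s) (hs : 0 < s) :
    DifferentiableAt ℝ (fun t => expMom t (A t)) s := by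
  obtain ⟨⟨N, hN⟩, hA⟩ := hA
  have hev : (fun t => RelMoment.expMom t (A t)) =ᶠ[nhds s] fun t =>
      ∑ i ∈ Finset.range (N + 1), (A t).coeff i * RelMoment.expMom t (X ^ i * 1) := by
    filter_upwards [Ioi_mem_nhds hs] with t ht
    rw [← expMom_mul_eq_sum ht (hN t), mul_one]
  refine DifferentiableAt.congr_of_eventuallyEq ?_ hev
  exact DifferentiableAt.fun_sum fun i _ =>
    (hA i).fun_mul (hasDerivAt_expMom hs _).differentiableAt

lemma PolyDiffAt.wip {A B : ℝ → ℝ[X]} {s : ℝ} (ℓ : Fin 2) (hA : PolyDiffAt A s)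
    (hB : PolyDiffAt B s) (hs : 0 < s) : DifferentiableAt ℝ (fun t => wip ℓ t (A t) (B t)) s := by
  simp only [wip_eq]
  exact (((PolyDiffAt.const _ s).mul (hA.mul hB)).expMom hs).fun_div
    ((PolyDiffAt.const X s).expMom hs) (expMom_X_pos hs).ne'

/-- Gram-Schmidt uses only sums, products, moments and the inverse square root of a positive norm.
-/
lemma polyDiffAt_orthPoly (ℓ : Fin 2) {s : ℝ} (hs : 0 < s) (n : ℕ) :
    PolyDiffAt (fun t => orthPoly ℓ t n) s := by
  induction n using Nat.strong_induction_on with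
  | _ n ih =>
    have hpre : PolyDiffAt (fun t => preOrth ℓ t n) s := by
      refine (PolyDiffAt.const (X ^ n) s).sub (PolyDiffAt.sum _ fun k hk => ?_)
      have hk' := ih k (Finset.mem_range.1 hk)
      exact (PolyDiffAt.of_scalar ((PolyDiffAt.const (X ^ n) s).wip ℓ hk' hs)).mul hk'
    -- As `0⁻¹ = 0`, a vanishing norm would make the orthonormal polynomial itself zero.
    have hsq : Real.sqrt (wip ℓ s (preOrth ℓ s n) (preOrth ℓ s n)) ≠ 0 := by
      intro h0
      refine (isONS_orthPoly ℓ hs).ne_zero n ?_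
      rw [orthPoly_eq, h0]
      simp
    have hne : wip ℓ s (preOrth ℓ s n) (preOrth ℓ s n) ≠ 0 := fun h0 => hsq (by rw [h0]; simp)
    simp only [orthPoly_eq ℓ _ n]
    exact (PolyDiffAt.of_scalar (((hpre.wip ℓ hpre hs).sqrt hne).fun_inv hsq)).mul hpre

/-- Termwise derivative of a differentiable family, and of its moments with `ζ = t⁻¹`. -/
lemma PolyDiffAt.exists_deriv {A : ℝ → ℝ[X]} {s : ℝ} (hA : PolyDiffAt A s) (hs : 0 < s) :
    ∃ A' : ℝ[X], (∀ x, HasDerivAt (fun t => (A t).eval x) (A'.eval x) s) ∧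
      ∀ h : ℝ[X], HasDerivAt (fun t => RelMoment.expMom t⁻¹ (A t * h))
        (RelMoment.expMom s⁻¹ (A' * h) + (s ^ 2)⁻¹ * RelMoment.expMom s⁻¹ (X * (A s * h))) s := by
  obtain ⟨⟨N, hN⟩, hA⟩ := hA
  set A' : ℝ[X] := ∑ i ∈ Finset.range (N + 1), C (deriv (fun t => (A t).coeff i) s) * X ^ i
    with hA'
  refine ⟨A', fun x => ?_, fun h => ?_⟩
  · have e : (fun t => (A t).eval x) =
        fun t => ∑ i ∈ Finset.range (N + 1), (A t).coeff i * x ^ i :=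
      funext fun t => eval_eq_sum_range' (Nat.lt_succ_of_le (hN t)) x
    rw [e, hA', eval_finsetSum]
    simp only [eval_mul, eval_C, eval_pow, eval_X]
    exact HasDerivAt.fun_sum fun i _ => (hA i).hasDerivAt.mul_const _
  · have hζ := inv_pos.2 hs
    have hev : (fun t => RelMoment.expMom t⁻¹ (A t * h)) =ᶠ[nhds s] fun t =>
        ∑ i ∈ Finset.range (N + 1), (A t).coeff i * RelMoment.expMom t⁻¹ (X ^ i * h) := by
      filter_upwards [Ioi_mem_nhds hs] with t ht
      rw [← expMom_mul_eq_sum (inv_pos.2 ht) (hN t)]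
    have hd : ∀ i ∈ Finset.range (N + 1), HasDerivAt
        (fun t => (A t).coeff i * RelMoment.expMom t⁻¹ (X ^ i * h))
        (deriv (fun t => (A t).coeff i) s * RelMoment.expMom s⁻¹ (X ^ i * h) +
          (A s).coeff i * (-RelMoment.expMom s⁻¹ (X * (X ^ i * h)) * -(s ^ 2)⁻¹)) s := fun i _ =>
      (hA i).hasDerivAt.mul ((hasDerivAt_expMom hζ (X ^ i * h)).comp s (hasDerivAt_inv hs.ne'))
    refine ((HasDerivAt.fun_sum hd).congr_of_eventuallyEq hev).congr_deriv ?_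
    have e1 : A' * h = ∑ i ∈ Finset.range (N + 1),
        C (deriv (fun t => (A t).coeff i) s) * (X ^ i * h) := by
      rw [hA', Finset.sum_mul]
      exact Finset.sum_congr rfl fun i _ => by ring
    have e2 : RelMoment.expMom s⁻¹ (A' * h) = ∑ i ∈ Finset.range (N + 1),
        deriv (fun t => (A t).coeff i) s * RelMoment.expMom s⁻¹ (X ^ i * h) := by
      rw [e1]
      change expMomL hζ _ = _
      rw [map_sum]
      exact Finset.sum_congr rfl fun i _ => map_C_mul (expMomL hζ) _ _
    rw [Finset.sum_add_distrib, ← e2, mul_left_comm X, expMom_mul_eq_sum hζ (hN s), Finset.mul_sum]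
    congr 1
    refine Finset.sum_congr rfl fun i _ => ?_
    rw [mul_left_comm (X ^ i)]
    ring

/-- The temperature derivative of `mix` along differentiable families. -/
lemma exists_hasDerivAt_mix_theta {A B : ℝ → ℝ[X]} {θ : ℝ} (hθ : 0 < θ) (hA : PolyDiffAt A θ)
    (hB : PolyDiffAt B θ) : ∃ F G : ℝ[X],
      (∀ u p, HasDerivAt (fun s => mix u s (A s) (B s) p) (mix u θ F G p) θ) ∧
      (∀ h, HasDerivAt (fun s => wip 0 s⁻¹ (A s) h) (wip 0 θ⁻¹ F h) θ) ∧
      (∀ h, HasDerivAt (fun s => wip 1 s⁻¹ (B s) h) (wip 1 θ⁻¹ G h) θ) := by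
  have hζ := inv_pos.2 hθ
  obtain ⟨A', hA1, hA2⟩ := hA.exists_deriv hθ
  obtain ⟨B', hB1, hB2⟩ := hB.exists_deriv hθ
  have hN0 := (expMom_X_pos hζ).ne'
  obtain ⟨N', hN⟩ : ∃ N', HasDerivAt (fun s : ℝ => expMom s⁻¹ X) N' θ :=
    ⟨_, (hasDerivAt_expMom hζ X).comp θ (hasDerivAt_inv hθ.ne')⟩
  -- This is the logarithmic θ-derivative of g as a polynomial in E. The same derivative polynomials
  -- serve pointwise and for the moments.
  set m : ℝ[X] := C (θ ^ 2)⁻¹ * X - C (N' / expMom θ⁻¹ X) with hm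
  have hwip : ∀ (A : ℝ → ℝ[X]) (A' : ℝ[X]), (∀ h : ℝ[X],
      HasDerivAt (fun t => expMom t⁻¹ (A t * h))
        (expMom θ⁻¹ (A' * h) + (θ ^ 2)⁻¹ * expMom θ⁻¹ (X * (A θ * h))) θ) → ∀ h : ℝ[X],
      HasDerivAt (fun s => expMom s⁻¹ (A s * h) / expMom s⁻¹ X)
        (expMom θ⁻¹ ((A' + m * A θ) * h) / expMom θ⁻¹ X) θ := by
    intro A A' hA h
    refine ((hA h).fun_div hN hN0).congr_deriv ?_
    have e : (A' + m * A θ) * h = A' * h + (C (θ ^ 2)⁻¹ * (X * (A θ * h))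
        + C (-(N' / expMom θ⁻¹ X)) * (A θ * h)) := by
      rw [hm, C_neg]; ring
    rw [e, expMom_add hζ, expMom_add hζ, expMom_C_mul, expMom_C_mul]
    generalize expMom θ⁻¹ X = n at hN0 ⊢
    field_simp
    ring
  refine ⟨A' + m * A θ, B' + m * B θ, fun u p => ?_, fun h => ?_, fun h => ?_⟩
  · have hexp : HasDerivAt (fun s : ℝ => Real.exp (-s⁻¹ * energy u p))
        (Real.exp (-θ⁻¹ * energy u p) * ((θ ^ 2)⁻¹ * energy u p)) θ := by
      refine (((hasDerivAt_inv hθ.ne').fun_neg.mul_const (energy u p)).exp).congr_deriv ?_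
      rw [neg_neg]
    have h := ((hN.fun_inv hN0).fun_mul hexp).fun_mul
      ((hA1 (energy u p)).fun_add ((hB1 (energy u p)).const_mul (nmom u p)))
    have e : (fun s => mix u s (A s) (B s) p) = fun s => (expMom s⁻¹ X)⁻¹ *
        Real.exp (-s⁻¹ * energy u p) *
        ((A s).eval (energy u p) + nmom u p * (B s).eval (energy u p)) := by
      funext s; rw [mix, gEq_eq]
    rw [e]
    refine h.congr_deriv ?_
    rw [mix, gEq_eq]
    simp only [hm, eval_add, eval_mul, eval_sub, eval_X, eval_C]
    generalize expMom θ⁻¹ X = n at hN0 ⊢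
    field_simp
    ring
  · simpa only [wip_eq, Fin.val_zero, pow_zero, one_mul] using hwip A A' hA2 h
  · have e : ∀ f : ℝ[X], (X ^ 2 - 1) * (f * h) = f * ((X ^ 2 - 1) * h) := fun f => by ring
    simpa only [wip_eq, Fin.val_one, pow_one, e] using hwip B B' hB2 ((X ^ 2 - 1) * h)

/-! ### The polynomial coefficients of the projected distribution -/

lemma basisFn_of_scalar (u θ : ℝ) {j : ℕ} (hj : j = 0 ∨ Odd j) :
    basisFn u θ j = mix u θ (posPoly θ⁻¹ j) 0 := by
  funext p
  simp [basisFn, mix, if_pos hj]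

lemma basisFn_of_vector (u θ : ℝ) {j : ℕ} (hj : ¬ (j = 0 ∨ Odd j)) :
    basisFn u θ j = mix u θ 0 (posPoly θ⁻¹ j) := by
  funext p
  simp only [basisFn, mix, if_neg hj, nmom, eval_zero, zero_add]
  ring

/-- The combination of the polynomials `P_n^{(0)}` in the distribution of the state `w`. -/
def polyA {M : ℕ} (θ : ℝ) (w : State M) : ℝ[X] :=
  ∑ j : Fin (2 * M + 1), if (j : ℕ) = 0 ∨ Odd (j : ℕ) then
    C ((matDW M θ).mulVec w j) * posPoly θ⁻¹ j else 0

/-- The combination of the polynomials `P_n^{(1)}` in the distribution of the state `w`. -/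
def polyB {M : ℕ} (θ : ℝ) (w : State M) : ℝ[X] :=
  ∑ j : Fin (2 * M + 1), if (j : ℕ) = 0 ∨ Odd (j : ℕ) then 0 else
    C ((matDW M θ).mulVec w j) * posPoly θ⁻¹ j

lemma projDist_eq {M : ℕ} (W : State M) :
    projDist W = mix W.vel W.theta (polyA W.theta W) (polyB W.theta W) := by
  funext p
  simp only [projDist, mix, polyA, polyB, eval_finsetSum, Finset.mul_sum,
    ← Finset.sum_add_distrib]
  refine Finset.sum_congr rfl fun j _ => ?_
  by_cases hj : (j : ℕ) = 0 ∨ Odd (j : ℕ)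
  · rw [basisFn_of_scalar _ _ hj, if_pos hj, if_pos hj, mix]
    simp only [eval_mul, eval_C, eval_zero]
    ring
  · rw [basisFn_of_vector _ _ hj, if_neg hj, if_neg hj, mix]
    simp only [eval_mul, eval_C, eval_zero]
    ring

lemma polyA_add_smul {M : ℕ} (θ : ℝ) (v w : State M) (c : ℝ) :
    polyA θ (v + c • w) = polyA θ v + C c * polyA θ w := by
  simp only [polyA, Finset.mul_sum, ← Finset.sum_add_distrib, Matrix.mulVec_add,
    Matrix.mulVec_smul, Pi.add_apply, Pi.smul_apply, smul_eq_mul]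
  refine Finset.sum_congr rfl fun j _ => ?_
  split_ifs
  · rw [C_add, C_mul]; ring
  · ring

lemma polyB_add_smul {M : ℕ} (θ : ℝ) (v w : State M) (c : ℝ) :
    polyB θ (v + c • w) = polyB θ v + C c * polyB θ w := by
  simp only [polyB, Finset.mul_sum, ← Finset.sum_add_distrib, Matrix.mulVec_add,
    Matrix.mulVec_smul, Pi.add_apply, Pi.smul_apply, smul_eq_mul]
  refine Finset.sum_congr rfl fun j _ => ?_
  split_ifs
  · ring
  · rw [C_add, C_mul]; ring

/-- `polyA` as a linear map of the state. -/
def polyAL {M : ℕ} (θ : ℝ) : State M →ₗ[ℝ] ℝ[X] where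
  toFun := polyA θ
  map_add' v w := by simpa using polyA_add_smul θ v w 1
  map_smul' c w := by
    have h0 : polyA θ (0 : State M) = 0 := by simp [polyA]
    simpa [h0, smul_eq_C_mul] using polyA_add_smul θ 0 w c

/-- `polyB` as a linear map of the state. -/
def polyBL {M : ℕ} (θ : ℝ) : State M →ₗ[ℝ] ℝ[X] where
  toFun := polyB θ
  map_add' v w := by simpa using polyB_add_smul θ v w 1
  map_smul' c w := by
    have h0 : polyB θ (0 : State M) = 0 := by simp [polyB]
    simpa [h0, smul_eq_C_mul] using polyB_add_smul θ 0 w c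

/-- The columns of u and θ are zero: these variables act through the basis and, for θ, the entries
of `matDW`, not through the linear coefficients. -/
lemma matDW_mulVec_single {M : ℕ} (θ : ℝ) {k : Fin (2 * M + 1)} (hk : (k : ℕ) = 1 ∨ (k : ℕ) = 2) :
    (matDW M θ).mulVec (Pi.single k 1) = 0 := by
  funext j
  have h0 : (k : ℕ) ≠ 0 := by omega
  rw [Matrix.mulVec_single_one]
  simp [matDW, h0, hk]

lemma polyA_single {M : ℕ} (θ : ℝ) {k : Fin (2 * M + 1)} (hk : (k : ℕ) = 1 ∨ (k : ℕ) = 2) :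
    polyA θ (Pi.single k 1 : State M) = 0 := by
  simp [polyA, matDW_mulVec_single θ hk]

lemma polyB_single {M : ℕ} (θ : ℝ) {k : Fin (2 * M + 1)} (hk : (k : ℕ) = 1 ∨ (k : ℕ) = 2) :
    polyB θ (Pi.single k 1 : State M) = 0 := by
  simp [polyB, matDW_mulVec_single θ hk]

lemma update_eq_add {M : ℕ} (W : State M) (k : Fin (2 * M + 1)) (s : ℝ) :
    Function.update W k s = W + (s - W k) • (Pi.single k 1 : State M) := by
  funext j
  by_cases h : j = k
  · subst h; simp
  · simp [h]

lemma polyA_update {M : ℕ} (θ : ℝ) (W : State M) (k : Fin (2 * M + 1)) (s : ℝ) :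
    polyA θ (Function.update W k s) =
      polyA θ W + C (s - W k) * polyA θ (Pi.single k 1 : State M) := by
  rw [update_eq_add, polyA_add_smul]

lemma polyB_update {M : ℕ} (θ : ℝ) (W : State M) (k : Fin (2 * M + 1)) (s : ℝ) :
    polyB θ (Function.update W k s) =
      polyB θ W + C (s - W k) * polyB θ (Pi.single k 1 : State M) := by
  rw [update_eq_add, polyB_add_smul]

/-! ### Coefficients -/

lemma State.comp_of_lt {M : ℕ} (w : State M) (k : Fin (2 * M + 1)) : w.comp k = w k := by
  rw [State.comp, dif_pos k.2]

lemma State.comp_of_ge {M : ℕ} (w : State M) {k : ℕ} (hk : 2 * M + 1 ≤ k) : w.comp k = 0 := by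
  simp [State.comp, Nat.not_lt.2 hk]

/-- The components of `f_M`. -/
def momCoef {M : ℕ} (θ : ℝ) (w : State M) (j : ℕ) : ℝ :=
  if j = 0 then (lc 0 θ⁻¹ 0)⁻¹ * w.comp 0 - (posPoly θ⁻¹ 0).eval 0 * w.comp 3
  else if j = 1 ∨ j = 3 then -(posPoly θ⁻¹ j).eval 0 * w.comp 3
  else if j = 2 ∨ j = 4 then -(posPoly θ⁻¹ j).eval 0 * w.comp 4
  else w.comp j

lemma sum_indicator_comp {M : ℕ} (w : State M) (i : ℕ) (c : ℝ) :
    ∑ k ∈ Finset.range (2 * M + 1), (if k = i then c else 0) * w.comp k = c * w.comp i := by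
  simp only [ite_mul, zero_mul, Finset.sum_ite_eq', Finset.mem_range]
  split_ifs with h
  · rfl
  · rw [w.comp_of_ge (by omega), mul_zero]

lemma matDW_mulVec {M : ℕ} (θ : ℝ) (w : State M) (j : Fin (2 * M + 1)) :
    (matDW M θ).mulVec w j = momCoef θ w j := by
  have e : (matDW M θ).mulVec w j = ∑ k ∈ Finset.range (2 * M + 1),
      ((if k = 0 then (if (j : ℕ) = 0 then (lc 0 θ⁻¹ 0)⁻¹ else 0) else 0) * w.comp k +
       (if k = 3 then (if (j : ℕ) = 0 ∨ (j : ℕ) = 1 ∨ (j : ℕ) = 3 then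
          -(posPoly θ⁻¹ j).eval 0 else 0) else 0) * w.comp k +
       (if k = 4 then (if (j : ℕ) = 2 ∨ (j : ℕ) = 4 then
          -(posPoly θ⁻¹ j).eval 0 else 0) else 0) * w.comp k +
       (if k = j then (if 5 ≤ (j : ℕ) then 1 else 0) else 0) * w.comp k) := by
    rw [Finset.sum_range]
    change ∑ k, matDW M θ j k * w k = _
    refine Finset.sum_congr rfl fun k _ => ?_
    rw [← add_mul, ← add_mul, ← add_mul, w.comp_of_lt]
    congr 1
    simp only [matDW, Fin.ext_iff]
    rcases k with ⟨k, hk⟩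
    rcases j with ⟨j, hj⟩
    simp only
    rcases Nat.lt_or_ge k 5 with h5 | h5
    · interval_cases k <;> simp <;> omega
    · have : k ≠ 0 ∧ k ≠ 1 ∧ k ≠ 2 ∧ k ≠ 3 ∧ k ≠ 4 := by omega
      simp only [this, if_false, zero_add, or_self]
      by_cases hjk : j = k
      · simp [hjk, h5]
      · simp [hjk, Ne.symm hjk]
  rw [e]
  simp only [Finset.sum_add_distrib, sum_indicator_comp, momCoef]
  rcases Nat.lt_or_ge (j : ℕ) 5 with h5 | h5
  · generalize (j : ℕ) = i at *
    interval_cases i <;> (simp; try ring)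
  · have : (j : ℕ) ≠ 0 ∧ (j : ℕ) ≠ 1 ∧ (j : ℕ) ≠ 2 ∧ (j : ℕ) ≠ 3 ∧ (j : ℕ) ≠ 4 := by omega
    simp [this, h5]

lemma momCoef_of_ge {M : ℕ} (hM : 1 ≤ M) (θ : ℝ) (w : State M) {j : ℕ} (hj : 2 * M + 1 ≤ j) :
    momCoef θ w j = 0 := by
  have h0 : j ≠ 0 := by omega
  simp only [momCoef, if_neg h0]
  split_ifs with h1 h2
  · rw [w.comp_of_ge (by omega), mul_zero]
  · rw [w.comp_of_ge (by omega), mul_zero]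
  · exact w.comp_of_ge hj

/-- Padding with zeros makes the five exceptional positions available for every M, also for M = 1.
-/
lemma sum_extend (M : ℕ) (f : ℕ → ℝ[X]) (hf : ∀ j, 2 * M + 1 ≤ j → f j = 0) :
    ∑ j : Fin (2 * M + 1), f j =
      (∑ j ∈ Finset.range 5, f j) + ∑ j ∈ Finset.range (2 * M), f (5 + j) := by
  rw [← Finset.sum_range, ← Finset.sum_range_add]
  refine Finset.sum_subset (Finset.range_mono (by omega)) fun j _ hj => hf j ?_
  simpa using hj

lemma polyA_eq {M : ℕ} (hM : 1 ≤ M) (θ : ℝ) (w : State M) :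
    polyA θ w = C ((lc 0 θ⁻¹ 0)⁻¹ * w.comp 0) * orthPoly 0 θ⁻¹ 0
      - C (w.comp 3) * ∑ k ∈ Finset.range 3, C ((orthPoly 0 θ⁻¹ k).eval 0) * orthPoly 0 θ⁻¹ k
      + ∑ j ∈ Finset.range (2 * M), if Odd (5 + j) then
          C (w.comp (5 + j)) * orthPoly 0 θ⁻¹ ((5 + j + 1) / 2) else 0 := by
  simp only [polyA, matDW_mulVec]
  rw [sum_extend M (fun j => if j = 0 ∨ Odd j then C (momCoef θ w j) * posPoly θ⁻¹ j else 0)]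
  · congr 1
    · simp only [Finset.sum_range_succ, Finset.sum_range_zero]
      simp [momCoef, posPoly, show Odd 3 from ⟨1, rfl⟩, show ¬ Odd 2 by decide,
        show ¬ Odd 4 by decide]
      ring
    · refine Finset.sum_congr rfl fun j _ => ?_
      have h : momCoef θ w (5 + j) = w.comp (5 + j) := by
        have : 5 + j ≠ 0 ∧ 5 + j ≠ 1 ∧ 5 + j ≠ 2 ∧ 5 + j ≠ 3 ∧ 5 + j ≠ 4 := by omega
        simp only [momCoef, this, if_false, or_self]
      have h0 : 5 + j ≠ 0 := by omega
      simp only [h, posPoly, h0, false_or]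
      split_ifs <;> rfl
  · intro j hj
    simp [momCoef_of_ge hM θ w hj]

lemma polyB_eq {M : ℕ} (hM : 1 ≤ M) (θ : ℝ) (w : State M) :
    polyB θ w = -(C (w.comp 4) *
        ∑ k ∈ Finset.range 2, C ((orthPoly 1 θ⁻¹ k).eval 0) * orthPoly 1 θ⁻¹ k)
      + ∑ j ∈ Finset.range (2 * M), if Odd (5 + j) then 0 else
          C (w.comp (5 + j)) * orthPoly 1 θ⁻¹ ((5 + j) / 2 - 1) := by
  simp only [polyB, matDW_mulVec]
  rw [sum_extend M (fun j => if j = 0 ∨ Odd j then 0 else C (momCoef θ w j) * posPoly θ⁻¹ j)]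
  · congr 1
    · simp only [Finset.sum_range_succ, Finset.sum_range_zero]
      simp [momCoef, posPoly, show Odd 3 from ⟨1, rfl⟩, show ¬ Odd 2 by decide,
        show ¬ Odd 4 by decide]
      ring
    · refine Finset.sum_congr rfl fun j _ => ?_
      have h : momCoef θ w (5 + j) = w.comp (5 + j) := by
        have : 5 + j ≠ 0 ∧ 5 + j ≠ 1 ∧ 5 + j ≠ 2 ∧ 5 + j ≠ 3 ∧ 5 + j ≠ 4 := by omega
        simp only [momCoef, this, if_false, or_self]
      have h0 : 5 + j ≠ 0 := by omega
      simp only [h, posPoly, h0, false_or]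
      split_ifs <;> rfl
  · intro j hj
    simp [momCoef_of_ge hM θ w hj]

/-- The low moments of the scalar part. -/
lemma wip_polyA {M : ℕ} (hM : 1 ≤ M) {θ : ℝ} (hθ : 0 < θ) (w : State M) {h : ℝ[X]}
    (hh : h.degree < 3) :
    wip 0 θ⁻¹ (polyA θ w) h = w.comp 0 * wip 0 θ⁻¹ 1 h - w.comp 3 * h.eval 0 := by
  have hζ := inv_pos.2 hθ
  have h0 := isONS_orthPoly 0 hζ
  -- The Π column is minus the kernel Σ_{k≤2} P_k(0)P_k, which reproduces h(0) for degree at most 2.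
  -- The remaining terms have index at least 3 and are orthogonal to h.
  rw [wip_eq_wFun 0 hζ, wip_eq_wFun 0 hζ, polyA_eq hM, add_mul, sub_mul, map_add, map_sub,
    mul_assoc (C (w.comp 3)), map_C_mul _ (w.comp 3), h0.reproducing hh, Finset.sum_mul, map_sum,
    Finset.sum_eq_zero, add_zero]
  · congr 1
    have e : orthPoly 0 θ⁻¹ 0 = C (lc 0 θ⁻¹ 0) := by
      conv_lhs => rw [eq_C_of_natDegree_eq_zero (h0.natDegree_eq 0)]
      rw [h0.coeff_self, lc]
    have hl : lc 0 θ⁻¹ 0 ≠ 0 := (h0.lc_pos 0).ne'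
    rw [e, ← C_mul, map_C_mul, one_mul]
    congr 1
    rw [mul_right_comm, inv_mul_cancel₀ hl, one_mul]
  · intro j _
    split_ifs
    · rw [mul_assoc, map_C_mul, mul_comm (orthPoly _ _ _), h0.map_mul_eq_zero, mul_zero]
      refine hh.trans_le ?_
      exact_mod_cast (by omega : 3 ≤ (5 + j + 1) / 2)
    · simp

/-- The low moments of the vector part. -/
lemma wip_polyB {M : ℕ} (hM : 1 ≤ M) {θ : ℝ} (hθ : 0 < θ) (w : State M) {h : ℝ[X]}
    (hh : h.degree < 2) :
    wip 1 θ⁻¹ (polyB θ w) h = -(w.comp 4 * h.eval 0) := by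
  have hζ := inv_pos.2 hθ
  have h0 := isONS_orthPoly 1 hζ
  rw [wip_eq_wFun 1 hζ, polyB_eq hM, add_mul, neg_mul, map_add, map_neg,
    mul_assoc (C (w.comp 4)), map_C_mul _ (w.comp 4), h0.reproducing hh, Finset.sum_mul, map_sum,
    Finset.sum_eq_zero, add_zero]
  intro j _
  split_ifs with hj
  · simp
  · rw [mul_assoc, map_C_mul, mul_comm (orthPoly _ _ _), h0.map_mul_eq_zero, mul_zero]
    refine hh.trans_le ?_
    -- Position 5 belongs to the scalar family; from position 6 on the vector index is at least 2.
    have : 5 + j ≠ 5 := fun h5 => hj (by rw [h5]; decide)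
    exact_mod_cast (by omega : 2 ≤ (5 + j) / 2 - 1)

lemma wip_polyA_posPoly {M : ℕ} {θ : ℝ} (hθ : 0 < θ) (w : State M)
    {j : Fin (2 * M + 1)} (hj : (j : ℕ) = 0 ∨ Odd (j : ℕ)) :
    wip 0 θ⁻¹ (polyA θ w) (posPoly θ⁻¹ j) = momCoef θ w j := by
  have hζ := inv_pos.2 hθ
  have h0 := isONS_orthPoly 0 hζ
  rw [wip_eq_wFun 0 hζ, polyA, Finset.sum_mul, map_sum, Finset.sum_eq_single j]
  · rw [if_pos hj, matDW_mulVec, mul_assoc, map_C_mul, posPoly, if_pos hj, h0.ortho]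
    simp
  · intro i _ hij
    split_ifs with hi
    · rw [mul_assoc, map_C_mul, posPoly, posPoly, if_pos hi, if_pos hj, h0.ortho, if_neg, mul_zero]
      intro h
      apply hij
      rw [Fin.ext_iff]
      simp only [Nat.odd_iff] at hi hj
      omega
    · simp
  · simp

lemma wip_polyB_posPoly {M : ℕ} {θ : ℝ} (hθ : 0 < θ) (w : State M)
    {j : Fin (2 * M + 1)} (hj : ¬ ((j : ℕ) = 0 ∨ Odd (j : ℕ))) :
    wip 1 θ⁻¹ (polyB θ w) (posPoly θ⁻¹ j) = momCoef θ w j := by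
  have hζ := inv_pos.2 hθ
  have h0 := isONS_orthPoly 1 hζ
  rw [wip_eq_wFun 1 hζ, polyB, Finset.sum_mul, map_sum, Finset.sum_eq_single j]
  · rw [if_neg hj, matDW_mulVec, mul_assoc, map_C_mul, posPoly, if_neg hj, h0.ortho]
    simp
  · intro i _ hij
    split_ifs with hi
    · simp
    · rw [mul_assoc, map_C_mul, posPoly, posPoly, if_neg hi, if_neg hj, h0.ortho, if_neg, mul_zero]
      intro h
      apply hij
      rw [Fin.ext_iff]
      simp only [Nat.odd_iff] at hi hj
      omega
  · simp

/-! ### Differentiability in the temperature -/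

lemma polyDiffAt_posPoly {θ : ℝ} (hθ : 0 < θ) (j : ℕ) :
    PolyDiffAt (fun s => posPoly s⁻¹ j) θ := by
  unfold posPoly
  split_ifs
  · exact (polyDiffAt_orthPoly 0 (inv_pos.2 hθ) _).comp_inv hθ.ne'
  · exact (polyDiffAt_orthPoly 1 (inv_pos.2 hθ) _).comp_inv hθ.ne'

/-- Valid without a sign condition on ζ, so that `lc` at index 0 can be replaced by the constant
coefficient as a function before differentiating. -/
lemma natDegree_orthPoly_zero (ℓ : Fin 2) (ζ : ℝ) : (orthPoly ℓ ζ 0).natDegree = 0 := by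
  rw [orthPoly_eq, preOrth]
  simp

lemma differentiableAt_momCoef {M : ℕ} (w : State M) {θ : ℝ} (hθ : 0 < θ) (j : ℕ) :
    DifferentiableAt ℝ (fun s => momCoef s w j) θ := by
  have hP : ∀ i, DifferentiableAt ℝ (fun s => (posPoly s⁻¹ i).eval 0) θ := fun i => by
    simpa only [coeff_zero_eq_eval_zero] using (polyDiffAt_posPoly hθ i).coeff 0
  have hl : DifferentiableAt ℝ (fun s => (lc 0 s⁻¹ 0)⁻¹) θ := by
    refine DifferentiableAt.fun_inv ?_ ((isONS_orthPoly 0 (inv_pos.2 hθ)).lc_pos 0).ne'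
    simp only [lc, leadingCoeff, natDegree_orthPoly_zero]
    exact ((polyDiffAt_orthPoly 0 (inv_pos.2 hθ) 0).comp_inv hθ.ne').coeff 0
  unfold momCoef
  split_ifs
  · exact (hl.mul_const _).fun_sub ((hP 0).mul_const _)
  · exact (hP j).fun_neg.mul_const _
  · exact (hP j).fun_neg.mul_const _
  · exact differentiableAt_const _

lemma polyDiffAt_polyA {M : ℕ} (w : State M) {θ : ℝ} (hθ : 0 < θ) :
    PolyDiffAt (fun s => polyA s w) θ := by
  simp only [polyA, matDW_mulVec]
  refine PolyDiffAt.sum _ fun j _ => ?_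
  split_ifs
  · exact (PolyDiffAt.of_scalar (differentiableAt_momCoef w hθ j)).mul (polyDiffAt_posPoly hθ j)
  · exact PolyDiffAt.const 0 θ

lemma polyDiffAt_polyB {M : ℕ} (w : State M) {θ : ℝ} (hθ : 0 < θ) :
    PolyDiffAt (fun s => polyB s w) θ := by
  simp only [polyB, matDW_mulVec]
  refine PolyDiffAt.sum _ fun j _ => ?_
  split_ifs
  · exact PolyDiffAt.const 0 θ
  · exact (PolyDiffAt.of_scalar (differentiableAt_momCoef w hθ j)).mul (polyDiffAt_posPoly hθ j)

/-! ### Invertibility of the coefficient matrix -/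

section Columns

variable {M : ℕ}

lemma vel_update (hM : 1 ≤ M) (W : State M) (k : Fin (2 * M + 1)) (s : ℝ) :
    State.vel (Function.update W k s) = if (k : ℕ) = 1 then s else W.vel := by
  have h : 1 < 2 * M + 1 := by omega
  simp only [State.vel, State.comp, dif_pos h, Function.update_apply, Fin.ext_iff, eq_comm]

lemma theta_update (hM : 1 ≤ M) (W : State M) (k : Fin (2 * M + 1)) (s : ℝ) :
    State.theta (Function.update W k s) = if (k : ℕ) = 2 then s else W.theta := by
  have h : 2 < 2 * M + 1 := by omega
  simp only [State.theta, State.comp, dif_pos h, Function.update_apply, Fin.ext_iff, eq_comm]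

lemma hasDerivAt_projDist_linear (hM : 1 ≤ M) (W : State M) {k : Fin (2 * M + 1)}
    (h1 : (k : ℕ) ≠ 1) (h2 : (k : ℕ) ≠ 2) (p : ℝ) :
    HasDerivAt (fun s => projDist (M := M) (Function.update W k s) p)
      (mix W.vel W.theta (polyA W.theta (Pi.single k 1 : State M))
        (polyB W.theta (Pi.single k 1 : State M)) p) (W k) := by
  simp only [projDist_eq, vel_update hM, theta_update hM, if_neg h1, if_neg h2, polyA_update,
    polyB_update]
  have e : ∀ (A B A' B' : ℝ[X]), (fun s => mix W.vel W.theta (A + C (s - W k) * A')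
      (B + C (s - W k) * B') p) = fun s =>
      mix W.vel W.theta A B p + (s - W k) * mix W.vel W.theta A' B' p := by
    intro A B A' B'
    funext s
    simp only [mix, eval_add, eval_mul, eval_C]
    ring
  rw [e]
  simpa using (((hasDerivAt_id (W k)).sub_const (W k)).mul_const
    (mix W.vel W.theta (polyA W.theta (Pi.single k 1 : State M))
      (polyB W.theta (Pi.single k 1 : State M)) p)).const_add
        (mix W.vel W.theta (polyA W.theta W) (polyB W.theta W) p)

lemma hasDerivAt_projDist_vel (hM : 1 ≤ M) (W : State M) (hu : |W.vel| < 1)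
    {k : Fin (2 * M + 1)} (hk : (k : ℕ) = 1) (p : ℝ) :
    HasDerivAt (fun s => projDist (M := M) (Function.update W k s) p)
      (mix W.vel W.theta (velA W.vel W.theta⁻¹ (polyB W.theta W))
        (velB W.vel W.theta⁻¹ (polyA W.theta W)) p) (W k) := by
  have h2 : (k : ℕ) ≠ 2 := by omega
  have hv : W k = W.vel := by rw [State.vel, ← hk, W.comp_of_lt]
  simp only [projDist_eq, vel_update hM, theta_update hM, if_pos hk, if_neg h2, polyA_update,
    polyB_update, polyA_single _ (Or.inl hk), polyB_single _ (Or.inl hk), mul_zero, add_zero]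
  rw [hv]
  exact hasDerivAt_mix_vel hu _ _ _ p

lemma hasDerivAt_projDist_theta (hM : 1 ≤ M) (W : State M) {F G : ℝ[X]}
    (hFG : ∀ u p, HasDerivAt (fun s => mix u s (polyA s W) (polyB s W) p)
      (mix u W.theta F G p) W.theta) {k : Fin (2 * M + 1)} (hk : (k : ℕ) = 2) (p : ℝ) :
    HasDerivAt (fun s => projDist (M := M) (Function.update W k s) p)
      (mix W.vel W.theta F G p) (W k) := by
  have h1 : (k : ℕ) ≠ 1 := by omega
  have hv : W k = W.theta := by rw [State.theta, ← hk, W.comp_of_lt]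
  simp only [projDist_eq, vel_update hM, theta_update hM, if_pos hk, if_neg h1, polyA_update,
    polyB_update, polyA_single _ (Or.inr hk), polyB_single _ (Or.inr hk), mul_zero, add_zero]
  rw [hv]
  exact hFG _ p

/-- The derivative of the projected distribution in the direction of `W_k`. -/
lemma hasDerivAt_projDist (hM : 1 ≤ M) (W : State M) (hu : |W.vel| < 1) {F G : ℝ[X]}
    (hFG : ∀ u p, HasDerivAt (fun s => mix u s (polyA s W) (polyB s W) p)
      (mix u W.theta F G p) W.theta) (k : Fin (2 * M + 1)) (p : ℝ) :
    HasDerivAt (fun s => projDist (M := M) (Function.update W k s) p)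
      (mix W.vel W.theta
        (polyA W.theta (Pi.single k 1 : State M) +
          (C (if (k : ℕ) = 1 then 1 else 0) * velA W.vel W.theta⁻¹ (polyB W.theta W) +
            C (if (k : ℕ) = 2 then 1 else 0) * F))
        (polyB W.theta (Pi.single k 1 : State M) +
          (C (if (k : ℕ) = 1 then 1 else 0) * velB W.vel W.theta⁻¹ (polyA W.theta W) +
            C (if (k : ℕ) = 2 then 1 else 0) * G)) p) (W k) := by
  by_cases h1 : (k : ℕ) = 1
  · have h2 : (k : ℕ) ≠ 2 := by omega
    simpa [h1, polyA_single _ (Or.inl h1), polyB_single _ (Or.inl h1)]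
      using hasDerivAt_projDist_vel hM W hu h1 p
  · by_cases h2 : (k : ℕ) = 2
    · simpa [h2, polyA_single _ (Or.inr h2), polyB_single _ (Or.inr h2)]
        using hasDerivAt_projDist_theta hM W hFG h2 p
    · simpa [h1, h2] using hasDerivAt_projDist_linear hM W h1 h2 p

/-- Collects the columns of D into one polynomial: columns 1 and 2 contribute the velocity and
temperature derivatives, `L` the linear dependence. -/
lemma sum_column (w : State M) (L : State M →ₗ[ℝ] ℝ[X]) (V F : ℝ[X]) :
    ∑ k : Fin (2 * M + 1), C (w k) * (L (Pi.single k 1) +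
      (C (if (k : ℕ) = 1 then 1 else 0) * V + C (if (k : ℕ) = 2 then 1 else 0) * F)) =
      L w + (C (w.comp 1) * V + C (w.comp 2) * F) := by
  have hw : w = ∑ k, w k • (Pi.single k 1 : State M) := by
    funext j
    simp [Finset.sum_apply, Pi.single_apply]
  have hL : L w = ∑ k, C (w k) * L (Pi.single k 1) := by
    conv_lhs => rw [hw]
    simp only [map_sum, map_smul, smul_eq_C_mul]
  have hs : ∀ i : ℕ, ∀ V : ℝ[X], ∑ k : Fin (2 * M + 1),
      C (w k) * (C (if (k : ℕ) = i then (1 : ℝ) else 0) * V) = C (w.comp i) * V := by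
    intro i V
    have h := sum_indicator_comp w i 1
    rw [Finset.sum_range, one_mul] at h
    rw [← h, map_sum, Finset.sum_mul]
    refine Finset.sum_congr rfl fun k _ => ?_
    rw [w.comp_of_lt, C_mul]
    ring
  simp only [mul_add, Finset.sum_add_distrib, hs, hL]

lemma matD_mulVec_scalar (hM : 1 ≤ M) (W : State M) (hu : |W.vel| < 1) (hθ : 0 < W.theta)
    {F G : ℝ[X]} (hFG : ∀ u p, HasDerivAt (fun s => mix u s (polyA s W) (polyB s W) p)
      (mix u W.theta F G p) W.theta) (w : State M) {j : Fin (2 * M + 1)}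
    (hj : (j : ℕ) = 0 ∨ Odd (j : ℕ)) :
    (matD W).mulVec w j = wip 0 W.theta⁻¹ (polyA W.theta w +
      (C (w.comp 1) * velA W.vel W.theta⁻¹ (polyB W.theta W) + C (w.comp 2) * F))
        (posPoly W.theta⁻¹ j) := by
  have hζ := inv_pos.2 hθ
  have e := sum_column w (polyAL W.theta) (velA W.vel W.theta⁻¹ (polyB W.theta W)) F
  change _ = polyA W.theta w + _ at e
  rw [← e, wip_eq_wFun 0 hζ, Finset.sum_mul, map_sum]
  change ∑ k, matD W j k * w k = _
  refine Finset.sum_congr rfl fun k _ => ?_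
  simp only [matD, (hasDerivAt_projDist hM W hu hFG k _).deriv, basisFn_of_scalar _ _ hj]
  rw [mul_assoc, map_C_mul, mul_comm]
  congr 1
  refine (gip_mix hu hθ _ _ _ _).trans ?_
  rw [wip_eq_wFun 0 hζ, wip_eq_wFun 1 hζ, mul_zero, map_zero, add_zero]
  rfl

lemma matD_mulVec_vector (hM : 1 ≤ M) (W : State M) (hu : |W.vel| < 1) (hθ : 0 < W.theta)
    {F G : ℝ[X]} (hFG : ∀ u p, HasDerivAt (fun s => mix u s (polyA s W) (polyB s W) p)
      (mix u W.theta F G p) W.theta) (w : State M) {j : Fin (2 * M + 1)}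
    (hj : ¬ ((j : ℕ) = 0 ∨ Odd (j : ℕ))) :
    (matD W).mulVec w j = wip 1 W.theta⁻¹ (polyB W.theta w +
      (C (w.comp 1) * velB W.vel W.theta⁻¹ (polyA W.theta W) + C (w.comp 2) * G))
        (posPoly W.theta⁻¹ j) := by
  have hζ := inv_pos.2 hθ
  have e := sum_column w (polyBL W.theta) (velB W.vel W.theta⁻¹ (polyA W.theta W)) G
  change _ = polyB W.theta w + _ at e
  rw [← e, wip_eq_wFun 1 hζ, Finset.sum_mul, map_sum]
  change ∑ k, matD W j k * w k = _
  refine Finset.sum_congr rfl fun k _ => ?_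
  simp only [matD, (hasDerivAt_projDist hM W hu hFG k _).deriv, basisFn_of_vector _ _ hj]
  rw [mul_assoc, map_C_mul, mul_comm]
  congr 1
  refine (gip_mix hu hθ _ _ _ _).trans ?_
  rw [wip_eq_wFun 0 hζ, wip_eq_wFun 1 hζ, mul_zero, map_zero, zero_add]
  rfl

end Columns

/-! ### Low moments and the kernel of D -/

/-- The temperature derivative of `(1, h)_{ω^{(0)}}`. -/
def thetaDeriv (θ : ℝ) (h : ℝ[X]) : ℝ :=
  (θ ^ 2)⁻¹ * (expMom θ⁻¹ (X * h) * expMom θ⁻¹ X - expMom θ⁻¹ h * expMom θ⁻¹ (X * X)) /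
    expMom θ⁻¹ X ^ 2

lemma hasDerivAt_wip_one {θ : ℝ} (hθ : 0 < θ) (h : ℝ[X]) :
    HasDerivAt (fun s => wip 0 s⁻¹ 1 h) (thetaDeriv θ h) θ := by
  have hζ := inv_pos.2 hθ
  have hm : ∀ f : ℝ[X], HasDerivAt (fun s : ℝ => expMom s⁻¹ f)
      (-expMom θ⁻¹ (X * f) * -(θ ^ 2)⁻¹) θ := fun f =>
    (hasDerivAt_expMom hζ f).comp θ (hasDerivAt_inv hθ.ne')
  simp only [wip_eq, Fin.val_zero, pow_zero, one_mul]
  refine ((hm h).fun_div (hm X) (expMom_X_pos hζ).ne').congr_deriv ?_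
  rw [thetaDeriv]
  ring

/-- The normalization by K₁ makes (1, x) equal to 1 for every temperature. -/
lemma thetaDeriv_X (θ : ℝ) : thetaDeriv θ X = 0 := by
  rw [thetaDeriv]; ring

/-- Strict Cauchy-Schwarz inequality for `expMom`. -/
lemma expMom_mul_sq_lt {ζ : ℝ} (hζ : 0 < ζ) {f : ℝ[X]} (hf : f ≠ 0)
    (hpos : ∀ x : ℝ, 1 ≤ x → 0 ≤ f.eval x) :
    expMom ζ (X * f) ^ 2 < expMom ζ f * expMom ζ (X * (X * f)) := by
  have h0 := expMom_pos hζ hf hpos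
  -- c is the mean of x under the density f, and the variance integral of f·(x - c)² is positive.
  set c := expMom ζ (X * f) / expMom ζ f with hc
  have hne : f * (X - C c) ^ 2 ≠ 0 := mul_ne_zero hf (pow_ne_zero _ (X_sub_C_ne_zero c))
  have h1 := expMom_pos hζ hne fun x hx => by
    rw [eval_mul, eval_pow]
    exact mul_nonneg (hpos x hx) (sq_nonneg _)
  have e : f * (X - C c) ^ 2 = X * (X * f) + (C (-(2 * c)) * (X * f) + C (c ^ 2) * f) := by
    rw [C_neg, C_mul, C_pow]
    have : (C (2 : ℝ) : ℝ[X]) = 2 := rfl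
    rw [this]
    ring
  rw [e, expMom_add hζ, expMom_add hζ, expMom_C_mul, expMom_C_mul] at h1
  have hc' : expMom ζ (X * f) = c * expMom ζ f := by rw [hc, div_mul_cancel₀ _ h0.ne']
  rw [hc'] at h1 ⊢
  nlinarith

/-- The numerator is positive by the strict Cauchy-Schwarz inequality with density x. -/
lemma thetaDeriv_X_sq_ne_zero {θ : ℝ} (hθ : 0 < θ) : thetaDeriv θ (X * X) ≠ 0 := by
  have hζ := inv_pos.2 hθ
  have h := expMom_mul_sq_lt hζ (X_ne_zero (R := ℝ)) fun x hx => by rw [eval_X]; linarith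
  have h1 := expMom_X_pos hζ
  refine ne_of_gt (div_pos (mul_pos (by positivity) ?_) (by positivity))
  nlinarith

/-- Cauchy-Schwarz with density 1; here the sign is negative. -/
lemma thetaDeriv_one_ne_zero {θ : ℝ} (hθ : 0 < θ) : thetaDeriv θ 1 ≠ 0 := by
  have hζ := inv_pos.2 hθ
  have h := expMom_mul_sq_lt hζ (one_ne_zero (α := ℝ[X])) fun x hx => by rw [eval_one]; norm_num
  rw [mul_one] at h
  have h1 := expMom_X_pos hζ
  refine ne_of_lt (div_neg_of_neg_of_pos (mul_neg_of_pos_of_neg (by positivity) ?_)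
    (by positivity))
  rw [mul_one]
  nlinarith

lemma orthPoly_zero_eq_posPoly (ζ : ℝ) (n : ℕ) :
    orthPoly 0 ζ n = posPoly ζ (2 * n - 1) ∧ (2 * n - 1 = 0 ∨ Odd (2 * n - 1)) := by
  have h : 2 * n - 1 = 0 ∨ Odd (2 * n - 1) := by
    rcases Nat.eq_zero_or_pos n with rfl | hn
    · left; rfl
    · right; rw [Nat.odd_iff]; omega
  refine ⟨?_, h⟩
  rw [posPoly, if_pos h]
  congr 1
  omega

lemma orthPoly_one_eq_posPoly (ζ : ℝ) (n : ℕ) :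
    orthPoly 1 ζ n = posPoly ζ (2 * n + 2) ∧ ¬ (2 * n + 2 = 0 ∨ Odd (2 * n + 2)) := by
  have h : ¬ (2 * n + 2 = 0 ∨ Odd (2 * n + 2)) := by
    rw [Nat.odd_iff]; omega
  refine ⟨?_, h⟩
  rw [posPoly, if_neg h]
  congr 1
  omega

lemma map_mul_eq_zero_of_basis {Λ : ℝ[X] →ₗ[ℝ] ℝ} {P : ℕ → ℝ[X]} (hP : IsONS Λ P) {N : ℕ}
    {f : ℝ[X]} (hf : ∀ n < N, Λ (f * P n) = 0) {h : ℝ[X]} (hh : h.degree < N) :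
    Λ (f * h) = 0 := by
  rw [hP.expansion hh, Finset.mul_sum, map_sum]
  refine Finset.sum_eq_zero fun n hn => ?_
  rw [mul_left_comm, map_C_mul, hf n (Finset.mem_range.1 hn), mul_zero]

/-- A kernel vector annihilates all moments against test polynomials of degree at most M in the
scalar part and at most M - 1 in the vector part. Tests of low degree form a triangular system for
its first five components. -/
theorem isUnit_det_matD {M : ℕ} (hM : 1 ≤ M) (W : State M) (hρ : 0 < W.rho) (hu : |W.vel| < 1)
    (hθ : 0 < W.theta) (hbulk : -(W.rho * W.theta) < W.bulk) : IsUnit (matD W).det := by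
  have hζ := inv_pos.2 hθ
  obtain ⟨F, G, hFG, hF, hG⟩ := exists_hasDerivAt_mix_theta hθ (polyDiffAt_polyA W hθ)
    (polyDiffAt_polyB W hθ)
  set θ := W.theta with hθd
  set u := W.vel with hud
  have hp := expMom_X_pos hζ
  have hU : U0 u ^ 2 ≠ 0 := pow_ne_zero 2 (U0_pos hu).ne'
  -- `F` is known only through these moments: the identity `wip_polyA` holds for all s > 0 and is
  -- differentiated in s. Its Π term is constant in s and drops out.
  have hFm : ∀ h : ℝ[X], h.degree < 3 → wFun 0 hζ (F * h) = W.rho * thetaDeriv θ h := by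
    intro h hh
    rw [← wip_eq_wFun]
    refine (hF h).unique ?_
    refine (((hasDerivAt_wip_one hθ h).const_mul W.rho).sub_const
      (W.comp 3 * h.eval 0)).congr_of_eventuallyEq ?_
    filter_upwards [Ioi_mem_nhds hθ] with s hs using wip_polyA hM hs W hh
  have hGm : ∀ h : ℝ[X], h.degree < 2 → wFun 1 hζ (G * h) = 0 := by
    intro h hh
    rw [← wip_eq_wFun]
    refine (hG h).unique ?_
    refine (hasDerivAt_const θ (-(W.comp 4 * h.eval 0))).congr_of_eventuallyEq ?_
    filter_upwards [Ioi_mem_nhds hθ] with s hs using wip_polyB hM hs W hh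
  rw [isUnit_iff_ne_zero]
  intro hdet
  obtain ⟨w, hw, hw0⟩ : ∃ w : State M, w ≠ 0 ∧ (matD W).mulVec w = 0 :=
    Matrix.exists_mulVec_eq_zero_iff.2 hdet
  apply hw
  -- The bound 3 makes the low moments explicit; the bound M + 1 ensures that the rows of D control
  -- the test polynomial.
  have hA : ∀ h : ℝ[X], h.degree < 3 → h.degree < (M + 1 : ℕ) →
      w.comp 0 * wFun 0 hζ h - w.comp 3 * h.eval 0 + (w.comp 1 * (-U0 u ^ 2 *
        wFun 1 hζ (polyB θ W * derivative h)) + w.comp 2 * (W.rho * thetaDeriv θ h)) = 0 := by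
    intro h hh hh'
    have ht := map_mul_eq_zero_of_basis (isONS_orthPoly 0 hζ) (N := M + 1)
      (f := polyA θ w + (C (w.comp 1) * velA u θ⁻¹ (polyB θ W) + C (w.comp 2) * F))
      (fun n hn => by
        obtain ⟨h1, h2⟩ := orthPoly_zero_eq_posPoly θ⁻¹ n
        have h3 := matD_mulVec_scalar hM W hu hθ hFG w (j := ⟨2 * n - 1, by omega⟩) h2
        rw [hw0] at h3
        rw [h1, ← wip_eq_wFun]
        exact h3.symm) hh'
    have hA0 := wip_polyA hM hθ w hh
    rw [wip_eq_wFun 0 hζ, wip_eq_wFun 0 hζ, one_mul] at hA0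
    rw [add_mul, add_mul, map_add, map_add, mul_assoc, mul_assoc, map_C_mul, map_C_mul,
      wFun_velA_mul, hFm h hh, hA0] at ht
    exact ht
  have hB : ∀ h : ℝ[X], h.degree < 2 → h.degree < (M : ℕ) →
      -(w.comp 4 * h.eval 0) + w.comp 1 * (-U0 u ^ 2 *
        wFun 0 hζ (polyA θ W * (X * h + (X ^ 2 - 1) * derivative h))) = 0 := by
    intro h hh hh'
    have ht := map_mul_eq_zero_of_basis (isONS_orthPoly 1 hζ) (N := M)
      (f := polyB θ w + (C (w.comp 1) * velB u θ⁻¹ (polyA θ W) + C (w.comp 2) * G))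
      (fun n hn => by
        obtain ⟨h1, h2⟩ := orthPoly_one_eq_posPoly θ⁻¹ n
        have h3 := matD_mulVec_vector hM W hu hθ hFG w (j := ⟨2 * n + 2, by omega⟩) h2
        rw [hw0] at h3
        rw [h1, ← wip_eq_wFun]
        exact h3.symm) hh'
    have hB0 := wip_polyB hM hθ w hh
    rw [wip_eq_wFun 1 hζ] at hB0
    rw [add_mul, add_mul, map_add, map_add, mul_assoc, mul_assoc, map_C_mul, map_C_mul,
      wFun_velB_mul, hGm h hh, hB0, mul_zero, add_zero] at ht
    exact ht
  have hAW : ∀ h : ℝ[X], h.degree < 3 →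
      wFun 0 hζ (polyA θ W * h) = W.rho * wFun 0 hζ h - W.bulk * h.eval 0 := by
    intro h hh
    have h1 := wip_polyA hM hθ W hh
    rwa [wip_eq_wFun 0 hζ, wip_eq_wFun 0 hζ, one_mul] at h1
  have hX1 : wFun 0 hζ X = 1 := by rw [wFun_zero_apply, div_self hp.ne']
  have hdX : (X : ℝ[X]).degree < 3 := by rw [degree_X]; norm_num
  have hdX' : (X : ℝ[X]).degree < 2 := by rw [degree_X]; norm_num
  have hd1 : (1 : ℝ[X]).degree < 3 := by rw [degree_one]; norm_num
  have hd1' : (1 : ℝ[X]).degree < 2 := by rw [degree_one]; norm_num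
  have tX := hA X hdX (by rw [degree_X]; exact_mod_cast (by omega : 1 < M + 1))
  have t1 := hA 1 hd1 (by rw [degree_one]; exact_mod_cast (by omega : 0 < M + 1))
  have s1 := hB 1 hd1' (by rw [degree_one]; exact_mod_cast (by omega : 0 < M))
  rw [hX1, thetaDeriv_X, eval_X] at tX
  rw [derivative_one, mul_zero, map_zero, eval_one] at t1
  rw [derivative_one, mul_zero, add_zero, mul_one, hAW X hdX, hX1, eval_X, eval_one] at s1
  have hw1234 : w.comp 0 = 0 ∧ w.comp 1 = 0 ∧ w.comp 2 = 0 ∧ w.comp 3 = 0 ∧ w.comp 4 = 0 := by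
    rcases hM.eq_or_lt with rfl | hM2
    -- For M = 1 the tests x² (scalar) and x (vector) are not available, but the components 3 and 4
    -- are 0 by convention, and testing with 1 determines the velocity and the temperature instead.
    · have w3 : w.comp 3 = 0 := w.comp_of_ge (by norm_num)
      have w4 : w.comp 4 = 0 := w.comp_of_ge (by norm_num)
      have w1 : w.comp 1 = 0 := by
        rw [w4] at s1
        have : w.comp 1 * (U0 u ^ 2 * W.rho) = 0 := by linear_combination -s1
        exact (mul_eq_zero.1 this).resolve_right (mul_ne_zero hU hρ.ne')
      have w0 : w.comp 0 = 0 := by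
        rw [w1] at tX
        linear_combination tX
      refine ⟨w0, w1, ?_, w3, w4⟩
      rw [w0, w1, w3] at t1
      have : w.comp 2 * (W.rho * thetaDeriv θ 1) = 0 := by linear_combination t1
      exact (mul_eq_zero.1 this).resolve_right
        (mul_ne_zero hρ.ne' (thetaDeriv_one_ne_zero hθ))
    · have hdXX : (X * X : ℝ[X]).degree < 3 := by
        rw [degree_mul, degree_X]; exact_mod_cast (by norm_num : 1 + 1 < 3)
      have tXX := hA (X * X) hdXX (by
        rw [degree_mul, degree_X]; exact_mod_cast (by omega : 1 + 1 < M + 1))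
      have sX := hB X hdX' (by rw [degree_X]; exact_mod_cast hM2)
      have hpoly : (X * X + (X ^ 2 - 1) * derivative X : ℝ[X]) = 2 * (X * X) - 1 := by
        rw [derivative_X]; ring
      have hdpoly : (2 * (X * X) - 1 : ℝ[X]).degree < 3 := by
        refine (degree_sub_le _ _).trans_lt (max_lt ?_ hd1)
        have : (2 : ℝ[X]) = C 2 := rfl
        rwa [this, degree_C_mul two_ne_zero]
      have hparts := expMom_by_parts hζ (1 : ℝ[X])
      rw [hpoly, hAW _ hdpoly] at sX
      have hm0 : 0 < wFun 0 hζ (X * X) := isPosFunctional_wFun 0 hζ _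
        (mul_ne_zero X_ne_zero X_ne_zero) fun x _ => by rw [eval_mul]; exact mul_self_nonneg _
      -- Integration by parts with f = 1 gives (1, x) = ζ(1, x² - 1), so x² - 1 has moment θ.
      have hrel : wFun 0 hζ (2 * (X * X) - 1) = wFun 0 hζ (X * X) + θ := by
        have e0 : wFun 0 hζ (X * 1 + (X ^ 2 - 1) * (derivative 1 - C θ⁻¹ * 1)) = 0 := by
          rw [wFun_zero_apply, hparts, zero_div]
        have e1 : (X * 1 + (X ^ 2 - 1) * (derivative 1 - C θ⁻¹ * 1) : ℝ[X]) =
            X - C θ⁻¹ * (X * X - 1) := by rw [derivative_one]; ring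
        rw [e1, map_sub, map_C_mul, hX1] at e0
        have e2 : wFun 0 hζ (X * X - 1) = θ := by
          have hinv : θ * θ⁻¹ = 1 := mul_inv_cancel₀ hθ.ne'
          linear_combination -θ * e0 - wFun 0 hζ (X * X - 1) * hinv
        have e3 : (2 * (X * X) - 1 : ℝ[X]) = X * X + (X * X - 1) := by ring
        rw [e3, map_add, e2]
      have w1 : w.comp 1 = 0 := by
        rw [hrel] at sX
        simp only [eval_sub, eval_mul, eval_X, mul_zero, eval_one] at sX
        -- The test x vanishes at 0 and removes component 4. The bracket is positive by Π > -ρθ and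
        -- the positive second moment.
        have : w.comp 1 * (U0 u ^ 2 * (W.rho * (wFun 0 hζ (X * X) + θ) + W.bulk)) = 0 := by
          linear_combination -sX
        refine (mul_eq_zero.1 this).resolve_right (mul_ne_zero hU (ne_of_gt ?_))
        nlinarith [mul_pos hρ hm0]
      have w0 : w.comp 0 = 0 := by
        rw [w1] at tX
        linear_combination tX
      have w2 : w.comp 2 = 0 := by
        rw [w0, w1, eval_mul, eval_X] at tXX
        have : w.comp 2 * (W.rho * thetaDeriv θ (X * X)) = 0 := by linear_combination tXX
        exact (mul_eq_zero.1 this).resolve_right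
          (mul_ne_zero hρ.ne' (thetaDeriv_X_sq_ne_zero hθ))
      refine ⟨w0, w1, w2, ?_, ?_⟩
      · rw [w0, w1, w2] at t1
        linear_combination -t1
      · rw [w1] at s1
        linear_combination -s1
  obtain ⟨w0, w1, w2, w3, w4⟩ := hw1234
  -- Without the velocity and temperature terms, D w is the coefficient vector of the distribution
  -- of w.
  have hmom : ∀ j : Fin (2 * M + 1), momCoef θ w j = 0 := by
    intro j
    have hj0 := congrFun hw0 j
    by_cases hj : (j : ℕ) = 0 ∨ Odd (j : ℕ)
    · rw [matD_mulVec_scalar hM W hu hθ hFG w hj, w1, w2, C_0, zero_mul, zero_mul, add_zero,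
        add_zero, wip_polyA_posPoly hθ w hj] at hj0
      exact hj0
    · rw [matD_mulVec_vector hM W hu hθ hFG w hj, w1, w2, C_0, zero_mul, zero_mul, add_zero,
        add_zero, wip_polyB_posPoly hθ w hj] at hj0
      exact hj0
  funext j
  rw [← w.comp_of_lt, Pi.zero_apply]
  rcases Nat.lt_or_ge (j : ℕ) 5 with h5 | h5
  · generalize (j : ℕ) = i at h5
    interval_cases i <;> assumption
  · have h := hmom j
    have : (j : ℕ) ≠ 0 ∧ (j : ℕ) ≠ 1 ∧ (j : ℕ) ≠ 2 ∧ (j : ℕ) ≠ 3 ∧ (j : ℕ) ≠ 4 := by omega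
    simpa only [momCoef, this, if_false, or_self] using h

/-! ### The moment system -/

/-- The position of a basis function in the interlaced ordering. -/
def blkPos {M : ℕ} (b : Blk M) : ℕ :=
  Sum.elim (fun n : Fin (M + 1) => 2 * (n : ℕ) - 1) (fun n : Fin M => 2 * (n : ℕ) + 2) b

lemma blkPos_lt {M : ℕ} (b : Blk M) : blkPos b < 2 * M + 1 := by
  rcases b with n | n <;> simp only [blkPos, Sum.elim_inl, Sum.elim_inr] <;> omega

lemma blkPos_injective (M : ℕ) : Function.Injective (blkPos : Blk M → ℕ) := by
  rintro (m | m) (n | n) h <;> simp only [blkPos, Sum.elim_inl, Sum.elim_inr] at h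
  · congr 1
    rw [Fin.ext_iff]
    omega
  · omega
  · omega
  · congr 1
    rw [Fin.ext_iff]
    omega

lemma permMat_transpose_mul (M : ℕ) : (permMat M).transpose * permMat M = 1 := by
  ext b b'
  rw [Matrix.mul_apply, Finset.sum_eq_single ⟨blkPos b, blkPos_lt b⟩]
  · have h1 : permMat M ⟨blkPos b, blkPos_lt b⟩ b = 1 := if_pos rfl
    rw [Matrix.transpose_apply, h1, one_mul, Matrix.one_apply]
    by_cases h : b = b'
    · rw [if_pos h, ← h, h1]
    · rw [if_neg h]
      exact if_neg fun h' => h (blkPos_injective M h')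
  · intro j _ hj
    have : permMat M j b = 0 := if_neg fun h => hj (Fin.ext h)
    rw [Matrix.transpose_apply, this, zero_mul]
  · simp

lemma permMat_mul_transpose (M : ℕ) : permMat M * (permMat M).transpose = 1 :=
  (Matrix.mul_eq_one_comm_of_card_eq _ _ _ (by simp; omega)).1 (permMat_transpose_mul M)

lemma permMat_conj_mulVec {M : ℕ} (A : Matrix (Blk M) (Blk M) ℝ) (y : Blk M → ℝ) :
    (permMat M * A * (permMat M).transpose).mulVec ((permMat M).mulVec y) =
      (permMat M).mulVec (A.mulVec y) := by
  rw [Matrix.mulVec_mulVec, Matrix.mul_assoc, permMat_transpose_mul, Matrix.mul_one,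
    Matrix.mulVec_mulVec]

lemma matMt_mulVec (M : ℕ) (u θ : ℝ) (y : Blk M → ℝ) :
    (matMt M u θ).mulVec ((permMat M).mulVec y) = (permMat M).mulVec
      (U0 u • (matA0 M θ⁻¹).mulVec y - U1 u • (matA1 M θ⁻¹).mulVec y) := by
  rw [matMt, Matrix.add_mulVec, Matrix.smul_mulVec, Matrix.smul_mulVec, permMat_conj_mulVec,
    permMat_conj_mulVec, Matrix.mulVec_sub, Matrix.mulVec_smul, Matrix.mulVec_smul, neg_smul]
  abel

lemma matMx_mulVec (M : ℕ) (u θ : ℝ) (y : Blk M → ℝ) :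
    (matMx M u θ).mulVec ((permMat M).mulVec y) = (permMat M).mulVec
      (U1 u • (matA0 M θ⁻¹).mulVec y - U0 u • (matA1 M θ⁻¹).mulVec y) := by
  rw [matMx, Matrix.add_mulVec, Matrix.smul_mulVec, Matrix.smul_mulVec, permMat_conj_mulVec,
    permMat_conj_mulVec, Matrix.mulVec_sub, Matrix.mulVec_smul, Matrix.mulVec_smul, neg_smul]
  abel

/-- Generalized eigenvalues of an eigensystem are among the listed numbers. -/
lemma IsEigenSystem.exists_eq {ι : Type} [Fintype ι] [DecidableEq ι] {M : ℕ}
    {A0 A1 : Matrix ι ι ℝ} {μ : ℤ → ℝ} {y : ℤ → ι → ℝ} (h : IsEigenSystem M A0 A1 μ y)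
    {v : ι → ℝ} (hv : v ≠ 0) {c : ℝ} (hc : A1.mulVec v = c • A0.mulVec v) :
    ∃ i ∈ Set.Icc (-(M : ℤ)) M, c = μ i := by
  have h0 : (A0⁻¹ * A1).charpoly.eval c = 0 := by
    rw [Matrix.eval_charpoly]
    refine Matrix.exists_mulVec_eq_zero_iff.1 ⟨v, hv, ?_⟩
    rw [Matrix.sub_mulVec, ← Matrix.mulVec_mulVec, hc, Matrix.mulVec_smul,
      Matrix.mulVec_mulVec, Matrix.nonsing_inv_mul _ h.isUnit_det, Matrix.one_mulVec]
    ext j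
    simp [Matrix.scalar_apply]
  rw [h.charpoly_eq, eval_prod, Finset.prod_eq_zero_iff] at h0
  obtain ⟨i, hi, hi0⟩ := h0
  refine ⟨i, by simpa using hi, ?_⟩
  simpa [sub_eq_zero] using hi0

lemma one_sub_mul_pos {u a : ℝ} (hu : |u| < 1) (ha : |a| < 1) : 0 < 1 - u * a := by
  have h : |u * a| < 1 := by
    rw [abs_mul]
    nlinarith [abs_nonneg u, abs_nonneg a]
  linarith [le_abs_self (u * a)]

/-- A kernel vector satisfies A⁰y = u A¹y. For u = 0 this contradicts the invertibility of A⁰;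
otherwise 1/u would be some λ̂, although |uλ̂| < 1. -/
lemma isUnit_det_matMt {M : ℕ} {u θ : ℝ} (hu : |u| < 1) {z : ℤ → ℝ}
    (hz : IsZeroList M θ⁻¹ z)
    (h : IsEigenSystem M (matA0 M θ⁻¹) (matA1 M θ⁻¹) (lamHat z) (genVec M θ⁻¹ z)) :
    IsUnit (matMt M u θ).det := by
  rw [isUnit_iff_ne_zero]
  intro hdet
  obtain ⟨v, hv, hv0⟩ := Matrix.exists_mulVec_eq_zero_iff.2 hdet
  set y := (permMat M).transpose.mulVec v with hy
  have hvy : v = (permMat M).mulVec y := by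
    rw [hy, Matrix.mulVec_mulVec, permMat_mul_transpose, Matrix.one_mulVec]
  have hy0 : y ≠ 0 := fun h0 => hv (by rw [hvy, h0, Matrix.mulVec_zero])
  rw [hvy, matMt_mulVec] at hv0
  have h1 := congrArg (permMat M).transpose.mulVec hv0
  rw [Matrix.mulVec_mulVec, permMat_transpose_mul, Matrix.one_mulVec, Matrix.mulVec_zero, U1_eq,
    mul_comm, mul_smul, ← smul_sub, smul_eq_zero] at h1
  have h2 := sub_eq_zero.1 (h1.resolve_left (U0_pos hu).ne')
  have hu0 : u ≠ 0 := by
    rintro rfl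
    rw [zero_smul] at h2
    exact hy0 (Matrix.eq_zero_of_mulVec_eq_zero h.isUnit_det.ne_zero h2)
  obtain ⟨i, hi, hci⟩ := h.exists_eq hy0 (c := u⁻¹) (by rw [h2, smul_smul, inv_mul_cancel₀ hu0,
    one_smul])
  have h3 := one_sub_mul_pos hu (hz.abs_lamHat_lt_one hi)
  rw [← hci, mul_inv_cancel₀ hu0] at h3
  simp at h3

lemma abs_mobius_lt_one {u a : ℝ} (hu : |u| < 1) (ha : |a| < 1) :
    |(u - a) / (1 - u * a)| < 1 := by
  have h := one_sub_mul_pos hu ha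
  rw [abs_div, abs_of_pos h, div_lt_one h, abs_lt]
  rw [abs_lt] at hu ha
  constructor <;> nlinarith

/-- On `permMat` applied to an eigenvector of the pair, M^t and M^x act as A⁰ followed by the
factors U⁰(1 - uλ̂) and U⁰(u - λ̂), whose quotient is the eigenvalue. The map λ̂ ↦ (u - λ̂)/(1 -
uλ̂) is injective since 1 - u² ≠ 0. -/
theorem isEigenSystem_moment {M : ℕ} (W : State M) (hu : |W.vel| < 1)
    (hD : IsUnit (matD W).det) {z : ℤ → ℝ} (hz : IsZeroList M W.theta⁻¹ z)
    (h : IsEigenSystem M (matA0 M W.theta⁻¹) (matA1 M W.theta⁻¹) (lamHat z)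
      (genVec M W.theta⁻¹ z)) :
    IsEigenSystem M (matB0 W) (matB1 W) (lam W.vel z) (eigVec W z) := by
  have hDr : ∀ i, (matD W).mulVec (eigVec W z i) =
      (permMat M).mulVec (genVec M W.theta⁻¹ z i) := fun i => by
    rw [eigVec, Matrix.mulVec_mulVec, ← Matrix.mul_assoc, Matrix.mul_nonsing_inv _ hD,
      Matrix.one_mul]
  refine isEigenSystem_of_eigen (by simp) ?_ ?_ ?_ ?_
  · rw [matB0, Matrix.det_mul]
    exact (isUnit_det_matMt hu hz h).mul hD
  · intro i hi j hj hij
    refine h.injOn hi hj ?_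
    have hi' := one_sub_mul_pos hu (hz.abs_lamHat_lt_one hi)
    have hj' := one_sub_mul_pos hu (hz.abs_lamHat_lt_one hj)
    rw [lam, lam, div_eq_div_iff hi'.ne' hj'.ne'] at hij
    have h2 : (1 - W.vel ^ 2) * (lamHat z i - lamHat z j) = 0 := by linear_combination -hij
    exact sub_eq_zero.1 ((mul_eq_zero.1 h2).resolve_left (one_sub_sq_pos hu).ne')
  · intro i hi h0
    have h1 := hDr i
    rw [h0, Matrix.mulVec_zero] at h1
    have h2 := congrArg (permMat M).transpose.mulVec h1
    rw [Matrix.mulVec_mulVec, permMat_transpose_mul, Matrix.one_mulVec, Matrix.mulVec_zero] at h2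
    exact h.ne_zero i hi h2.symm
  · intro i hi
    have hi' := one_sub_mul_pos hu (hz.abs_lamHat_lt_one hi)
    rw [matB0, matB1, ← Matrix.mulVec_mulVec, ← Matrix.mulVec_mulVec, hDr, matMx_mulVec,
      matMt_mulVec, h.eigen i hi, smul_smul, smul_smul, ← sub_smul, ← sub_smul,
      Matrix.mulVec_smul, Matrix.mulVec_smul, smul_smul, U1_eq, lam]
    congr 1
    field_simp

end RelMoment

end

theorem mainTheorem2 (M : ℕ) (hM : 1 ≤ M) (W : RelMoment.State M)
    (hρ : 0 < W.rho) (hu : |W.vel| < 1) (hθ : 0 < W.theta)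
    (hbulk : -(W.rho * W.theta) < W.bulk) :
    ∃ z : ℤ → ℝ, RelMoment.IsZeroList M W.theta⁻¹ z ∧
      RelMoment.IsEigenSystem M (RelMoment.matA0 M W.theta⁻¹) (RelMoment.matA1 M W.theta⁻¹)
        (RelMoment.lamHat z) (RelMoment.genVec M W.theta⁻¹ z) ∧
      IsUnit (RelMoment.matD W).det ∧
      RelMoment.IsEigenSystem M (RelMoment.matB0 W) (RelMoment.matB1 W)
        (RelMoment.lam W.vel z) (RelMoment.eigVec W z) ∧
      ∀ i ∈ Set.Icc (-(M : ℤ)) M, |RelMoment.lam W.vel z i| < 1 := by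
  have hζ := inv_pos.2 hθ
  obtain ⟨z, hz⟩ := RelMoment.exists_isZeroList hζ hM
  have hpair := hz.isEigenSystem_pair hζ hM
  have hD := RelMoment.isUnit_det_matD hM W hρ hu hθ hbulk
  exact ⟨z, hz, hpair, hD, RelMoment.isEigenSystem_moment W hu hD hz hpair,
    fun i hi => RelMoment.abs_mobius_lt_one hu (hz.abs_lamHat_lt_one hi)⟩
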